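/- **Model.** Let $G=(V,E)$ be a graph with $|V|=n\ge 2$ and let $Y\in\{\pm1\}^V$ be an unknown ground truth. One observes $X\in\{\pm1\}^E$ with $X_{uv}=Y_uY_v$ with probability $1-p$ and $X_{uv}=-Y_uY_v$ otherwise, and $Z\in\{\pm1\}^V$ with $Z_v=Y_v$ with probability $1-q$ and $Z_v=-Y_v$ otherwise; all measurements are independent, $0<p<q<1/2$, and $\varepsilon=1/2-q$. **Decomposition.** Let $E'\subseteq E$ (the probed edges) be such that $G'=(V,E')$ is connected, and let $T=(\mathcal W,F)$ be a tree decomposition of $G'$ (every vertex lies in some component, both ends of every edge of $G'$ lie in a common component, and $T$ is coherent: if $W_2$ is on the path of $T$ from $W_1$ to $W_3$, then $W_1\cap W_3\subseteq W_2$), non-redundant in the sense that no $W$ is contained in a neighbour of $W$ in $T$. Every $W\in\mathcal W$ has an extended component $W^\star\supseteq W$ such that the induced graph $G'(W^\star)$ is connected; $E'(W^\star)$ is its edge set. Write $\deg(T)$, $\deg(G')$ for maximum degrees, $\mathrm{wid}(T)=\max_W|W|-1$, $\mathrm{wid}^\star(T)=\max_W|W^\star|-1$, $\deg_E^\star(T)=\max_{e\in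 E'}|\{W: e\in E'(W^\star)\}|$, $M=\max_W|E'(W^\star)|$, and $$\mathrm{mincut}^\star(W)=\min\{|\delta_{G'(W^\star)}(S)|: S\subseteq W^\star,\ S\cap W\ne\emptyset,\ W\setminus S\neq\emptyset\},\qquad \Sigma=\sum_{W\in\mathcal W}p^{\lceil \mathrm{mincut}^\star(W)/2\rceil}.$$ **Algorithm** (TreeDecompositionDecoder with failure probability $\delta$). Put $K_n=4^{\mathrm{wid}^\star(T)+2}\,\Sigma+6\deg_E^\star(T)\,M\log(2/\delta)$ and $L_n=\deg(T)K_n$. (1) For each $W$ let $\widetilde Y^{W^\star}\in\{\pm1\}^{W^\star}$ minimize $\sum_{uv\in E'(W^\star)}\mathbf 1\{\widetilde Y_u\widetilde Y_v\ne X_{uv}\}$, and let $\widehat Y^{W^\star}$ be its restriction to $W$. (2) For each $W$ and $s\in\{\pm1\}$ put $\mathrm{Cost}_W[s]=\sum_{v\in W}\mathbf 1\{s\widehat Y^{W^\star}_v\neq Z_v\}$; for each $(W_1,W_2)\in F$ choose $v\in W_1\cap W_2$ and put $S(W_1,W_2)=\widehat Y^{W_1^\star}_v\widehat Y^{W_2^\star}_v$.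 Let $\hat s\in\{\pm1\}^{\mathcal W}$ minimize $\sum_W\mathrm{Cost}_W[s_W]$ subject to $\sum_{(W_1,W_2)\in F}\mathbf 1\{s_{W_1}\ne s_{W_2}S(W_1,W_2)\}\le L_n$. For each $v$ choose $W\ni v$ and output $\widehat Y_v=\hat s_W\widehat Y^{W^\star}_v$. All minimizers and choices are arbitrary, and the error bounds below hold simultaneously for all outputs $\widehat Y$ that can arise from the same $(X,Z)$. **Theorem.** (a) There is a universal constant $C>0$ such that for every $\delta\in(0,1/2]$, with probability at least $1-\delta$ over $X$ and $Z$, $$\sum_{v\in V}\mathbf 1\{\widehat Y_v\ne Y_v\}\le \frac{C}{\varepsilon^2}\,\deg(G')\deg_E^\star(T)\Big(4^{\mathrm{wid}^\star(T)}\,\Sigma+\deg_E^\star(T)\,M\log(1/\delta)\Big)\big(\mathrm{wid}(T)+\deg(T)\log n\big).$$ (b) For every $D$ there is a constant $C_D>0$ such that, if $\deg(T)$, $\deg^\star_E(T)$, $M$, $\mathrm{wid}^\star(T)$ and $\deg(G')$ are at most $D$ and $\delta=1/n$, then with probability at least $1-1/n$ $$\sum_{v\in V}\mathbf 1\{\widehat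 Y_v\ne Y_v\}\le \frac{C_D}{\varepsilon^2}\log n\,\big(\Sigma+\log n\big),$$ and, for every integer $\Delta\ge0$ with $\Delta\le\mathrm{mincut}^\star(W)$ for all $W\in\mathcal W$, with probability at least $1-1/n$ $$\sum_{v\in V}\mathbf 1\{\widehat Y_v\ne Y_v\}\le \frac{C_D}{\varepsilon^2}\log n\,\big(p^{\lceil\Delta/2\rceil}n+\log n\big).$$ (c) The implementation of the algorithm by brute-force enumeration in step (1) and dynamic programming over $T$ (with tables indexed by component, sign and number of violated edges, from an arbitrary root) in step (2), given $L_n$, always returns a possible output of the algorithm. Under the assumptions of (b), for every such $\Delta$, the number of elementary steps it takes is at most $C_D\,(\log n)^2\,\lceil p^{\Delta/2}n\rceil^2\,n$, and at most $C_D\,(\log n)^2\,\lceil p^{\Delta/2}n\rceil\,n$ when $T$ is a path. (One step is an operation on a bounded number of machine words: an arithmetic operation or comparison on signs, indices or natural numbers, an adjacency query, an array access, or the allocation of a cell.) -/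

import Mathlib

open MeasureTheory

namespace TreeDecoding

/-! ## Tree decompositions and their parameters -/

/-- `T` (given by `tree` on the index set `ι`, with component `bag i` at the node `i`) is a
non-redundant tree decomposition of the graph `H`. -/
structure IsTreeDecomposition {V ι : Type*} (H : SimpleGraph V) (tree : SimpleGraph ι)
    (bag : ι → Finset V) : Prop where
  isTree : tree.IsTree
  vertex_inclusion : ∀ v, ∃ i, v ∈ bag i
  edge_inclusion : ∀ u v, H.Adj u v → ∃ i, u ∈ bag i ∧ v ∈ bag i
  coherence : ∀ (i k : ι) (w : tree.Walk i k), w.IsPath → ∀ j ∈ w.support,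
    ∀ v, v ∈ bag i → v ∈ bag k → v ∈ bag j
  nonredundant : ∀ i j, tree.Adj i j → ¬ bag j ⊆ bag i

/-- The parameters of the decoder: the graph `G` (`graph`) on `n` vertices, the graph `G'`
(`probed`) of probed edges, the tree with its `N` components `W` (`bag i`), and the extended
components `W*` (`ext i`). -/
structure Setup (n N : ℕ) where
  graph : SimpleGraph (Fin n)
  probed : SimpleGraph (Fin n)
  tree : SimpleGraph (Fin N)
  bag : Fin N → Finset (Fin n)
  ext : Fin N → Finset (Fin n)
  decGraph : DecidableRel graph.Adj
  decProbed : DecidableRel probed.Adj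
  decTree : DecidableRel tree.Adj

attribute [instance] Setup.decGraph Setup.decProbed Setup.decTree

namespace Setup

variable {n N : ℕ} (P : Setup n N)

/-- `E'(W*)`: the probed edges with both endpoints in the extended component. -/
def extEdges (i : Fin N) : Finset (Sym2 (Fin n)) :=
  P.probed.edgeFinset.filter fun e => ∀ v ∈ e, v ∈ P.ext i

/-- `wid(T)`. -/
def wid : ℕ := (Finset.univ.sup fun i => (P.bag i).card) - 1

/-- `wid*(T)`. -/
def widStar : ℕ := (Finset.univ.sup fun i => (P.ext i).card) - 1

/-- `deg(T)`. -/
def treeDeg : ℕ := P.tree.maxDegree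

/-- `deg*_E(T)`: the largest number of extended components that contain a given probed edge. -/
def edgeDegStar : ℕ :=
  P.probed.edgeFinset.sup fun e => (Finset.univ.filter fun i => e ∈ P.extEdges i).card

/-- `max_W |E'(W*)|`. -/
def maxExtEdges : ℕ := Finset.univ.sup fun i => (P.extEdges i).card

/-- `mincut*(W)`: the least number of edges of `G'(W*)` between `S` and `W* \ S`, over the sets
`S ⊆ W*` that separate two vertices of `W`.  (There is such an `S` as soon as `W` has two
vertices.) -/
noncomputable def mincutStar (i : Fin N) : ℕ :=
  sInf {k | ∃ S ⊆ P.ext i, (S ∩ P.bag i).Nonempty ∧ (P.bag i \ S).Nonempty ∧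
    k = (P.probed.interedges S (P.ext i \ S)).card}

/-- `∑_W p ^ ⌈mincut*(W) / 2⌉`. -/
noncomputable def cutSum (p : ℝ) : ℝ := ∑ i, p ^ ((P.mincutStar i + 1) / 2)

/-- The qualitative part of admissibility. -/
structure IsAdmissible : Prop where
  probed_le : P.probed ≤ P.graph
  isTreeDecomposition : IsTreeDecomposition P.probed P.tree P.bag
  bag_subset_ext : ∀ i, P.bag i ⊆ P.ext i
  ext_connected : ∀ i, (P.probed.induce {v | v ∈ P.ext i}).Connected

/-- The quantitative part of admissibility, together with bounded degree of the probed graph: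
all the quantities that have to be constant are at most `D`. -/
structure BoundedBy (D : ℕ) : Prop where
  treeDeg_le : P.treeDeg ≤ D
  edgeDegStar_le : P.edgeDegStar ≤ D
  maxExtEdges_le : P.maxExtEdges ≤ D
  widStar_le : P.widStar ≤ D
  maxDegree_le : P.probed.maxDegree ≤ D

end Setup

/-! ## The observation model -/

instance : DiscreteMeasurableSpace ℤˣ where
  forall_measurableSet s := by
    refine ⟨Units.val '' s, trivial, ?_⟩
    exact Set.preimage_image_eq s Units.val_injective

/-- The product `y u * y v` of the labels at the two ends of `e = uv`. -/
def edgeProd {V : Type*} (y : V → ℤˣ) (e : Sym2 V) : ℤˣ := (e.map y).mul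

/-- The sign `y`, flipped with probability `p`. -/
noncomputable def noisySign (p : ℝ) (y : ℤˣ) : Measure ℤˣ :=
  ENNReal.ofReal (1 - p) • Measure.dirac y + ENNReal.ofReal p • Measure.dirac (-y)

variable {n N : ℕ}

/-- Edge measurements `X`. -/
abbrev EdgeObs (P : Setup n N) : Type := P.graph.edgeSet → ℤˣ

/-- Vertex measurements `Z`. -/
abbrev VertexObs (n : ℕ) : Type := Fin n → ℤˣ

/-- The law of `(X, Z)` for the ground truth `Y`: all measurements are independent, edge
measurements are flipped with probability `p`, vertex measurements with probability `q`. -/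
noncomputable def obsLaw (P : Setup n N) (Y : Fin n → ℤˣ) (p q : ℝ) :
    Measure (EdgeObs P × VertexObs n) :=
  (Measure.pi fun e : P.graph.edgeSet => noisySign p (edgeProd Y e)).prod
    (Measure.pi fun v => noisySign q (Y v))

/-! ## What the decoder computes -/

namespace Setup

variable (P : Setup n N)

/-- `K_n`, the bound for the number of components on which the first stage fails. -/
noncomputable def errBudget (p δ : ℝ) : ℝ :=
  4 ^ (P.widStar + 2) * P.cutSum p
    + 6 * P.edgeDegStar * P.maxExtEdges * Real.log (2 / δ)

/-- `L_n = deg(T) * K_n`, the number of violated edges that is allowed in the second stage. -/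
noncomputable def treeBudget (p δ : ℝ) : ℝ := P.treeDeg * P.errBudget p δ

/-- The number of edges of `E'(W*)` whose measurement disagrees with the labeling `y`. -/
def disagreements (X : EdgeObs P) (i : Fin N) (y : Fin n → ℤˣ) : ℕ :=
  (Finset.univ.filter fun e : P.graph.edgeSet =>
    (e : Sym2 (Fin n)) ∈ P.extEdges i ∧ edgeProd y e ≠ X e).card

/-- `Cost_W[s]`. -/
def bagCost (Z : VertexObs n) (est : Fin N → Fin n → ℤˣ) (i : Fin N) (s : ℤˣ) : ℕ :=
  ((P.bag i).filter fun v => s * est i v ≠ Z v).card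

/-- The number of edges `(W₁, W₂)` of the tree with `s W₁ ≠ s W₂ * S(W₁, W₂)`, where
`S(W₁, W₂)` is read off at the common vertex `link (W₁, W₂)`. -/
def violations (est : Fin N → Fin n → ℤˣ) (link : Sym2 (Fin N) → Fin n) (s : Fin N → ℤˣ) : ℕ :=
  (P.tree.edgeFinset.filter fun e => edgeProd s e ≠ edgeProd (fun i => est i (link e)) e).card

/-- `Yhat` is a possible output of the decoder, for the failure probability `δ` and the input
`X`, `Z`, with some resolution of the arbitrary choices: of the minimizers `est i` (only the
values of `est i` on `W*` matter, and only those on `W` are used), of the common vertices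
`link e` of adjacent components, of the minimizer `s`, and of the component `home v` of each
vertex. -/
def IsOutput (p δ : ℝ) (X : EdgeObs P) (Z : VertexObs n) (Yhat : Fin n → ℤˣ) : Prop :=
  ∃ (est : Fin N → Fin n → ℤˣ) (link : Sym2 (Fin N) → Fin n) (s : Fin N → ℤˣ)
    (home : Fin n → Fin N),
    (∀ i y, P.disagreements X i (est i) ≤ P.disagreements X i y) ∧
    (∀ i j, P.tree.Adj i j → link s(i, j) ∈ P.bag i ∩ P.bag j) ∧
    (P.violations est link s : ℝ) ≤ P.treeBudget p δ ∧
    (∀ s' : Fin N → ℤˣ, (P.violations est link s' : ℝ) ≤ P.treeBudget p δ →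
      ∑ i, P.bagCost Z est i (s i) ≤ ∑ i, P.bagCost Z est i (s' i)) ∧
    (∀ v, v ∈ P.bag (home v)) ∧
    (∀ v, Yhat v = s (home v) * est (home v) v)

end Setup

/-! ## Programs with a step count

A program is a value together with the number of elementary steps spent on it.  Steps add up
under sequencing.  One step pays for an operation on a bounded number of machine words (signs,
vertices, components, natural numbers, pointers): an arithmetic operation, a comparison, an
adjacency query, the allocation of a cell, an access to an array. -/

structure Timed (α : Type) where
  val : α
  time : ℕ

namespace Timed

instance : Monad Timed where
  pure a := ⟨a, 0⟩
  bind x f := ⟨(f x.val).val, x.time + (f x.val).time⟩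

/-- Spend `k` steps. -/
def tick (k : ℕ) : Timed Unit := ⟨(), k⟩

/-- Read an array. -/
def fetch {ι α : Type} (a : ι → α) (i : ι) : Timed α := ⟨a i, 1⟩

/-- Loop over a list; each iteration costs one step more than its body. -/
def forEach {α β : Type} : List α → β → (β → α → Timed β) → Timed β
  | [], b, _ => pure b
  | a :: l, b, f => do
    tick 1
    let b' ← f b a
    forEach l b' f

/-- Fill an array with the index set `Fin m`. -/
def fillFin {α : Type} {m : ℕ} (f : Fin m → Timed α) : Timed (Fin m → α) :=
  ⟨fun i => (f i).val, ∑ i, ((f i).time + 1)⟩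

/-- Fill an array with the indices `0, …, L`. -/
def fillUpTo {α : Type} (L : ℕ) (f : ℕ → Timed α) : Timed (ℕ → α) :=
  ⟨fun k => (f (min k L)).val, ∑ k ∈ Finset.range (L + 1), ((f k).time + 1)⟩

/-- Fill an array with the indices `1, -1`. -/
def fillSign {α : Type} (f : ℤˣ → Timed α) : Timed (ℤˣ → α) := do
  tick 2
  let a ← f 1
  let b ← f (-1)
  pure fun s => if s = 1 then a else b

end Timed

open Timed

namespace Setup

variable (P : Setup n N)

/-! ### First stage -/

/-- All labelings of the vertices in a list (with the value `1` at all other vertices). -/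
def labelings : List (Fin n) → List (Fin n → ℤˣ)
  | [] => [fun _ => 1]
  | v :: l => (labelings l).flatMap fun y => [y, Function.update y v (-1)]

/-- Read one label of a labeling that is stored as a list of `m` pairs (vertex, label). -/
def readLabel (m : ℕ) (y : Fin n → ℤˣ) (v : Fin n) : Timed ℤˣ := do
  tick (m + 1)
  pure (y v)

/-- Read the measurement of the edge `uv`. -/
def readEdge (X : EdgeObs P) (u v : Fin n) : Timed ℤˣ := do
  tick 1
  pure (if h : P.graph.Adj u v then X ⟨s(u, v), h⟩ else 1)

/-- The number of probed edges with ends in the list whose measurement disagrees with `y`. -/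
def energyProg (X : EdgeObs P) (l : List (Fin n)) (y : Fin n → ℤˣ) : Timed ℕ :=
  forEach l 0 fun acc u => forEach l acc fun acc v => do
    tick 2
    if u < v ∧ P.probed.Adj u v then
      let x ← P.readEdge X u v
      let a ← readLabel l.length y u
      let b ← readLabel l.length y v
      tick 3
      pure (if a * b ≠ x then acc + 1 else acc)
    else pure acc

/-- Brute-force search for a labeling with the least number of disagreements. -/
def estimatorProg (X : EdgeObs P) (l : List (Fin n)) : Timed (Fin n → ℤˣ) := do
  -- list all labelings, each of them of length at most `l.length`
  tick (2 ^ (l.length + 1) * (l.length + 1))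
  let e₀ ← P.energyProg X l fun _ => 1
  let best ← forEach (labelings l) (e₀, fun _ => 1) fun (best : ℕ × (Fin n → ℤˣ)) y => do
    let e ← P.energyProg X l y
    tick 1
    pure (if e < best.1 then (e, y) else best)
  pure best.2

/-! ### Costs and signs for the second stage -/

def costProg (Z : VertexObs n) (est : Fin N → Fin n → ℤˣ) (i : Fin N) (s : ℤˣ) : Timed ℕ :=
  forEach ((P.bag i).sort (· ≤ ·)) 0 fun acc v => do
    let y ← readLabel (P.ext i).card (est i) v
    let z ← fetch Z v
    tick 3
    pure (if s * y ≠ z then acc + 1 else acc)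

/-- The first common vertex of two components, found by comparing their vertex lists. -/
def linkProg (i j : Fin N) : Timed (Option (Fin n)) :=
  forEach ((P.bag i).sort (· ≤ ·)) none fun acc v => do
    tick ((P.bag j).card + 2)
    pure (if acc.isNone ∧ v ∈ P.bag j then some v else acc)

/-- `S(W₁, W₂)`. -/
def signProg (est : Fin N → Fin n → ℤˣ) (i j : Fin N) : Timed ℤˣ := do
  let o ← P.linkProg i j
  match o with
  | none => pure 1
  | some v => do
    let a ← readLabel (P.ext i).card (est i) v
    let b ← readLabel (P.ext j).card (est j) v
    tick 1
    pure (a * b)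

/-! ### Dynamic programming over the tree -/

/-- A labeling of some components, stored as a binary tree of pointers. -/
inductive Labels (N : ℕ) : Type
  | single (i : Fin N) (s : ℤˣ) : Labels N
  | join (a b : Labels N) : Labels N

/-- For a sign `s` and a budget `k`: the least cost of a labeling of a subtree whose root has
the label `s`, with at most `k` violated edges, and a labeling with that cost. -/
abbrev Table (N : ℕ) : Type := ℤˣ → ℕ → ℕ × Labels N

def better (a b : ℕ × Labels N) : Timed (ℕ × Labels N) := do
  tick 1
  pure (if b.1 < a.1 then b else a)

/-- Add the costs and join the labelings. -/
def addCells (a b : ℕ × Labels N) : Timed (ℕ × Labels N) := do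
  tick 2
  pure (a.1 + b.1, Labels.join a.2 b.2)

/-- The table of a component without the subtrees below it. -/
def baseTable (L : ℕ) (cost : Fin N → ℤˣ → ℕ) (u : Fin N) : Timed (Table N) :=
  fillSign fun s => fillUpTo L fun _ => do
    tick 2
    pure (cost u s, Labels.single u s)

/-- From the table `g` of a child, the table in terms of the label `t` and the budget `k` of the
parent, with the edge to the parent taken into account; `sg` is the sign of that edge. -/
def messageTable (L : ℕ) (sg : ℤˣ) (g : Table N) : Timed (Table N) :=
  fillSign fun t => fillUpTo L fun k => do
    tick 2
    let a ← fetch (g (t * sg)) k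
    if k = 0 then pure a
    else
      let b ← fetch (g (-(t * sg))) (k - 1)
      better a b

/-- Combine the base table of a component with the message of its first child (one cell of the
base table is enough, because its entries do not depend on the budget). -/
def attachFirst (L : ℕ) (base h : Table N) : Timed (Table N) :=
  fillSign fun s => fillUpTo L fun k => do
    let a ← fetch (base s) 0
    let b ← fetch (h s) k
    addCells a b

/-- Combine the table of a component, with some subtrees attached, with the message of one more
child, over all ways to split the budget. -/
def attachNext (L : ℕ) (g h : Table N) : Timed (Table N) :=
  fillSign fun s => fillUpTo L fun k => do
    let a ← fetch (g s) k
    let b ← fetch (h s) 0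
    let c ← addCells a b
    forEach (List.range k) c fun c j => do
      tick 2
      let a ← fetch (g s) (k - (j + 1))
      let b ← fetch (h s) (j + 1)
      let c' ← addCells a b
      better c c'

/-- The table of the subtree below `u`, where `parent` is the component above `u`, if there is
one.  The recursion depth is at most `fuel`. -/
def solveProg (L : ℕ) (est : Fin N → Fin n → ℤˣ) (cost : Fin N → ℤˣ → ℕ) :
    ℕ → Option (Fin N) → Fin N → Timed (Table N)
  | 0, _, u => baseTable L cost u
  | fuel + 1, parent, u => do
    let base ← baseTable L cost u
    let nbrs := (P.tree.neighborFinset u).sort (· ≤ ·)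
    tick nbrs.length
    match nbrs.filter fun c => parent ≠ some c with
    | [] => pure base
    | c :: cs => do
      let g ← solveProg L est cost fuel (some u) c
      let sg ← P.signProg est u c
      let h ← messageTable L sg g
      let t ← attachFirst L base h
      forEach cs t fun t c => do
        let g ← solveProg L est cost fuel (some u) c
        let sg ← P.signProg est u c
        let h ← messageTable L sg g
        attachNext L t h

/-- Write a labeling into an array. -/
def writeLabels : Labels N → (Fin N → ℤˣ) → Timed (Fin N → ℤˣ)
  | Labels.single i s, a => do
    tick 1
    pure (Function.update a i s)
  | Labels.join l r, a => do
    tick 1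
    let a' ← writeLabels l a
    writeLabels r a'

/-- Minimize the total cost over the labelings of the tree with at most `L` violated edges. -/
def treeDecoder (L : ℕ) (root : Fin N) (est : Fin N → Fin n → ℤˣ) (cost : Fin N → ℤˣ → ℕ) :
    Timed (Fin N → ℤˣ) := do
  let t ← P.solveProg L est cost N none root
  let a ← fetch (t 1) L
  let b ← fetch (t (-1)) L
  let c ← better a b
  let init ← fillFin fun _ => pure 1
  writeLabels c.2 init

/-! ### The decoder -/

/-- For each vertex, a component that contains it. -/
def homeProg (root : Fin N) : Timed (Fin n → Fin N) := do
  let init ← fillFin fun _ => pure root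
  forEach (List.finRange N) init fun h i =>
    forEach ((P.bag i).sort (· ≤ ·)) h fun h v => do
      tick 1
      pure (Function.update h v i)

/-- The decoder with the budget `L` for violated edges.  The tree is given by adjacency lists,
components and extended components by vertex lists, the graphs by adjacency matrices; the tree
is traversed from the component `root`. -/
def decoder (L : ℕ) (root : Fin N) (X : EdgeObs P) (Z : VertexObs n) :
    Timed (Fin n → ℤˣ) := do
  let est ← fillFin fun i => P.estimatorProg X ((P.ext i).sort (· ≤ ·))
  let cost ← fillFin fun i => fillSign fun s => P.costProg Z est i s
  let s ← P.treeDecoder L root est cost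
  let home ← P.homeProg root
  fillFin fun v => do
    let i ← fetch home v
    let a ← fetch s i
    let y ← readLabel (P.ext i).card (est i) v
    tick 1
    pure (a * y)

/-- The decoder with failure probability `δ`, whose budget is the constant `L_n`. -/
noncomputable def treeDecompositionDecoder (p δ : ℝ) (root : Fin N) (X : EdgeObs P)
    (Z : VertexObs n) : Timed (Fin n → ℤˣ) :=
  P.decoder ⌊P.treeBudget p δ⌋₊ root X Z

end Setup

end TreeDecoding

/-!
The optimality of `Ỹ^{W⋆}` means that, if it is wrong on `W` even up to a global sign, then at least
half of the edges of some cut of `G'(W⋆)` that separates `W` are noisy. A union bound over the cuts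
bounds the expected number of such bad components by a multiple of `4^{wid⋆} Σ`. Two components go
bad independently unless their extended components share an edge, which a component does with at
most `deg⋆_E M` others, so a concentration inequality for sparse dependency graphs turns this into
the bound `K_n` with high probability. The signs that make the good components correct then violate
at most `L_n = deg(T) K_n` edges of the tree, so they are feasible for the second stage.

There are few feasible sign patterns, because a pattern is determined by the sign at one component
and the set of violated edges. For each of them, the vertex observations decide between it and the
correct pattern by a biased vote with advantage `ε` per vertex. So, simultaneously for all feasible
patterns, no pattern that disagrees with the truth on many vertices has a smaller cost, and the
minimizer errs on few vertices besides those in bad components.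

In the dynamic program, attaching a child to a component costs a convolution of two tables of length
`L_n + 1`, except for the first child, since the base table of a component does not depend on the
budget. On a path only the root can have a second child, which is why the time becomes linear in the
budget.
-/

namespace TreeDecoding

open Timed

/-! ## Rooted trees -/

section RootedTree

variable {ι : Type*} {T : SimpleGraph ι} {r u v x y : ι}

open Classical in
/-- The parent of `x` in the tree `T` with root `r`: the second vertex of the path from `x` to
`r`.  The root is its own parent. -/
noncomputable def parent (T : SimpleGraph ι) (r x : ι) : ι :=
  if h : Nonempty (T.Path x r) then (h.some : T.Walk x r).snd else x

theorem parent_eq_snd (hT : T.IsTree) {p : T.Walk x r} (hp : p.IsPath) : parent T r x = p.snd := by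
  have hne : Nonempty (T.Path x r) := ⟨⟨p, hp⟩⟩
  rw [parent, dif_pos hne, (hT.isAcyclic.subsingleton_path x r).elim hne.some ⟨p, hp⟩]

theorem parent_root (hT : T.IsTree) (r : ι) : parent T r r = r :=
  parent_eq_snd hT .nil

theorem parent_adj (hT : T.IsTree) (hx : x ≠ r) : T.Adj x (parent T r x) := by
  obtain ⟨p, hp⟩ := (hT.connected x r).exists_isPath
  rw [parent_eq_snd hT hp]
  exact p.adj_snd (SimpleGraph.Walk.not_nil_of_ne hx)

theorem adj_iff_parent (hT : T.IsTree) (r : ι) :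
    T.Adj x y ↔ (x ≠ r ∧ y = parent T r x) ∨ (y ≠ r ∧ x = parent T r y) := by
  refine ⟨fun h => ?_, ?_⟩
  · obtain ⟨p, hp⟩ := (hT.connected x r).exists_isPath
    by_cases hy : y ∈ p.support
    · refine .inl ⟨?_, (hT.isAcyclic.eq_snd_of_adj_start hp h hy).trans (parent_eq_snd hT hp).symm⟩
      rintro rfl
      rw [(SimpleGraph.Walk.isPath_iff_nil.1 hp).eq_nil, SimpleGraph.Walk.mem_support_nil_iff] at hy
      exact h.ne' hy
    · refine .inr ⟨fun hyr => hy (hyr ▸ p.end_mem_support), ?_⟩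
      rw [parent_eq_snd hT (hp.cons (h := h.symm) hy), SimpleGraph.Walk.snd_cons]
  · rintro (⟨h, rfl⟩ | ⟨h, rfl⟩)
    exacts [parent_adj hT h, (parent_adj hT h).symm]

theorem dist_parent_add_one (hT : T.IsTree) (hx : x ≠ r) :
    T.dist r (parent T r x) + 1 = T.dist r x := by
  obtain ⟨p, hp, hlen⟩ := (hT.connected x r).exists_path_of_dist
  have hnil : ¬ p.Nil := SimpleGraph.Walk.not_nil_of_ne hx
  have hcons := p.length_tail_add_one hnil
  have htail := SimpleGraph.dist_le p.tail
  have htri := hT.connected.dist_triangle (u := x) (v := p.snd) (w := r)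
  rw [SimpleGraph.dist_eq_one_iff_adj.2 (p.adj_snd hnil)] at htri
  rw [parent_eq_snd hT hp, SimpleGraph.dist_comm (u := r), SimpleGraph.dist_comm (u := r)]
  omega

theorem dist_iterate_parent (hT : T.IsTree) (r x : ι) (k : ℕ) :
    T.dist r ((parent T r)^[k] x) = T.dist r x - k := by
  induction k with
  | zero => rfl
  | succ k ih =>
    rw [Function.iterate_succ_apply']
    by_cases h : (parent T r)^[k] x = r
    · rw [h, SimpleGraph.dist_self] at ih
      rw [h, parent_root hT, SimpleGraph.dist_self]
      omega
    · have := dist_parent_add_one hT h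
      omega

theorem iterate_parent_of_dist_le (hT : T.IsTree) {k : ℕ} (hk : T.dist r x ≤ k) :
    (parent T r)^[k] x = r :=
  ((hT.connected r _).dist_eq_zero_iff.1
    ((dist_iterate_parent hT r x k).trans (Nat.sub_eq_zero_of_le hk))).symm

theorem edgeFinset_eq_image_parent [Fintype ι] [DecidableEq ι] [DecidableRel T.Adj]
    (hT : T.IsTree) (r : ι) :
    T.edgeFinset = (Finset.univ.erase r).image fun x => s(x, parent T r x) := by
  ext e
  induction e with | _ x y => ?_
  simp only [SimpleGraph.mem_edgeFinset, SimpleGraph.mem_edgeSet, Finset.mem_image,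
    Finset.mem_erase, Finset.mem_univ, and_true, adj_iff_parent hT r, Sym2.eq_iff]
  constructor
  · rintro (⟨h, rfl⟩ | ⟨h, rfl⟩)
    · exact ⟨x, h, .inl ⟨rfl, rfl⟩⟩
    · exact ⟨y, h, .inr ⟨rfl, rfl⟩⟩
  · rintro ⟨z, hz, ⟨rfl, rfl⟩ | ⟨rfl, rfl⟩⟩
    · exact .inl ⟨hz, rfl⟩
    · exact .inr ⟨hz, rfl⟩

theorem injOn_edge_parent (hT : T.IsTree) (r : ι) :
    Set.InjOn (fun x => s(x, parent T r x)) {x | x ≠ r} := by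
  intro x hx y hy h
  rcases Sym2.eq_iff.1 h with ⟨h, -⟩ | ⟨hxy, hyx⟩
  · exact h
  · have hdx := dist_parent_add_one hT hx
    have hdy := dist_parent_add_one hT hy
    rw [hyx] at hdx
    rw [← hxy] at hdy
    omega

theorem card_filter_edgeFinset [Fintype ι] [DecidableEq ι] [DecidableRel T.Adj]
    (hT : T.IsTree) (r : ι) (p : Sym2 ι → Prop) [DecidablePred p] :
    (T.edgeFinset.filter p).card =
      (Finset.univ.filter fun x => x ≠ r ∧ p s(x, parent T r x)).card := by
  rw [edgeFinset_eq_image_parent hT r, Finset.filter_image, Finset.card_image_of_injOn]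
  · congr 1
    ext x
    simp
  · exact (injOn_edge_parent hT r).mono fun x hx => by simp_all

/-- `x` lies in the subtree of `T` that hangs from `u`, when `T` is rooted at `r`. -/
def Below (T : SimpleGraph ι) (r u x : ι) : Prop := ∃ k, (parent T r)^[k] x = u

theorem below_refl (r u : ι) : Below T r u u := ⟨0, rfl⟩

theorem below_root (hT : T.IsTree) (r x : ι) : Below T r r x :=
  ⟨_, iterate_parent_of_dist_le hT le_rfl⟩

namespace Below

theorem of_parent (h : Below T r u (parent T r x)) : Below T r u x :=
  let ⟨k, hk⟩ := h
  ⟨k + 1, hk⟩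

theorem parent_of_ne (h : Below T r u x) (hne : x ≠ u) : Below T r u (parent T r x) := by
  obtain ⟨_ | k, hk⟩ := h
  exacts [absurd hk hne, ⟨k, hk⟩]

theorem dist_le (hT : T.IsTree) (h : Below T r u x) : T.dist r u ≤ T.dist r x := by
  obtain ⟨k, rfl⟩ := h
  rw [dist_iterate_parent hT]
  omega

theorem eq_iterate (hT : T.IsTree) (h : Below T r u x) :
    u = (parent T r)^[T.dist r x - T.dist r u] x := by
  obtain ⟨k, rfl⟩ := h
  rw [dist_iterate_parent hT]
  by_cases hk : k ≤ T.dist r x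
  · rw [Nat.sub_sub_self hk]
  · rw [iterate_parent_of_dist_le hT (Nat.le_of_not_le hk), iterate_parent_of_dist_le hT (by omega)]

theorem eq_of_dist_eq (hT : T.IsTree) (hu : Below T r u x) (hv : Below T r v x)
    (h : T.dist r u = T.dist r v) : u = v := by
  rw [hu.eq_iterate hT, hv.eq_iterate hT, h]

theorem antisymm (hT : T.IsTree) (hxy : Below T r x y) (hyx : Below T r y x) : x = y :=
  hxy.eq_of_dist_eq hT (below_refl r y) ((hxy.dist_le hT).antisymm (hyx.dist_le hT))

theorem eq_and_eq_parent_of_adj (hT : T.IsTree) (hadj : T.Adj x y) (hx : Below T r u x)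
    (hy : ¬ Below T r u y) : x = u ∧ y = parent T r u := by
  rcases (adj_iff_parent hT r).1 hadj with ⟨-, rfl⟩ | ⟨-, rfl⟩
  · obtain rfl : x = u := by_contra fun hne => hy (hx.parent_of_ne hne)
    exact ⟨rfl, rfl⟩
  · exact absurd hx.of_parent hy

theorem mem_support_of_not_below (hT : T.IsTree) (w : T.Walk x y) (hx : Below T r u x)
    (hy : ¬ Below T r u y) : u ∈ w.support ∧ parent T r u ∈ w.support := by
  obtain ⟨d, hd, hfst, hsnd⟩ := w.exists_boundary_dart {z | Below T r u z} hx hy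
  obtain ⟨hu, hpu⟩ := eq_and_eq_parent_of_adj hT d.adj hfst hsnd
  exact ⟨hu ▸ w.dart_fst_mem_support_of_mem_darts hd,
    hpu ▸ w.dart_snd_mem_support_of_mem_darts hd⟩

end Below

theorem below_iff (hT : T.IsTree) :
    Below T r u x ↔ x = u ∨ ∃ c, c ≠ r ∧ parent T r c = u ∧ Below T r c x := by
  constructor
  · rintro ⟨k, hk⟩
    induction k generalizing u with
    | zero => exact .inl hk
    | succ k ih =>
      rw [Function.iterate_succ_apply'] at hk
      by_cases hr : (parent T r)^[k] x = r
      · refine ih (hr.trans ?_)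
        rwa [hr, parent_root hT] at hk
      · exact .inr ⟨_, hr, hk, k, rfl⟩
  · rintro (rfl | ⟨c, -, hc, k, hk⟩)
    · exact below_refl r x
    · exact ⟨k + 1, by rw [Function.iterate_succ_apply', hk, hc]⟩

theorem not_below_parent (hT : T.IsTree) (hx : x ≠ r) : ¬ Below T r x (parent T r x) := fun h => by
  have hle := h.dist_le hT
  have hlt := dist_parent_add_one hT hx
  omega

theorem eq_of_parent_eq_of_below (hT : T.IsTree) {c d : ι} (hc : c ≠ r) (hd : d ≠ r)
    (h : parent T r c = parent T r d) (hcx : Below T r c x) (hdx : Below T r d x) : c = d := by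
  refine hcx.eq_of_dist_eq hT hdx ?_
  rw [← dist_parent_add_one hT hc, ← dist_parent_add_one hT hd, h]

end RootedTree

/-! ## Tree decompositions -/

namespace IsTreeDecomposition

variable {V ι : Type*} {H : SimpleGraph V} {T : SimpleGraph ι} {bag : ι → Finset V} {r j y z : ι}

theorem mem_bag_of_crossing (h : IsTreeDecomposition H T bag) {v : V} (hvy : v ∈ bag y)
    (hvz : v ∈ bag z) (hy : Below T r j y) (hz : ¬ Below T r j z) :
    v ∈ bag j ∧ v ∈ bag (parent T r j) := by
  obtain ⟨w, hw⟩ := (h.isTree.connected y z).exists_isPath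
  obtain ⟨hj, hpj⟩ := hy.mem_support_of_not_below h.isTree w hz
  exact ⟨h.coherence y z w hw j hj v hvy hvz, h.coherence y z w hw _ hpj v hvy hvz⟩

theorem bag_nonempty [Nonempty V] (h : IsTreeDecomposition H T bag) (i : ι) : (bag i).Nonempty := by
  obtain ⟨k, hk⟩ := h.vertex_inclusion (Classical.arbitrary V)
  rcases eq_or_ne i k with rfl | hik
  · exact ⟨_, hk⟩
  · have : Nontrivial ι := ⟨i, k, hik⟩
    obtain ⟨j, hij⟩ := h.isTree.connected.preconnected.exists_adj_of_nontrivial i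
    refine Finset.nonempty_iff_ne_empty.2 fun hempty => h.nonredundant j i hij.symm ?_
    simp only [hempty, Finset.empty_subset]

/-- Every component has a vertex that is missing from its parent, and these vertices are
distinct. -/
theorem card_le [Fintype V] [Fintype ι] [Nonempty V] (h : IsTreeDecomposition H T bag) :
    Fintype.card ι ≤ Fintype.card V := by
  obtain ⟨r⟩ := h.isTree.connected.nonempty
  have hnew (x : ι) : ∃ v ∈ bag x, x ≠ r → v ∉ bag (parent T r x) := by
    rcases eq_or_ne x r with rfl | hx
    · exact (h.bag_nonempty x).imp fun v hv => ⟨hv, fun hx => absurd rfl hx⟩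
    · obtain ⟨v, hv, hv'⟩ := Finset.not_subset.1
        (h.nonredundant _ _ (parent_adj h.isTree hx).symm)
      exact ⟨v, hv, fun _ => hv'⟩
  choose f hf hf_new using hnew
  have hbelow {x y : ι} (hxy : f x = f y) : Below T r x y := by
    by_contra hb
    refine hf_new x (fun hx => hb (hx ▸ below_root h.isTree r y)) ?_
    exact (h.mem_bag_of_crossing (hf x) (hxy ▸ hf y) (below_refl r x) hb).2
  exact Fintype.card_le_of_injective f fun x y hxy =>
    (hbelow hxy).antisymm h.isTree (hbelow hxy.symm)

theorem exists_mem_bag_inter_of_adj (h : IsTreeDecomposition H T bag) (hH : H.Connected)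
    {i j : ι} (hij : T.Adj i j) : ∃ v ∈ bag i, v ∈ bag j := by
  have := hH.nonempty
  obtain ⟨hji, hi⟩ : j ≠ i ∧ i = parent T i j :=
    ((adj_iff_parent h.isTree i).1 hij).resolve_left fun h => h.1 rfl
  by_contra! hdisj
  -- The vertices that occur below `j` would form a union of connected components of `H`.
  have hclosed (u v : V) (huv : H.Adj u v) :
      (∃ y, Below T i j y ∧ u ∈ bag y) → ∃ y, Below T i j y ∧ v ∈ bag y := by
    rintro ⟨y, hy, hu⟩
    obtain ⟨k, hku, hkv⟩ := h.edge_inclusion u v huv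
    by_contra! hk
    obtain ⟨huj, hui⟩ := h.mem_bag_of_crossing hu hku hy fun hb => hk k hb hkv
    exact hdisj u (hi ▸ hui) huj
  obtain ⟨u, hu⟩ := h.bag_nonempty j
  obtain ⟨v, hv⟩ := h.bag_nonempty i
  obtain ⟨w⟩ := hH.preconnected u v
  obtain ⟨y, hy, hvy⟩ : ∃ y, Below T i j y ∧ v ∈ bag y := by
    by_contra hv'
    obtain ⟨d, -, hfst, hsnd⟩ := w.exists_boundary_dart {x | ∃ y, Below T i j y ∧ x ∈ bag y}
      ⟨j, below_refl i j, hu⟩ hv'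
    exact hsnd (hclosed _ _ d.adj hfst)
  have hij' : ¬ Below T i j i := fun hb => not_below_parent h.isTree hji (hi ▸ hb)
  exact hdisj v hv (h.mem_bag_of_crossing hvy hv hy hij').1

end IsTreeDecomposition

/-! ## Parameters of the decoder -/

namespace Setup

variable {n N : ℕ} {P : Setup n N} {i : Fin N}

theorem mem_extEdges {u v : Fin n} :
    s(u, v) ∈ P.extEdges i ↔ P.probed.Adj u v ∧ u ∈ P.ext i ∧ v ∈ P.ext i := by
  simp [extEdges]

theorem card_bag_le (i : Fin N) : (P.bag i).card ≤ P.wid + 1 :=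
  Nat.le_add_of_sub_le <| Nat.sub_le_sub_right
    (Finset.le_sup (f := fun i => (P.bag i).card) (Finset.mem_univ i)) 1

theorem card_ext_le (i : Fin N) : (P.ext i).card ≤ P.widStar + 1 :=
  Nat.le_add_of_sub_le <| Nat.sub_le_sub_right
    (Finset.le_sup (f := fun i => (P.ext i).card) (Finset.mem_univ i)) 1

theorem card_extEdges_le (i : Fin N) : (P.extEdges i).card ≤ P.maxExtEdges :=
  Finset.le_sup (f := fun i => (P.extEdges i).card) (Finset.mem_univ i)

theorem card_ext_of_edge_le {e : Sym2 (Fin n)} (he : e ∈ P.probed.edgeFinset) :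
    (Finset.univ.filter fun i => e ∈ P.extEdges i).card ≤ P.edgeDegStar :=
  Finset.le_sup (f := fun e => (Finset.univ.filter fun i => e ∈ P.extEdges i).card) he

namespace IsAdmissible

variable (hP : P.IsAdmissible)
include hP

theorem wid_le_widStar : P.wid ≤ P.widStar :=
  Nat.sub_le_sub_right
    (Finset.sup_mono_fun fun i _ => Finset.card_le_card (hP.bag_subset_ext i)) 1

theorem card_le (hn : 0 < n) : N ≤ n := by
  have : Nonempty (Fin n) := ⟨⟨0, hn⟩⟩
  simpa only [Fintype.card_fin] using hP.isTreeDecomposition.card_le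

variable (hc : P.probed.Connected) (hn : 2 ≤ n)
include hc hn

theorem exists_adj_mem_bag : ∃ i u v, P.probed.Adj u v ∧ u ∈ P.bag i ∧ v ∈ P.bag i := by
  have : Nontrivial (Fin n) := Fin.nontrivial_iff_two_le.2 hn
  obtain ⟨v, hv⟩ := hc.preconnected.exists_adj_of_nontrivial ⟨0, by omega⟩
  obtain ⟨i, hi⟩ := hP.isTreeDecomposition.edge_inclusion _ _ hv
  exact ⟨i, _, v, hv, hi⟩

theorem one_le_wid : 1 ≤ P.wid := by
  obtain ⟨i, u, v, huv, hu, hv⟩ := hP.exists_adj_mem_bag hc hn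
  have hcard : 1 < (P.bag i).card := Finset.one_lt_card.2 ⟨u, hu, v, hv, huv.ne⟩
  exact Nat.le_of_lt_succ (hcard.trans_le (P.card_bag_le i))

theorem one_le_maxExtEdges : 1 ≤ P.maxExtEdges := by
  obtain ⟨i, u, v, huv, hu, hv⟩ := hP.exists_adj_mem_bag hc hn
  exact (Finset.card_pos.2 ⟨s(u, v), mem_extEdges.2
    ⟨huv, hP.bag_subset_ext i hu, hP.bag_subset_ext i hv⟩⟩).trans_le (P.card_extEdges_le i)

theorem one_le_edgeDegStar : 1 ≤ P.edgeDegStar := by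
  obtain ⟨i, u, v, huv, hu, hv⟩ := hP.exists_adj_mem_bag hc hn
  refine (Finset.card_pos.2 ⟨i, (Finset.mem_filter_univ _).2 <| mem_extEdges.2
    ⟨huv, hP.bag_subset_ext i hu, hP.bag_subset_ext i hv⟩⟩).trans_le (P.card_ext_of_edge_le ?_)
  exact SimpleGraph.mem_edgeFinset.2 huv

theorem one_le_maxDegree : 1 ≤ P.probed.maxDegree := by
  obtain ⟨-, u, v, huv, -⟩ := hP.exists_adj_mem_bag hc hn
  exact ((P.probed.degree_pos_iff_exists_adj u).2 ⟨v, huv⟩).trans_le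
    (P.probed.degree_le_maxDegree u)

theorem exists_mem_extEdges {v : Fin n} (hv : v ∈ P.bag i) :
    ∃ u, P.probed.Adj v u ∧ s(v, u) ∈ P.extEdges i := by
  have hT := hP.isTreeDecomposition
  have hvi := hP.bag_subset_ext i hv
  have : Nontrivial (Fin n) := Fin.nontrivial_iff_two_le.2 hn
  obtain ⟨u, hvu⟩ := hc.preconnected.exists_adj_of_nontrivial v
  obtain ⟨k, hvk, huk⟩ := hT.edge_inclusion v u hvu
  rcases eq_or_ne i k with rfl | hik
  · exact ⟨u, hvu, mem_extEdges.2 ⟨hvu, hvi, hP.bag_subset_ext i huk⟩⟩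
  -- By coherence `v` also lies in a neighbour of `W`, so by non-redundancy `W ≠ {v}`.
  obtain ⟨w, hw⟩ := (hT.isTree.connected i k).exists_isPath
  have hv_snd := hT.coherence i k w hw w.snd (w.getVert_mem_support 1) v hv hvk
  obtain ⟨x, hx, hx_snd⟩ := Finset.not_subset.1
    (hT.nonredundant _ _ (w.adj_snd (SimpleGraph.Walk.not_nil_of_ne hik)).symm)
  have : Nontrivial {y | y ∈ P.ext i} := ⟨⟨v, hvi⟩, ⟨x, hP.bag_subset_ext i hx⟩, fun h =>
    hx_snd ((show v = x from congrArg Subtype.val h) ▸ hv_snd)⟩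
  obtain ⟨⟨z, hz⟩, hvz⟩ := (hP.ext_connected i).preconnected.exists_adj_of_nontrivial ⟨v, hvi⟩
  exact ⟨z, hvz, mem_extEdges.2 ⟨hvz, hvi, hz⟩⟩

theorem card_bags_le (v : Fin n) :
    (Finset.univ.filter fun i => v ∈ P.bag i).card ≤ P.probed.maxDegree * P.edgeDegStar := by
  have hsub : (Finset.univ.filter fun i => v ∈ P.bag i) ⊆ (P.probed.neighborFinset v).biUnion
      fun u => Finset.univ.filter fun i => s(v, u) ∈ P.extEdges i := by
    intro i hi
    obtain ⟨u, hu, he⟩ := hP.exists_mem_extEdges hc hn ((Finset.mem_filter_univ i).1 hi)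
    exact Finset.mem_biUnion.2
      ⟨u, (P.probed.mem_neighborFinset v u).2 hu, (Finset.mem_filter_univ _).2 he⟩
  calc (Finset.univ.filter fun i => v ∈ P.bag i).card
      ≤ P.probed.degree v * P.edgeDegStar :=
        (Finset.card_le_card hsub).trans <| Finset.card_biUnion_le_card_mul _ _ _ fun u hu =>
          P.card_ext_of_edge_le <| SimpleGraph.mem_edgeFinset.2 <|
            (P.probed.mem_neighborFinset v u).1 hu
    _ ≤ P.probed.maxDegree * P.edgeDegStar :=
        Nat.mul_le_mul_right _ (P.probed.degree_le_maxDegree v)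

end IsAdmissible

end Setup

/-! ## Product measures and noisy signs -/

section Pi

variable {E : Type*} [Fintype E] {α : E → Type*} [∀ e, MeasurableSpace (α e)]
  (μ : ∀ e, Measure (α e)) [∀ e, IsProbabilityMeasure (μ e)]

theorem measureReal_pi_le_card_filter_mem_le {B : ∀ e, Set (α e)} {p : ℝ}
    [∀ e, DecidablePred (· ∈ B e)] (F : Finset E) (hB : ∀ e ∈ F, (μ e).real (B e) ≤ p) (a : ℕ) :
    (Measure.pi μ).real {x | a ≤ (F.filter fun e => x e ∈ B e).card} ≤
      F.card.choose a * p ^ a := by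
  have hsub : {x : ∀ e, α e | a ≤ (F.filter fun e => x e ∈ B e).card} ⊆
      ⋃ S ∈ F.powersetCard a, (S : Set E).pi B := by
    intro x hx
    obtain ⟨S, hSF, hS⟩ := Finset.exists_subset_card_eq hx
    refine Set.mem_biUnion (Finset.mem_coe.2 <|
      Finset.mem_powersetCard.2 ⟨hSF.trans (Finset.filter_subset _ _), hS⟩) fun e he => ?_
    exact (Finset.mem_filter.1 (hSF he)).2
  have hS : ∀ S ∈ F.powersetCard a, (Measure.pi μ).real ((S : Set E).pi B) ≤ p ^ a := by
    intro S hS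
    obtain ⟨hSF, rfl⟩ := Finset.mem_powersetCard.1 hS
    rw [measureReal_def, Measure.pi_pi_finset, ENNReal.toReal_prod]
    exact (Finset.prod_le_prod (fun _ _ => measureReal_nonneg) fun e he => hB e (hSF he)).trans_eq
      (Finset.prod_const p)
  calc (Measure.pi μ).real {x | a ≤ (F.filter fun e => x e ∈ B e).card}
      ≤ ∑ S ∈ F.powersetCard a, (Measure.pi μ).real ((S : Set E).pi B) :=
        (measureReal_mono hsub (measure_ne_top _ _)).trans (measureReal_biUnion_finset_le _ _)
    _ ≤ F.card.choose a * p ^ a := by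
        rw [← Finset.card_powersetCard, ← nsmul_eq_mul]
        exact Finset.sum_le_card_nsmul _ _ _ hS

variable [∀ e, Finite (α e)] [∀ e, DiscreteMeasurableSpace (α e)]

theorem indepFun_pi_of_dependsOn {β γ : Type*} [MeasurableSpace β] [MeasurableSpace γ]
    {f : (∀ e, α e) → β} {g : (∀ e, α e) → γ} {S T : Finset E} (hST : Disjoint S T)
    (hf : DependsOn f S) (hg : DependsOn g T) :
    ProbabilityTheory.IndepFun f g (Measure.pi μ) := by
  have : Nonempty β := ⟨f fun e => (μ e).nonempty_of_neZero.some⟩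
  have : Nonempty γ := ⟨g fun e => (μ e).nonempty_of_neZero.some⟩
  obtain ⟨φ, rfl⟩ := dependsOn_iff_exists_comp.1 hf
  obtain ⟨ψ, rfl⟩ := dependsOn_iff_exists_comp.1 hg
  have hind := ProbabilityTheory.iIndepFun_pi (μ := μ) (X := fun _ x => x)
    fun _ => aemeasurable_id
  exact (hind.indepFun_finset S T hST measurable_pi_apply).comp (φ := φ) (ψ := ψ)
    Measurable.of_discrete Measurable.of_discrete

theorem iIndepSet_pi_of_dependsOn {ι : Type*} {A : ι → Set (∀ e, α e)} {F : ι → Finset E}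
    (hA : ∀ i, DependsOn (· ∈ A i) (F i)) (hF : Pairwise (Function.onFun Disjoint F)) :
    ProbabilityTheory.iIndepSet A (Measure.pi μ) := by
  classical
  refine (ProbabilityTheory.iIndepSet_iff_meas_biInter fun i => .of_discrete).2 fun s => ?_
  induction s using Finset.induction_on with
  | empty => simp
  | insert i s hi ih =>
    have hdisj : Disjoint (F i) (s.biUnion F) :=
      (Finset.disjoint_biUnion_right _ _ _).2 fun j hj => hF (ne_of_mem_of_not_mem hj hi).symm
    have hinter : DependsOn (· ∈ ⋂ j ∈ s, A j) (s.biUnion F) := by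
      intro x y hxy
      simp only [Set.mem_iInter, eq_iff_iff]
      refine forall₂_congr fun j hj => (hA j fun e he => hxy e ?_).to_iff
      exact Finset.mem_coe.2 (Finset.mem_biUnion.2 ⟨j, hj, he⟩)
    have hind := indepFun_pi_of_dependsOn μ hdisj (hA i) hinter
    rw [Finset.set_biInter_insert, Finset.prod_insert hi, ← ih]
    simpa [Set.preimage, -Set.mem_iInter] using
      hind.measure_inter_preimage_eq_mul {True} {True} .of_discrete .of_discrete

end Pi

theorem colorable_of_forall_degree_le {V : Type*} [Fintype V] {G : SimpleGraph V}
    [DecidableRel G.Adj] {d : ℕ} (hd : ∀ v, G.degree v ≤ d) : G.Colorable (d + 1) := by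
  classical
  suffices h : ∀ s : Finset V, ∃ c : V → Fin (d + 1), ∀ u ∈ s, ∀ v ∈ s, G.Adj u v → c u ≠ c v by
    obtain ⟨c, hc⟩ := h Finset.univ
    exact ⟨.mk c fun {u v} => hc u (Finset.mem_univ u) v (Finset.mem_univ v)⟩
  intro s
  induction s using Finset.induction_on with
  | empty => exact ⟨fun _ => 0, by simp⟩
  | insert a s ha ih =>
    obtain ⟨c, hc⟩ := ih
    obtain ⟨m, -, hm⟩ : ∃ m ∈ Finset.univ, m ∉ (G.neighborFinset a).image c :=
      Finset.exists_mem_notMem_of_card_lt_card <|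
        Finset.card_image_le.trans_lt (by simpa [Nat.lt_succ_iff] using hd a)
    have hm_ne : ∀ v, G.Adj a v → c v ≠ m := by
      rintro v hv rfl
      exact hm (Finset.mem_image_of_mem c ((G.mem_neighborFinset a v).2 hv))
    refine ⟨Function.update c a m, fun u hu v hv huv => ?_⟩
    rcases Finset.mem_insert.1 hu with rfl | hus <;> rcases Finset.mem_insert.1 hv with rfl | hvs
    · exact absurd rfl huv.ne
    · simpa [huv.ne'] using (hm_ne v huv).symm
    · simpa [huv.ne] using hm_ne u huv.symm
    · simpa [ne_of_mem_of_not_mem hus ha, ne_of_mem_of_not_mem hvs ha] using hc u hus v hvs huv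

section Tail

variable {Ω : Type*} {mΩ : MeasurableSpace Ω} {μ : Measure Ω} [IsProbabilityMeasure μ]

theorem integral_exp_indicator_le {A : Set Ω} (hA : MeasurableSet A) :
    ∫ ω, Real.exp (A.indicator 1 ω) ∂μ ≤ Real.exp ((Real.exp 1 - 1) * μ.real A) := by
  have hexp : ∀ ω, Real.exp (A.indicator 1 ω) = (Real.exp 1 - 1) * A.indicator 1 ω + 1 := by
    intro ω
    by_cases h : ω ∈ A <;> simp [h]
  have hinteg : Integrable (A.indicator (1 : Ω → ℝ)) μ := (integrable_const 1).indicator hA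
  simp_rw [hexp]
  rw [integral_add (hinteg.const_mul _) (integrable_const _), integral_const_mul,
    integral_indicator_one hA, integral_const, probReal_univ, one_smul]
  exact Real.add_one_le_exp _

theorem integrable_exp_sum_indicator_sub_div {ι : Type*} {A : ι → Set Ω}
    (hA : ∀ i, MeasurableSet (A i)) (s : Finset ι) (a : ι → ℝ) (r : ℝ) :
    Integrable (fun ω => Real.exp ((∑ i ∈ s, ((A i).indicator 1 ω - a i)) / r)) μ := by
  simp_rw [div_eq_inv_mul]
  refine ProbabilityTheory.integrable_exp_mul_of_mem_Icc (a := ∑ i ∈ s, (0 - a i))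
    (b := ∑ i ∈ s, (1 - a i)) (Finset.measurable_fun_sum s fun i _ =>
      (measurable_one.indicator (hA i)).sub_const _).aemeasurable (.of_forall fun ω => ⟨?_, ?_⟩)
  · gcongr with i
    exact Set.indicator_nonneg (fun _ _ => zero_le_one) ω
  · gcongr with i
    exact Set.indicator_le_self' (fun _ _ => zero_le_one) ω

theorem integral_exp_sum_indicator_sub_le_one {ι : Type*} {A : ι → Set Ω}
    (hA : ∀ i, MeasurableSet (A i)) {s : Finset ι}
    (hind : ProbabilityTheory.iIndepSet (fun i : s => A i) μ) :
    ∫ ω, Real.exp (∑ i ∈ s, ((A i).indicator 1 ω - (Real.exp 1 - 1) * μ.real (A i))) ∂μ ≤ 1 := by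
  simp_rw [Finset.sum_sub_distrib, Real.exp_sub, Real.exp_sum, integral_div]
  refine div_le_one_of_le₀ ?_ (Finset.prod_nonneg fun _ _ => (Real.exp_pos _).le)
  calc ∫ ω, ∏ i ∈ s, Real.exp ((A i).indicator 1 ω) ∂μ
      = ∫ ω, ∏ i : s, Real.exp ((A i).indicator 1 ω) ∂μ := by
        congr with ω
        exact (Finset.prod_coe_sort s fun i => Real.exp ((A i).indicator 1 ω)).symm
    _ = ∏ i : s, ∫ ω, Real.exp ((A i).indicator 1 ω) ∂μ :=
        hind.iIndepFun_indicator.integral_fun_prod_comp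
          (fun i => (measurable_one.indicator (hA i)).aemeasurable)
          fun _ => Real.measurable_exp.aestronglyMeasurable
    _ ≤ ∏ i : s, Real.exp ((Real.exp 1 - 1) * μ.real (A i)) :=
        Finset.prod_le_prod (fun _ _ => integral_nonneg fun _ => (Real.exp_pos _).le)
          fun i _ => integral_exp_indicator_le (hA i)
    _ = ∏ i ∈ s, Real.exp ((Real.exp 1 - 1) * μ.real (A i)) :=
        Finset.prod_coe_sort s fun i => Real.exp ((Real.exp 1 - 1) * μ.real (A i))

omit [IsProbabilityMeasure μ] in
theorem integral_exp_sum_div_le_one {ι κ : Type*} [Fintype ι] [Fintype κ] [Nonempty κ]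
    [DecidableEq κ] (c : ι → κ) (f : ι → Ω → ℝ)
    (hinteg : ∀ k, Integrable (fun ω => Real.exp (∑ i with c i = k, f i ω)) μ)
    (hinteg' : Integrable (fun ω => Real.exp ((∑ i, f i ω) / Fintype.card κ)) μ)
    (hf : ∀ k, ∫ ω, Real.exp (∑ i with c i = k, f i ω) ∂μ ≤ 1) :
    ∫ ω, Real.exp ((∑ i, f i ω) / Fintype.card κ) ∂μ ≤ 1 := by
  have hcard : (Fintype.card κ : ℝ) ≠ 0 := Nat.cast_ne_zero.2 Fintype.card_ne_zero
  have havg : ∀ ω, Real.exp ((∑ i, f i ω) / Fintype.card κ) ≤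
      ∑ k, (Fintype.card κ : ℝ)⁻¹ * Real.exp (∑ i with c i = k, f i ω) := by
    intro ω
    have := convexOn_exp.map_sum_le (t := Finset.univ) (w := fun _ : κ => (Fintype.card κ : ℝ)⁻¹)
      (p := fun k => ∑ i with c i = k, f i ω) (fun _ _ => by positivity) (by simp [hcard])
      fun _ _ => Set.mem_univ _
    rwa [← Finset.smul_sum, Finset.sum_fiberwise, smul_eq_mul, inv_mul_eq_div] at this
  calc ∫ ω, Real.exp ((∑ i, f i ω) / Fintype.card κ) ∂μ
      ≤ ∫ ω, ∑ k, (Fintype.card κ : ℝ)⁻¹ * Real.exp (∑ i with c i = k, f i ω) ∂μ :=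
        integral_mono hinteg' (integrable_finsetSum _ fun k _ => (hinteg k).const_mul _) havg
    _ = ∑ k, (Fintype.card κ : ℝ)⁻¹ * ∫ ω, Real.exp (∑ i with c i = k, f i ω) ∂μ := by
        rw [integral_finsetSum _ fun k _ => (hinteg k).const_mul _]
        simp_rw [integral_const_mul]
    _ ≤ ∑ _k : κ, (Fintype.card κ : ℝ)⁻¹ * 1 := by gcongr with k; exact hf k
    _ = 1 := by simp [hcard]

/-- Within a colour class of `G` the events are independent, and Jensen's inequality combines the
exponential moments of the classes. -/
theorem measureReal_le_card_filter_mem_le_exp_neg {ι : Type*} [Fintype ι] {G : SimpleGraph ι}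
    [DecidableRel G.Adj] {d : ℕ} (hd : ∀ i, G.degree i ≤ d) {A : ι → Set Ω}
    [∀ ω, DecidablePred fun i => ω ∈ A i] (hA : ∀ i, MeasurableSet (A i))
    (hind : ∀ s : Finset ι, G.IsIndepSet s → ProbabilityTheory.iIndepSet (fun i : s => A i) μ)
    (t : ℝ) :
    μ.real {ω | (Real.exp 1 - 1) * ∑ i, μ.real (A i) + (d + 1) * t ≤
      (Finset.univ.filter fun i => ω ∈ A i).card} ≤ Real.exp (-t) := by
  obtain ⟨c⟩ := colorable_of_forall_degree_le hd
  set f : ι → Ω → ℝ := fun i ω => (A i).indicator 1 ω - (Real.exp 1 - 1) * μ.real (A i)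
  have hinteg : ∀ (s : Finset ι) (r : ℝ),
      Integrable (fun ω => Real.exp ((∑ i ∈ s, f i ω) / r)) μ :=
    fun s => integrable_exp_sum_indicator_sub_div hA s _
  have hmgf : ∫ ω, Real.exp ((∑ i, f i ω) / Fintype.card (Fin (d + 1))) ∂μ ≤ 1 := by
    refine integral_exp_sum_div_le_one c f (fun k => ?_) (hinteg _ _) fun k => ?_
    · simpa only [div_one] using hinteg (Finset.univ.filter fun i => c i = k) 1
    · refine integral_exp_sum_indicator_sub_le_one hA (hind _ fun i hi j hj _ hadj => ?_)
      simp only [Finset.coe_filter, Finset.mem_univ, true_and, Set.mem_ofPred_eq] at hi hj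
      exact c.valid hadj (hi.trans hj.symm)
  rw [Fintype.card_fin, Nat.cast_add_one] at hmgf
  have hmarkov := mul_meas_ge_le_integral_of_nonneg (μ := μ)
    (.of_forall fun ω => (Real.exp_pos ((∑ i, f i ω) / (d + 1))).le) (hinteg _ _) (Real.exp t)
  rw [Real.exp_neg, ← one_div, le_div_iff₀' (Real.exp_pos _)]
  refine le_trans ?_ (hmarkov.trans hmgf)
  refine mul_le_mul_of_nonneg_left (measureReal_mono fun ω hω => ?_) (Real.exp_pos _).le
  have hcount : ∑ i, (A i).indicator (1 : Ω → ℝ) ω =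
      (Finset.univ.filter fun i => ω ∈ A i).card := by
    simp [Set.indicator_apply]
  rw [Set.mem_ofPred_eq, Real.exp_le_exp, le_div_iff₀ (by positivity), Finset.sum_sub_distrib,
    hcount, ← Finset.mul_sum]
  linarith [Set.mem_ofPred_eq ▸ hω]

end Tail

section NoisySign

variable {p : ℝ}

instance isProbabilityMeasure_noisySign [h : Fact (p ∈ Set.Icc (0 : ℝ) 1)] (y : ℤˣ) :
    IsProbabilityMeasure (noisySign p y) := by
  refine ⟨?_⟩
  have h1 : 0 ≤ 1 - p := sub_nonneg.2 h.out.2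
  simp [noisySign, ← ENNReal.ofReal_add h1 h.out.1]

theorem noisySign_real_ne (hp : 0 ≤ p) (y : ℤˣ) : (noisySign p y).real {x | x ≠ y} = p := by
  have hy : -y ≠ y := (units_ne_neg_self y).symm
  rw [measureReal_def, noisySign]
  simp [hy, hp]

/-- By the union bound the probability is at most `2 ^ k * p ^ ⌈k / 2⌉` with `k = F.card`, which is
at most `(4 * p) ^ ⌈k / 2⌉`; this is only useful when `4 * p ≤ 1`, and otherwise there is nothing
to prove. -/
theorem measure_half_flipped_le {E : Type*} [Fintype E] (hp : p ∈ Set.Icc (0 : ℝ) 1)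
    (y : E → ℤˣ) (F : Finset E) {c : ℕ} (hc : c ≤ (F.card + 1) / 2) :
    (Measure.pi fun e => noisySign p (y e)).real
      {x | F.card ≤ 2 * (F.filter fun e => x e ≠ y e).card} ≤ 4 ^ c * p ^ c := by
  have : Fact (p ∈ Set.Icc (0 : ℝ) 1) := ⟨hp⟩
  rw [← mul_pow]
  rcases le_total 1 (4 * p) with h4p | h4p
  · exact measureReal_le_one.trans (one_le_pow₀ h4p)
  set a := (F.card + 1) / 2
  have hchoose : F.card.choose a ≤ 4 ^ a :=
    calc F.card.choose a ≤ 2 ^ F.card := Nat.choose_le_two_pow _ _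
      _ ≤ 2 ^ (2 * a) := Nat.pow_le_pow_right two_pos (by omega)
      _ = 4 ^ a := pow_mul 2 2 a
  calc (Measure.pi fun e => noisySign p (y e)).real
        {x | F.card ≤ 2 * (F.filter fun e => x e ≠ y e).card}
      ≤ (Measure.pi fun e => noisySign p (y e)).real
        {x | a ≤ (F.filter fun e => x e ∈ {s | s ≠ y e}).card} := by
        refine measureReal_mono fun x hx => ?_
        simp only [Set.mem_ofPred_eq] at hx ⊢
        omega
    _ ≤ F.card.choose a * p ^ a :=
        measureReal_pi_le_card_filter_mem_le _ F (fun e _ => (noisySign_real_ne hp.1 _).le) a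
    _ ≤ (4 * p) ^ a := by
        rw [mul_pow]
        have := pow_nonneg hp.1 a
        gcongr
        exact_mod_cast hchoose
    _ ≤ (4 * p) ^ c := pow_le_pow_of_le_one (by linarith [hp.1]) h4p hc

end NoisySign

/-! ## The first stage -/

@[simp] theorem edgeProd_mk {V : Type*} (y : V → ℤˣ) (u v : V) : edgeProd y s(u, v) = y u * y v :=
  rfl

theorem edgeProd_mul {V : Type*} (y z : V → ℤˣ) (e : Sym2 V) :
    edgeProd (fun v => y v * z v) e = edgeProd y e * edgeProd z e := by
  induction e with | _ u v => exact mul_mul_mul_comm _ _ _ _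

theorem edgeProd_congr {V : Type*} {y z : V → ℤˣ} {e : Sym2 V} (h : ∀ v ∈ e, y v = z v) :
    edgeProd y e = edgeProd z e :=
  congrArg Sym2.mul (Sym2.map_congr h)

/-- The labeling that is `-1` exactly on `S`; an edge `e` crosses `S` iff
`edgeProd (flipOn S) e = -1`. -/
def flipOn {V : Type*} [DecidableEq V] (S : Finset V) (v : V) : ℤˣ := if v ∈ S then -1 else 1

namespace Setup

variable {n N : ℕ} (P : Setup n N)

/-- `E'(W*)` as a set of indices of edge measurements. -/
def obsEdges (i : Fin N) : Finset P.graph.edgeSet :=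
  Finset.univ.filter fun e => (e : Sym2 (Fin n)) ∈ P.extEdges i

/-- The edges of `G'(W*)` with exactly one end in `S`. -/
def cutEdges (i : Fin N) (S : Finset (Fin n)) : Finset P.graph.edgeSet :=
  (P.obsEdges i).filter fun e => edgeProd (flipOn S) (e : Sym2 (Fin n)) = -1

/-- The measurements that are flipped on at least half of the edges of some cut of `G'(W*)` that
separates two vertices of `W`. -/
def corrupted (Y : Fin n → ℤˣ) (i : Fin N) : Set (EdgeObs P) :=
  {X | ∃ S ⊆ P.ext i, (S ∩ P.bag i).Nonempty ∧ (P.bag i \ S).Nonempty ∧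
    (P.cutEdges i S).card ≤
      2 * ((P.cutEdges i S).filter fun e : P.graph.edgeSet => X e ≠ edgeProd Y e).card}

/-- Two components conflict if their extended components share a measured edge. -/
def conflictGraph : SimpleGraph (Fin N) where
  Adj i j := i ≠ j ∧ ¬ Disjoint (P.obsEdges i) (P.obsEdges j)
  symm := ⟨fun _ _ h => ⟨h.1.symm, fun hd => h.2 hd.symm⟩⟩
  loopless := ⟨fun _ h => h.1 rfl⟩

instance : DecidableRel P.conflictGraph.Adj := fun i j =>
  inferInstanceAs (Decidable (i ≠ j ∧ ¬ Disjoint (P.obsEdges i) (P.obsEdges j)))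

variable {P}

theorem mem_obsEdges {i : Fin N} {e : P.graph.edgeSet} :
    e ∈ P.obsEdges i ↔ (e : Sym2 (Fin n)) ∈ P.extEdges i :=
  Finset.mem_filter_univ e

/-- Flipping `S` trades the disagreements on the cut for the agreements. -/
theorem card_cutEdges_le_of_disagreements_le {X : EdgeObs P} {i : Fin N} {y Y : Fin n → ℤˣ}
    {S : Finset (Fin n)} (hyY : ∀ v ∈ P.ext i, y v = flipOn S v * Y v)
    (hy : P.disagreements X i y ≤ P.disagreements X i Y) :
    (P.cutEdges i S).card ≤
      2 * ((P.cutEdges i S).filter fun e : P.graph.edgeSet => X e ≠ edgeProd Y e).card := by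
  let D : (Fin n → ℤˣ) → Finset P.graph.edgeSet := fun z => Finset.univ.filter fun e =>
    (e : Sym2 (Fin n)) ∈ P.extEdges i ∧ edgeProd z (e : Sym2 (Fin n)) ≠ X e
  have hprod : ∀ e ∈ P.extEdges i, edgeProd y e = edgeProd (flipOn S) e * edgeProd Y e := by
    intro e he
    rw [← edgeProd_mul]
    exact edgeProd_congr fun v hv => hyY v ((Finset.mem_filter.1 he).2 v hv)
  have hmem : ∀ e : P.graph.edgeSet, (e ∈ D y \ D Y ↔ e ∈ P.cutEdges i S ∧ ¬ X e ≠ edgeProd Y e) ∧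
      (e ∈ D Y \ D y ↔ e ∈ P.cutEdges i S ∧ X e ≠ edgeProd Y e) := by
    intro e
    simp only [D, cutEdges, mem_obsEdges, Finset.mem_sdiff, Finset.mem_filter, Finset.mem_univ,
      true_and]
    by_cases he : (e : Sym2 (Fin n)) ∈ P.extEdges i
    · rcases Int.units_eq_one_or (edgeProd (flipOn S) (e : Sym2 (Fin n))) with hS | hS
      · simp [he, hprod _ he, hS, units_ne_neg_self]
      · simp [he, hprod _ he, hS, ← Int.units_ne_iff_eq_neg, eq_comm]
    · simp [he]
  have hagree : D y \ D Y =
      (P.cutEdges i S).filter fun e : P.graph.edgeSet => ¬ X e ≠ edgeProd Y e := by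
    ext e
    rw [(hmem e).1, Finset.mem_filter]
  have hdisagree : D Y \ D y =
      (P.cutEdges i S).filter fun e : P.graph.edgeSet => X e ≠ edgeProd Y e := by
    ext e
    rw [(hmem e).2, Finset.mem_filter]
  have hle := Finset.card_sdiff_le_card_sdiff_iff.2 hy
  rw [← Finset.card_filter_add_card_filter_not (s := P.cutEdges i S)
    (fun e : P.graph.edgeSet => X e ≠ edgeProd Y e), ← hagree, ← hdisagree, two_mul]
  exact Nat.add_le_add_left hle _

theorem eq_or_eq_neg_of_notMem_corrupted {Y y : Fin n → ℤˣ} {i : Fin N}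
    (hb : P.bag i ⊆ P.ext i) {X : EdgeObs P} (hX : X ∉ P.corrupted Y i)
    (hy : P.disagreements X i y ≤ P.disagreements X i Y) :
    ∃ σ : ℤˣ, ∀ v ∈ P.bag i, y v = σ * Y v := by
  by_contra! hcon
  obtain ⟨u, hu, hne⟩ := hcon 1
  obtain ⟨v, hv, hne'⟩ := hcon (-1)
  rw [one_mul] at hne
  have hveq : y v = Y v := by rwa [neg_one_mul, Int.units_ne_iff_eq_neg, neg_neg] at hne'
  refine hX ⟨(P.ext i).filter fun v => y v ≠ Y v, Finset.filter_subset _ _,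
    ⟨u, by simp [hu, hb hu, hne]⟩, ⟨v, by simp [hv, hveq]⟩,
    card_cutEdges_le_of_disagreements_le (fun w hw => ?_) hy⟩
  by_cases h : y w = Y w
  · simp [flipOn, h]
  · simp [flipOn, hw, Int.units_ne_iff_eq_neg.1 h]

theorem dependsOn_corrupted (Y : Fin n → ℤˣ) (i : Fin N) :
    DependsOn (· ∈ P.corrupted Y i) (P.obsEdges i) := by
  intro X X' h
  have hfilter : ∀ S, ((P.cutEdges i S).filter fun e : P.graph.edgeSet => X e ≠ edgeProd Y e) =
      (P.cutEdges i S).filter fun e : P.graph.edgeSet => X' e ≠ edgeProd Y e := fun S =>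
    Finset.filter_congr fun e he => by rw [h e (Finset.mem_coe.2 (Finset.mem_of_mem_filter e he))]
  simp only [corrupted, Set.mem_ofPred_eq, hfilter]

variable (P)

theorem degree_conflictGraph_le (i : Fin N) :
    P.conflictGraph.degree i ≤ P.edgeDegStar * P.maxExtEdges := by
  have hsub : P.conflictGraph.neighborFinset i ⊆
      (P.extEdges i).biUnion fun e => Finset.univ.filter fun j => e ∈ P.extEdges j := by
    intro j hj
    obtain ⟨-, hdisj⟩ := (P.conflictGraph.mem_neighborFinset i j).1 hj
    obtain ⟨e, hei, hej⟩ := Finset.not_disjoint_iff.1 hdisj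
    exact Finset.mem_biUnion.2
      ⟨e, mem_obsEdges.1 hei, (Finset.mem_filter_univ j).2 (mem_obsEdges.1 hej)⟩
  calc P.conflictGraph.degree i
      ≤ (P.extEdges i).card * P.edgeDegStar :=
        (Finset.card_le_card hsub).trans <| Finset.card_biUnion_le_card_mul _ _ _ fun e he =>
          P.card_ext_of_edge_le (Finset.mem_of_mem_filter _ he)
    _ ≤ P.edgeDegStar * P.maxExtEdges := by
        rw [mul_comm]
        exact Nat.mul_le_mul_left _ (P.card_extEdges_le i)

variable {P}

namespace IsAdmissible

theorem mincutStar_le_card_cutEdges (hP : P.IsAdmissible) {i : Fin N} {S : Finset (Fin n)}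
    (hS : S ⊆ P.ext i) (h1 : (S ∩ P.bag i).Nonempty) (h2 : (P.bag i \ S).Nonempty) :
    P.mincutStar i ≤ (P.cutEdges i S).card := by
  calc P.mincutStar i ≤ (P.probed.interedges S (P.ext i \ S)).card :=
        Nat.sInf_le ⟨S, hS, h1, h2, rfl⟩
    _ ≤ ((P.cutEdges i S).map (Function.Embedding.subtype _)).card := by
        refine Finset.card_le_card_of_injOn (fun x => s(x.1, x.2)) ?_ ?_
        · rintro ⟨u, v⟩ huv
          obtain ⟨hu, hv, hadj⟩ := Rel.mem_interedges_iff.1 huv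
          obtain ⟨hv, hvS⟩ := Finset.mem_sdiff.1 hv
          refine Finset.mem_map.2 ⟨⟨s(u, v), hP.probed_le hadj⟩, ?_, rfl⟩
          simp [cutEdges, mem_obsEdges, mem_extEdges, flipOn, hadj, hS hu, hv, hu, hvS]
        · rintro ⟨u, v⟩ huv ⟨u', v'⟩ huv' h
          have hu := (Rel.mem_interedges_iff.1 huv).1
          have hv' := (Finset.mem_sdiff.1 (Rel.mem_interedges_iff.1 huv').2.1).2
          rcases Sym2.eq_iff.1 h with ⟨rfl, rfl⟩ | ⟨rfl, rfl⟩
          · rfl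
          · exact absurd hu hv'
    _ = (P.cutEdges i S).card := Finset.card_map _

theorem mincutStar_le_widStar (hP : P.IsAdmissible) (i : Fin N) : P.mincutStar i ≤ P.widStar := by
  by_cases h : ∃ S ⊆ P.ext i, (S ∩ P.bag i).Nonempty ∧ (P.bag i \ S).Nonempty
  · obtain ⟨S, -, ⟨v, hv⟩, w, hw⟩ := h
    obtain ⟨hvS, hv⟩ := Finset.mem_inter.1 hv
    obtain ⟨hw, hwS⟩ := Finset.mem_sdiff.1 hw
    have hwv : w ≠ v := (ne_of_mem_of_not_mem hvS hwS).symm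
    have hve : {v} ⊆ P.ext i := Finset.singleton_subset_iff.2 (hP.bag_subset_ext i hv)
    calc P.mincutStar i ≤ (P.probed.interedges {v} (P.ext i \ {v})).card :=
          Nat.sInf_le ⟨{v}, hve, ⟨v, by simp [hv]⟩, ⟨w, by simp [hw, hwv]⟩, rfl⟩
      _ ≤ 1 * (P.ext i \ {v}).card := Rel.card_interedges_le_mul _ _ _
      _ = (P.ext i).card - 1 := by
          rw [one_mul, Finset.card_sdiff_of_subset hve, Finset.card_singleton]
      _ ≤ P.widStar := Nat.sub_le_of_le_add (P.card_ext_le i)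
  · have hempty : P.mincutStar i = 0 := by
      rw [mincutStar, Nat.sInf_eq_zero]
      exact .inr <| Set.eq_empty_of_forall_notMem fun k ⟨S, h1, h2, h3, _⟩ => h ⟨S, h1, h2, h3⟩
    exact hempty ▸ Nat.zero_le _

/-- Union bound over the at most `2 ^ (wid* + 1)` cuts. -/
theorem measure_corrupted_le (hP : P.IsAdmissible) {p : ℝ} (hp : p ∈ Set.Icc (0 : ℝ) 1)
    (Y : Fin n → ℤˣ) (i : Fin N) :
    (Measure.pi fun e : P.graph.edgeSet => noisySign p (edgeProd Y e)).real (P.corrupted Y i) ≤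
      4 ^ (P.widStar + 1) * p ^ ((P.mincutStar i + 1) / 2) := by
  set μ := Measure.pi fun e : P.graph.edgeSet => noisySign p (edgeProd Y e)
  have hpI : Fact (p ∈ Set.Icc (0 : ℝ) 1) := ⟨hp⟩
  set c := (P.mincutStar i + 1) / 2
  set I := (P.ext i).powerset.filter fun S => (S ∩ P.bag i).Nonempty ∧ (P.bag i \ S).Nonempty
  have hunion : P.corrupted Y i ⊆ ⋃ S ∈ I, {X : EdgeObs P | (P.cutEdges i S).card ≤
      2 * ((P.cutEdges i S).filter fun e : P.graph.edgeSet => X e ≠ edgeProd Y e).card} := by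
    rintro X ⟨S, hS, h1, h2, hX⟩
    simp only [Set.mem_iUnion]
    exact ⟨S, Finset.mem_filter.2 ⟨Finset.mem_powerset.2 hS, h1, h2⟩, hX⟩
  have hcut : ∀ S ∈ I, μ.real {X : EdgeObs P | (P.cutEdges i S).card ≤
      2 * ((P.cutEdges i S).filter fun e : P.graph.edgeSet => X e ≠ edgeProd Y e).card} ≤
      4 ^ c * p ^ c := by
    intro S hS
    obtain ⟨hS, h1, h2⟩ := Finset.mem_filter.1 hS
    have := hP.mincutStar_le_card_cutEdges (Finset.mem_powerset.1 hS) h1 h2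
    exact measure_half_flipped_le hp _ _ (by omega)
  have hI : I.card ≤ 2 ^ (P.widStar + 1) := by
    refine (Finset.card_filter_le _ _).trans ?_
    rw [Finset.card_powerset]
    exact Nat.pow_le_pow_right two_pos (P.card_ext_le i)
  have h4c : 4 ^ c ≤ 2 ^ (P.widStar + 1) := by
    have := hP.mincutStar_le_widStar i
    rw [show 4 = 2 ^ 2 from rfl, ← pow_mul]
    exact Nat.pow_le_pow_right two_pos (by omega)
  have hpc := pow_nonneg hp.1 c
  calc μ.real (P.corrupted Y i) ≤ I.card * (4 ^ c * p ^ c) := by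
        rw [← nsmul_eq_mul]
        exact (measureReal_mono hunion (measure_ne_top _ _)).trans <|
          (measureReal_biUnion_finset_le _ _).trans (Finset.sum_le_card_nsmul _ _ _ hcut)
    _ = (I.card * 4 ^ c : ℕ) * p ^ c := by push_cast; ring
    _ ≤ (2 ^ (P.widStar + 1) * 2 ^ (P.widStar + 1) : ℕ) * p ^ c := by gcongr
    _ = 4 ^ (P.widStar + 1) * p ^ c := by rw [← mul_pow]; norm_num

open Classical in
theorem measure_errBudget_lt_le (hP : P.IsAdmissible) (hc : P.probed.Connected) (hn : 2 ≤ n)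
    {p δ : ℝ} (hp : p ∈ Set.Icc (0 : ℝ) 1) (hδ : 0 < δ) (hδ2 : δ ≤ 2) (Y : Fin n → ℤˣ) :
    (Measure.pi fun e : P.graph.edgeSet => noisySign p (edgeProd Y e)).real
      {X | P.errBudget p δ < (Finset.univ.filter fun i => X ∈ P.corrupted Y i).card} ≤ δ / 2 := by
  have hpI : Fact (p ∈ Set.Icc (0 : ℝ) 1) := ⟨hp⟩
  have htail := measureReal_le_card_filter_mem_le_exp_neg
    (μ := Measure.pi fun e : P.graph.edgeSet => noisySign p (edgeProd Y e))
    P.degree_conflictGraph_le (A := P.corrupted Y) (fun _ => .of_discrete)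
    (fun s hs => iIndepSet_pi_of_dependsOn _ (fun i : s => dependsOn_corrupted Y i.1)
      fun i j hij => by_contra fun hdisj =>
        hs i.2 j.2 (Subtype.coe_ne_coe.2 hij) ⟨Subtype.coe_ne_coe.2 hij, hdisj⟩)
    (Real.log (2 / δ))
  rw [Real.exp_neg, Real.exp_log (by positivity), inv_div] at htail
  refine le_trans (measureReal_mono fun X hX => le_trans ?_ (Set.mem_ofPred_eq ▸ hX).le) htail
  have hlog : 0 ≤ Real.log (2 / δ) := Real.log_nonneg ((one_le_div hδ).2 hδ2)
  have he : Real.exp 1 - 1 ≤ 4 := by linarith [Real.exp_one_lt_d9]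
  have hmean : (Real.exp 1 - 1) * ∑ i, (Measure.pi fun e : P.graph.edgeSet =>
      noisySign p (edgeProd Y e)).real (P.corrupted Y i) ≤ 4 ^ (P.widStar + 2) * P.cutSum p :=
    calc _ ≤ (4 : ℝ) * ∑ i, 4 ^ (P.widStar + 1) * p ^ ((P.mincutStar i + 1) / 2) := by
          gcongr with i
          exact hP.measure_corrupted_le hp Y i
      _ = _ := by rw [← Finset.mul_sum, cutSum]; ring
  have hdeg : (1 : ℝ) ≤ P.edgeDegStar * P.maxExtEdges := by
    exact_mod_cast Nat.mul_pos (hP.one_le_edgeDegStar hc hn) (hP.one_le_maxExtEdges hc hn)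
  rw [errBudget]
  push_cast
  gcongr
  linarith

end IsAdmissible

end Setup

/-! ## The second stage -/

theorem card_filter_powerset_card_le {α : Type*} (s : Finset α) (k : ℕ) :
    (s.powerset.filter fun t => t.card ≤ k).card ≤ (s.card + 1) ^ k := by
  classical
  induction k with
  | zero => simp [Finset.filter_eq']
  | succ k ih =>
    have hsub : (s.powerset.filter fun t => t.card ≤ k + 1) ⊆
        (Finset.insertNone s ×ˢ s.powerset.filter fun t => t.card ≤ k).image
          fun x : Option α × Finset α => x.1.elim x.2 fun a => insert a x.2 := by
      intro t ht
      obtain ⟨hts, htk⟩ := Finset.mem_filter.1 ht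
      rw [Finset.mem_powerset] at hts
      rcases t.eq_empty_or_nonempty with rfl | ⟨a, ha⟩
      · exact Finset.mem_image.2 ⟨(none, ∅), by simp, rfl⟩
      · have hcard := Finset.card_erase_add_one ha
        refine Finset.mem_image.2 ⟨(some a, t.erase a), ?_, Finset.insert_erase ha⟩
        simp only [Finset.mem_product, Finset.some_mem_insertNone, Finset.mem_filter,
          Finset.mem_powerset]
        exact ⟨hts ha, (Finset.erase_subset a t).trans hts, by omega⟩
    calc (s.powerset.filter fun t => t.card ≤ k + 1).card
        ≤ (Finset.insertNone s).card * (s.powerset.filter fun t => t.card ≤ k).card := by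
          rw [← Finset.card_product]
          exact (Finset.card_le_card hsub).trans Finset.card_image_le
      _ ≤ (s.card + 1) ^ (k + 1) := by
          rw [Finset.card_insertNone, pow_succ']
          exact Nat.mul_le_mul_left _ ih

section EdgeBoundary

variable {V : Type*} {T : SimpleGraph V}

theorem eq_of_edgeProd_eq (hT : T.Preconnected) {y z : V → ℤˣ} {r : V} (hr : y r = z r)
    (h : ∀ e ∈ T.edgeSet, edgeProd y e = edgeProd z e) : y = z := by
  funext x
  obtain ⟨w⟩ := hT r x
  induction w with
  | nil => exact hr
  | cons hadj _ ih =>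
    have := h _ (T.mem_edgeSet.2 hadj)
    rw [edgeProd_mk, edgeProd_mk, hr] at this
    exact ih (mul_left_cancel this)

variable [DecidableEq V]

theorem flipOn_eq_neg_one_iff {S : Finset V} {v : V} : flipOn S v = -1 ↔ v ∈ S := by
  by_cases h : v ∈ S <;> simp [flipOn, h, units_ne_neg_self]

variable [Fintype V] [DecidableRel T.Adj]

/-- The edges of `T` with exactly one end in `D`. -/
def edgeBoundary (T : SimpleGraph V) [DecidableRel T.Adj] (D : Finset V) : Finset (Sym2 V) :=
  T.edgeFinset.filter fun e => edgeProd (flipOn D) e = -1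

theorem eq_of_edgeBoundary_eq (hT : T.Preconnected) {D D' : Finset V} {r : V}
    (hr : r ∈ D ↔ r ∈ D') (h : edgeBoundary T D = edgeBoundary T D') : D = D' := by
  have hunits : ∀ {a b : ℤˣ}, (a = -1 ↔ b = -1) → a = b := by decide
  have hflip : flipOn D = flipOn D' := by
    refine eq_of_edgeProd_eq hT (r := r) (hunits ?_) fun e he => hunits ?_
    · simpa only [flipOn_eq_neg_one_iff] using hr
    · have := Finset.ext_iff.1 h e
      simpa only [edgeBoundary, Finset.mem_filter, SimpleGraph.mem_edgeFinset, he, true_and]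
        using this
  ext v
  rw [← flipOn_eq_neg_one_iff, hflip, flipOn_eq_neg_one_iff]

/-- A set is determined by its boundary and its indicator at one vertex. -/
theorem card_filter_card_edgeBoundary_le (hT : T.IsTree) (k : ℕ) :
    (Finset.univ.filter fun D => (edgeBoundary T D).card ≤ k).card ≤ 2 * Fintype.card V ^ k := by
  obtain ⟨r⟩ := hT.connected.nonempty
  calc (Finset.univ.filter fun D => (edgeBoundary T D).card ≤ k).card
      ≤ ((Finset.univ : Finset Bool) ×ˢ T.edgeFinset.powerset.filter fun F => F.card ≤ k).card := by
        refine Finset.card_le_card_of_injOn (fun D => (decide (r ∈ D), edgeBoundary T D))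
          (fun D hD => ?_) fun D _ D' _ h => ?_
        · refine Finset.mem_product.2 ⟨Finset.mem_univ _, Finset.mem_filter.2
            ⟨Finset.mem_powerset.2 (Finset.filter_subset _ _), (Finset.mem_filter.1 hD).2⟩⟩
        · rw [Prod.mk.injEq, decide_eq_decide] at h
          exact eq_of_edgeBoundary_eq hT.connected.preconnected h.1 h.2
    _ ≤ 2 * Fintype.card V ^ k := by
        rw [Finset.card_product, ← hT.card_edgeFinset, Finset.card_univ, Fintype.card_bool]
        exact Nat.mul_le_mul_left _ (card_filter_powerset_card_le _ _)

theorem card_filter_exists_mem_le_mul_maxDegree (T : SimpleGraph V) [DecidableRel T.Adj]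
    (B : Finset V) :
    (T.edgeFinset.filter fun e => ∃ i ∈ B, i ∈ e).card ≤ B.card * T.maxDegree := by
  have hsub : (T.edgeFinset.filter fun e => ∃ i ∈ B, i ∈ e) ⊆
      B.biUnion fun i => T.incidenceFinset i := by
    intro e he
    obtain ⟨heT, i, hi, hie⟩ := Finset.mem_filter.1 he
    exact Finset.mem_biUnion.2
      ⟨i, hi, (T.mem_incidenceFinset i e).2 ⟨SimpleGraph.mem_edgeFinset.1 heT, hie⟩⟩
  refine (Finset.card_le_card hsub).trans (Finset.card_biUnion_le_card_mul _ _ _ fun i _ => ?_)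
  rw [T.card_incidenceFinset_eq_degree]
  exact T.degree_le_maxDegree i

end EdgeBoundary

theorem measureReal_sum_mul_sub_integral_le_le_exp {ι Ω : Type*} [Fintype ι]
    {mΩ : MeasurableSpace Ω} {μ : Measure Ω} [IsProbabilityMeasure μ] {X : ι → Ω → ℝ}
    (hind : ProbabilityTheory.iIndepFun X μ) (hX : ∀ i, AEMeasurable (X i) μ)
    (hX1 : ∀ i, ∀ᵐ ω ∂μ, X i ω ∈ Set.Icc (-1 : ℝ) 1) (c : ι → ℝ) (a : ℝ) {t : ℝ} (ht : 0 ≤ t) :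
    μ.real {ω | ∑ i, c i * (X i ω - ∫ ω, X i ω ∂μ) ≤ -a} ≤
      Real.exp (-(t * a) + (∑ i, c i ^ 2) * t ^ 2 / 2) := by
  set Z : ι → Ω → ℝ := fun i ω => c i * (X i ω - ∫ ω, X i ω ∂μ)
  have hZind : ProbabilityTheory.iIndepFun Z μ :=
    hind.comp (fun i x => c i * (x - ∫ ω, X i ω ∂μ)) fun i => by fun_prop
  have hZsub : ∀ i, ProbabilityTheory.HasSubgaussianMGF (Z i) (c i ^ 2).toNNReal μ := by
    intro i
    convert (ProbabilityTheory.hasSubgaussianMGF_of_mem_Icc (hX i) (hX1 i)).const_mul (c i)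
    rw [Real.toNNReal_of_nonneg (sq_nonneg _), show ‖(1 : ℝ) - -1‖₊ / 2 = 1 by ext; norm_num,
      one_pow]
    exact (mul_one _).symm
  have hsub := ProbabilityTheory.HasSubgaussianMGF.sum_of_iIndepFun hZind (s := Finset.univ)
    fun i _ => hZsub i
  refine (ProbabilityTheory.measure_le_le_exp_mul_mgf _ (neg_nonpos.2 ht)
    (hsub.integrable_exp_mul _)).trans
    ((mul_le_mul_of_nonneg_left (hsub.mgf_le (-t)) (Real.exp_pos _).le).trans_eq ?_)
  have hsum : ((∑ i, (c i ^ 2).toNNReal : NNReal) : ℝ) = ∑ i, c i ^ 2 := by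
    rw [NNReal.coe_sum]
    exact Finset.sum_congr rfl fun i _ => Real.coe_toNNReal _ (sq_nonneg _)
  rw [← Real.exp_add, hsum]
  ring_nf

theorem measureReal_sum_mul_le_le_exp_neg {ι Ω : Type*} [Fintype ι] {mΩ : MeasurableSpace Ω}
    {μ : Measure Ω} [IsProbabilityMeasure μ] {X : ι → Ω → ℝ}
    (hind : ProbabilityTheory.iIndepFun X μ) (hX : ∀ i, AEMeasurable (X i) μ)
    (hX1 : ∀ i, ∀ᵐ ω ∂μ, X i ω ∈ Set.Icc (-1 : ℝ) 1) {ε : ℝ} (hε : 0 < ε)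
    (hmean : ∀ i, 2 * ε ≤ ∫ ω, X i ω ∂μ) {c : ι → ℝ} {B : ℝ} (hB : 0 < B)
    (hc : ∀ i, c i ∈ Set.Icc 0 B) (l : ℝ) :
    μ.real {ω | ∑ i, c i * X i ω ≤ ε * ∑ i, c i - B * l / ε} ≤ Real.exp (-l) := by
  have hsum : 0 ≤ ∑ i, c i := Finset.sum_nonneg fun i _ => (hc i).1
  have hsq : ∑ i, c i ^ 2 ≤ B * ∑ i, c i := by
    rw [Finset.mul_sum]
    refine Finset.sum_le_sum fun i _ => ?_
    rw [sq]
    exact mul_le_mul_of_nonneg_right (hc i).2 (hc i).1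
  calc μ.real {ω | ∑ i, c i * X i ω ≤ ε * ∑ i, c i - B * l / ε}
      ≤ μ.real {ω | ∑ i, c i * (X i ω - ∫ ω, X i ω ∂μ) ≤ -(ε * ∑ i, c i + B * l / ε)} := by
        refine measureReal_mono fun ω hω => ?_
        have : ∑ i, c i * (2 * ε) ≤ ∑ i, c i * ∫ ω, X i ω ∂μ :=
          Finset.sum_le_sum fun i _ => mul_le_mul_of_nonneg_left (hmean i) (hc i).1
        rw [← Finset.sum_mul] at this
        simp only [Set.mem_ofPred_eq, mul_sub, Finset.sum_sub_distrib] at hω ⊢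
        linarith
    _ ≤ Real.exp (-(ε / B * (ε * ∑ i, c i + B * l / ε)) + (∑ i, c i ^ 2) * (ε / B) ^ 2 / 2) :=
        measureReal_sum_mul_sub_integral_le_le_exp hind hX hX1 c _ (by positivity)
    _ ≤ Real.exp (-(ε / B * (ε * ∑ i, c i + B * l / ε)) +
          (B * ∑ i, c i) * (ε / B) ^ 2 / 2) := by gcongr
    _ = Real.exp (-l - ε ^ 2 / B * (∑ i, c i) / 2) := by
        congr 1
        field_simp
        ring
    _ ≤ Real.exp (-l) := Real.exp_le_exp.2 (sub_le_self _ (by positivity))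

theorem integral_noisySign {q : ℝ} (hq : q ∈ Set.Icc (0 : ℝ) 1) (y : ℤˣ) (f : ℤˣ → ℝ) :
    ∫ z, f z ∂noisySign q y = (1 - q) * f y + q * f (-y) := by
  have hinteg : ∀ (r : ℝ) (z : ℤˣ), Integrable f (ENNReal.ofReal r • Measure.dirac z) :=
    fun r z => (integrable_dirac (by simp)).smul_measure ENNReal.ofReal_ne_top
  rw [noisySign, integral_add_measure (hinteg _ _) (hinteg _ _), integral_smul_measure,
    integral_smul_measure, integral_dirac, integral_dirac,
    ENNReal.toReal_ofReal (sub_nonneg.2 hq.2), ENNReal.toReal_ofReal hq.1, smul_eq_mul, smul_eq_mul]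

/-- `y * z` as a real number: `1` if the signs agree and `-1` otherwise. -/
def agree (y z : ℤˣ) : ℝ := ((y * z : ℤˣ) : ℤ)

theorem agree_mem_Icc (y z : ℤˣ) : agree y z ∈ Set.Icc (-1 : ℝ) 1 := by
  rcases Int.units_eq_one_or (y * z) with h | h <;> simp [agree, h]

theorem integral_agree_noisySign {q : ℝ} (hq : q ∈ Set.Icc (0 : ℝ) 1) (y : ℤˣ) :
    ∫ z, agree y z ∂noisySign q y = 2 * (1 / 2 - q) := by
  rw [integral_noisySign hq, agree, agree, mul_neg, Int.units_mul_self]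
  push_cast
  ring

theorem measure_sum_agree_le {V : Type*} [Fintype V] (Y : V → ℤˣ) {q : ℝ} (hq0 : 0 ≤ q)
    (hq : q < 1 / 2) {c : V → ℝ} {B : ℝ} (hB : 0 < B) (hc : ∀ v, c v ∈ Set.Icc 0 B) (l : ℝ) :
    (Measure.pi fun v => noisySign q (Y v)).real
      {Z | ∑ v, c v * agree (Y v) (Z v) ≤ (1 / 2 - q) * ∑ v, c v - B * l / (1 / 2 - q)} ≤
        Real.exp (-l) := by
  have hqI : q ∈ Set.Icc (0 : ℝ) 1 := ⟨hq0, by linarith⟩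
  have : Fact (q ∈ Set.Icc (0 : ℝ) 1) := ⟨hqI⟩
  refine measureReal_sum_mul_le_le_exp_neg (X := fun v (Z : V → ℤˣ) => agree (Y v) (Z v))
    (ProbabilityTheory.iIndepFun_pi fun _ => Measurable.of_discrete.aemeasurable)
    (fun _ => Measurable.of_discrete.aemeasurable) (fun _ => .of_forall fun _ => agree_mem_Icc _ _)
    (sub_pos.2 hq) (fun v => ?_) hB hc l
  rw [integral_comp_eval (μ := fun v => noisySign q (Y v)) (i := v) (f := agree (Y v))
    Measurable.of_discrete.aestronglyMeasurable, integral_agree_noisySign hqI]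

namespace Setup

variable {n N : ℕ} {P : Setup n N}

/-- The number of components in `D` that contain `v`. -/
def multiplicity (P : Setup n N) (D : Finset (Fin N)) (v : Fin n) : ℕ :=
  (D.filter fun i => v ∈ P.bag i).card

theorem sum_multiplicity_mul (D : Finset (Fin N)) (f : Fin n → ℝ) :
    ∑ v, P.multiplicity D v * f v = ∑ i ∈ D, ∑ v ∈ P.bag i, f v := by
  simp only [multiplicity, Finset.card_filter, Nat.cast_sum, Finset.sum_mul]
  rw [Finset.sum_comm]
  simp

theorem sum_multiplicity (D : Finset (Fin N)) :
    ∑ v, (P.multiplicity D v : ℝ) = ∑ i ∈ D, ((P.bag i).card : ℝ) := by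
  simpa using P.sum_multiplicity_mul D fun _ => 1

/-- The sets of components with at most `k` tree edges in the boundary. -/
def smallBoundary (P : Setup n N) (k : ℕ) : Finset (Finset (Fin N)) :=
  Finset.univ.filter fun D => (edgeBoundary P.tree D).card ≤ k

theorem IsAdmissible.measure_sum_bags_agree_le (hP : P.IsAdmissible) (hc : P.probed.Connected)
    (hn : 2 ≤ n) (Y : Fin n → ℤˣ) {q : ℝ} (hq0 : 0 ≤ q) (hq : q < 1 / 2) (D : Finset (Fin N))
    (l : ℝ) :
    (Measure.pi fun v => noisySign q (Y v)).real
      {Z | ∑ i ∈ D, ∑ v ∈ P.bag i, agree (Y v) (Z v) ≤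
        (1 / 2 - q) * ∑ i ∈ D, ((P.bag i).card : ℝ)
          - (P.probed.maxDegree * P.edgeDegStar : ℝ) * l / (1 / 2 - q)} ≤ Real.exp (-l) := by
  have hpos : (0 : ℝ) < P.probed.maxDegree * P.edgeDegStar := by
    have h1 := hP.one_le_maxDegree hc hn
    have h2 := hP.one_le_edgeDegStar hc hn
    positivity
  simp only [← sum_multiplicity_mul, ← sum_multiplicity]
  refine measure_sum_agree_le Y hq0 hq hpos (fun v => ⟨Nat.cast_nonneg _, ?_⟩) l
  exact_mod_cast (Finset.card_le_card (Finset.filter_subset_filter _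
    (Finset.subset_univ D))).trans (hP.card_bags_le hc hn v)

theorem IsAdmissible.measure_uninformative_le (hP : P.IsAdmissible) (hc : P.probed.Connected)
    (hn : 2 ≤ n) (Y : Fin n → ℤˣ) {q δ : ℝ} (hq0 : 0 ≤ q) (hq : q < 1 / 2) (hδ : 0 < δ) (k : ℕ) :
    (Measure.pi fun v => noisySign q (Y v)).real
      {Z | ∃ D ∈ P.smallBoundary k, ∑ i ∈ D, ∑ v ∈ P.bag i, agree (Y v) (Z v) ≤
        (1 / 2 - q) * ∑ i ∈ D, ((P.bag i).card : ℝ)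
          - (P.probed.maxDegree * P.edgeDegStar : ℝ) *
            (Real.log (4 / δ) + k * Real.log N) / (1 / 2 - q)} ≤ δ / 2 := by
  have : Fact (q ∈ Set.Icc (0 : ℝ) 1) := ⟨hq0, by linarith⟩
  set l := Real.log (4 / δ) + k * Real.log N with hl
  have hN : (0 : ℝ) < N := by
    obtain ⟨i⟩ := hP.isTreeDecomposition.isTree.connected.nonempty
    exact_mod_cast i.pos
  have hcard : ((P.smallBoundary k).card : ℝ) ≤ 2 * N ^ k := by
    have := card_filter_card_edgeBoundary_le hP.isTreeDecomposition.isTree k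
    rw [Fintype.card_fin] at this
    exact_mod_cast this
  calc _ ≤ ((P.smallBoundary k).card : ℝ) * Real.exp (-l) := by
        simp only [← exists_prop, Set.ofPred_exists]
        exact (measureReal_biUnion_finset_le _ _).trans ((Finset.sum_le_card_nsmul _ _ _
          fun D _ => hP.measure_sum_bags_agree_le hc hn Y hq0 hq D l).trans_eq (nsmul_eq_mul _ _))
    _ ≤ 2 * N ^ k * (δ / (4 * N ^ k)) := by
        rw [hl, ← Real.log_pow, ← Real.log_mul (by positivity) (by positivity), Real.exp_neg,
          Real.exp_log (by positivity), div_mul_eq_mul_div, inv_div]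
        gcongr
    _ = δ / 2 := by field_simp; norm_num

section Flipped

/-- The components outside `B` on which the labelings `s` and `σ` differ. -/
def flipped (s σ : Fin N → ℤˣ) (B : Finset (Fin N)) : Finset (Fin N) :=
  Finset.univ.filter fun i => i ∉ B ∧ s i ≠ σ i

theorem mem_flipped {s σ : Fin N → ℤˣ} {B : Finset (Fin N)} {i : Fin N} :
    i ∈ flipped s σ B ↔ i ∉ B ∧ s i ≠ σ i :=
  Finset.mem_filter_univ i

theorem flipOn_flipped (s σ : Fin N → ℤˣ) {B : Finset (Fin N)} {i : Fin N} (hi : i ∉ B) :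
    flipOn (flipped s σ B) i = s i * σ i := by
  by_cases h : s i = σ i
  · rw [flipOn, if_neg fun hD => (mem_flipped.1 hD).2 h, h, Int.units_mul_self]
  · rw [flipOn, if_pos (mem_flipped.2 ⟨hi, h⟩), Int.units_ne_iff_eq_neg.1 h, neg_mul,
      Int.units_mul_self]

variable {Y : Fin n → ℤˣ} {est : Fin N → Fin n → ℤˣ} {link : Sym2 (Fin N) → Fin n}
  {s σ : Fin N → ℤˣ} {B : Finset (Fin N)}

theorem edgeProd_eq_edgeProd_est (hσ : ∀ i ∉ B, ∀ v ∈ P.bag i, est i v = σ i * Y v)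
    (hlink : ∀ i j, P.tree.Adj i j → link s(i, j) ∈ P.bag i ∩ P.bag j) {e : Sym2 (Fin N)}
    (he : e ∈ P.tree.edgeFinset) (hB : ¬ ∃ i ∈ B, i ∈ e) :
    edgeProd σ e = edgeProd (fun i => est i (link e)) e := by
  induction e with | _ i j => ?_
  obtain ⟨hi, hj⟩ := Finset.mem_inter.1 (hlink i j (SimpleGraph.mem_edgeFinset.1 he))
  rw [edgeProd_mk, edgeProd_mk, hσ i (fun h => hB ⟨i, h, Sym2.mem_mk_left i j⟩) _ hi,
    hσ j (fun h => hB ⟨j, h, Sym2.mem_mk_right i j⟩) _ hj, mul_mul_mul_comm, Int.units_mul_self,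
    mul_one]

theorem violations_le_card_filter_exists_mem
    (hσ : ∀ i ∉ B, ∀ v ∈ P.bag i, est i v = σ i * Y v)
    (hlink : ∀ i j, P.tree.Adj i j → link s(i, j) ∈ P.bag i ∩ P.bag j) :
    P.violations est link σ ≤ (P.tree.edgeFinset.filter fun e => ∃ i ∈ B, i ∈ e).card := by
  refine Finset.card_le_card fun e he => ?_
  rw [Finset.mem_filter] at he ⊢
  exact ⟨he.1, by_contra fun hB => he.2 (edgeProd_eq_edgeProd_est hσ hlink he.1 hB)⟩

theorem card_edgeBoundary_flipped_le (hσ : ∀ i ∉ B, ∀ v ∈ P.bag i, est i v = σ i * Y v)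
    (hlink : ∀ i j, P.tree.Adj i j → link s(i, j) ∈ P.bag i ∩ P.bag j) :
    (edgeBoundary P.tree (flipped s σ B)).card ≤ P.violations est link s +
      (P.tree.edgeFinset.filter fun e => ∃ i ∈ B, i ∈ e).card := by
  refine (Finset.card_le_card fun e he => ?_).trans (Finset.card_union_le _ _)
  obtain ⟨heT, he⟩ := Finset.mem_filter.1 he
  rw [Finset.mem_union, Finset.mem_filter, Finset.mem_filter]
  by_cases hB : ∃ i ∈ B, i ∈ e
  · exact Or.inr ⟨heT, hB⟩
  · rw [edgeProd_congr fun i hi => flipOn_flipped s σ fun h => hB ⟨i, h, hi⟩, edgeProd_mul] at he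
    refine Or.inl ⟨heT, fun h => ?_⟩
    rw [h, ← edgeProd_eq_edgeProd_est hσ hlink heT hB, Int.units_mul_self] at he
    exact absurd he (by decide)

theorem indicator_sub_indicator (y z : ℤˣ) :
    ((if -y ≠ z then 1 else 0 : ℝ)) - (if y ≠ z then 1 else 0) = agree y z := by
  rcases Int.units_eq_one_or y with rfl | rfl <;> rcases Int.units_eq_one_or z with rfl | rfl <;>
    norm_num [agree]

theorem bagCost_neg_sub_bagCost {Z : VertexObs n} {i : Fin N} {t : ℤˣ}
    (ht : ∀ v ∈ P.bag i, est i v = t * Y v) :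
    (P.bagCost Z est i (-t) : ℝ) - P.bagCost Z est i t = ∑ v ∈ P.bag i, agree (Y v) (Z v) := by
  simp only [bagCost, Finset.card_filter, Nat.cast_sum, Nat.cast_ite, Nat.cast_one, Nat.cast_zero]
  rw [← Finset.sum_sub_distrib]
  refine Finset.sum_congr rfl fun v hv => ?_
  rw [ht v hv, neg_mul, ← mul_assoc, Int.units_mul_self, one_mul, indicator_sub_indicator]

theorem sum_agree_flipped_le {Z : VertexObs n}
    (hσ : ∀ i ∉ B, ∀ v ∈ P.bag i, est i v = σ i * Y v)
    (hcost : ∑ i, P.bagCost Z est i (s i) ≤ ∑ i, P.bagCost Z est i (σ i)) :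
    ∑ i ∈ flipped s σ B, ∑ v ∈ P.bag i, agree (Y v) (Z v) ≤ ∑ i ∈ B, ((P.bag i).card : ℝ) := by
  have hterm : ∀ i, (if i ∈ flipped s σ B then ∑ v ∈ P.bag i, agree (Y v) (Z v) else 0)
      - (if i ∈ B then ((P.bag i).card : ℝ) else 0) ≤
      (P.bagCost Z est i (s i) : ℝ) - P.bagCost Z est i (σ i) := by
    intro i
    by_cases hi : i ∈ B
    · have hle : (P.bagCost Z est i (σ i) : ℝ) ≤ (P.bag i).card :=
        Nat.cast_le.2 (Finset.card_filter_le _ _)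
      rw [if_neg fun h => (mem_flipped.1 h).1 hi, if_pos hi]
      linarith [(P.bagCost Z est i (s i)).cast_nonneg (α := ℝ)]
    · rw [if_neg hi, sub_zero]
      by_cases hs : s i = σ i
      · rw [if_neg fun h => (mem_flipped.1 h).2 hs, hs, sub_self]
      · rw [if_pos (mem_flipped.2 ⟨hi, hs⟩), Int.units_ne_iff_eq_neg.1 hs,
          bagCost_neg_sub_bagCost (hσ i hi)]
  have hsum := Finset.sum_le_sum fun i (_ : i ∈ Finset.univ) => hterm i
  rw [Finset.sum_sub_distrib, Finset.sum_sub_distrib] at hsum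
  simp only [Finset.sum_ite_mem, Finset.univ_inter] at hsum
  have hcost' : (∑ i, (P.bagCost Z est i (s i) : ℝ)) ≤ ∑ i, (P.bagCost Z est i (σ i) : ℝ) := by
    exact_mod_cast hcost
  linarith

theorem hammingDist_le_sum_card_bag {Yhat : Fin n → ℤˣ} {home : Fin n → Fin N}
    (hσ : ∀ i ∉ B, ∀ v ∈ P.bag i, est i v = σ i * Y v) (hhome : ∀ v, v ∈ P.bag (home v))
    (hout : ∀ v, Yhat v = s (home v) * est (home v) v) :
    hammingDist Yhat Y ≤ ∑ i ∈ B, (P.bag i).card + ∑ i ∈ flipped s σ B, (P.bag i).card := by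
  have hsub : (Finset.univ.filter fun v => Yhat v ≠ Y v) ⊆
      B.biUnion P.bag ∪ (flipped s σ B).biUnion P.bag := by
    intro v hv
    rw [Finset.mem_filter_univ] at hv
    simp only [Finset.mem_union, Finset.mem_biUnion]
    by_cases hB : home v ∈ B
    · exact Or.inl ⟨_, hB, hhome v⟩
    · refine Or.inr ⟨_, mem_flipped.2 ⟨hB, fun hs => hv ?_⟩, hhome v⟩
      rw [hout, hs, hσ _ hB v (hhome v), ← mul_assoc, Int.units_mul_self, one_mul]
  exact (Finset.card_le_card hsub).trans ((Finset.card_union_le _ _).trans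
    (add_le_add Finset.card_biUnion_le Finset.card_biUnion_le))

end Flipped

open Classical in
theorem IsOutput.exists_flipped {p δ : ℝ} {X : EdgeObs P} {Z : VertexObs n} {Yhat : Fin n → ℤˣ}
    (h : P.IsOutput p δ X Z Yhat) (hb : ∀ i, P.bag i ⊆ P.ext i) (Y : Fin n → ℤˣ)
    (hcor : ((Finset.univ.filter fun i => X ∈ P.corrupted Y i).card : ℝ) ≤ P.errBudget p δ) :
    ∃ D ∈ P.smallBoundary ⌊2 * P.treeBudget p δ⌋₊,
      ∑ i ∈ D, ∑ v ∈ P.bag i, agree (Y v) (Z v) ≤ P.errBudget p δ * (P.wid + 1) ∧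
      (hammingDist Yhat Y : ℝ) ≤
        P.errBudget p δ * (P.wid + 1) + ∑ i ∈ D, ((P.bag i).card : ℝ) := by
  obtain ⟨est, link, s, home, hest, hlink, hfeas, hopt, hhome, hout⟩ := h
  set B := Finset.univ.filter fun i => X ∈ P.corrupted Y i
  have hsign : ∀ i, ∃ t : ℤˣ, i ∉ B → ∀ v ∈ P.bag i, est i v = t * Y v := by
    intro i
    by_cases hi : X ∈ P.corrupted Y i
    · exact ⟨1, fun h => absurd ((Finset.mem_filter_univ i).2 hi) h⟩
    · exact (eq_or_eq_neg_of_notMem_corrupted (hb i) hi (hest i Y)).imp fun _ h _ => h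
  choose σ hσ using hsign
  have hincident : ((P.tree.edgeFinset.filter fun e => ∃ i ∈ B, i ∈ e).card : ℝ) ≤
      P.treeBudget p δ :=
    calc ((P.tree.edgeFinset.filter fun e => ∃ i ∈ B, i ∈ e).card : ℝ)
        ≤ B.card * P.treeDeg := by
          rw [← Nat.cast_mul, Nat.cast_le, treeDeg]
          convert card_filter_exists_mem_le_mul_maxDegree P.tree B
      _ ≤ P.treeBudget p δ := by
          rw [treeBudget, mul_comm]
          gcongr
  have hbag : ∑ i ∈ B, ((P.bag i).card : ℝ) ≤ P.errBudget p δ * (P.wid + 1) :=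
    calc ∑ i ∈ B, ((P.bag i).card : ℝ) ≤ B.card • ((P.wid : ℝ) + 1) :=
          Finset.sum_le_card_nsmul _ _ _ fun i _ => by exact_mod_cast P.card_bag_le i
      _ ≤ _ := by rw [nsmul_eq_mul]; gcongr
  have hcost := hopt σ
    ((Nat.cast_le.2 (violations_le_card_filter_exists_mem hσ hlink)).trans hincident)
  refine ⟨flipped s σ B, (Finset.mem_filter_univ _).2 (Nat.le_floor ?_),
    (sum_agree_flipped_le hσ hcost).trans hbag, ?_⟩
  · have := Nat.cast_le (α := ℝ).2 (card_edgeBoundary_flipped_le (s := s) hσ hlink)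
    push_cast at this
    linarith
  · have := Nat.cast_le (α := ℝ).2 (hammingDist_le_sum_card_bag hσ hhome hout)
    push_cast at this
    linarith

end Setup

/-! ## The error bounds -/

instance isProbabilityMeasure_obsLaw {n N : ℕ} (P : Setup n N) (Y : Fin n → ℤˣ) (p q : ℝ)
    [Fact (p ∈ Set.Icc (0 : ℝ) 1)] [Fact (q ∈ Set.Icc (0 : ℝ) 1)] :
    IsProbabilityMeasure (obsLaw P Y p q) := by
  rw [obsLaw]
  infer_instance

theorem log_two_le_log_one_div {δ : ℝ} (hδ : 0 < δ) (hδ2 : δ ≤ 1 / 2) :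
    Real.log 2 ≤ Real.log (1 / δ) :=
  Real.log_le_log two_pos (by rw [le_div_iff₀ hδ]; linarith)

theorem half_le_log {n : ℕ} (hn : 2 ≤ n) : 1 / 2 ≤ Real.log n :=
  calc (1 / 2 : ℝ) ≤ Real.log 2 := by linarith [Real.log_two_gt_d9]
    _ ≤ Real.log n := Real.log_le_log two_pos (by exact_mod_cast hn)

theorem add_div_add_div_sq_le {ε A B l S : ℝ} (hε : 0 < ε) (hε2 : ε ≤ 1 / 2) (hB : 1 ≤ B)
    (hS : 0 ≤ S) (hA : A ≤ 32 * S) (hl : l ≤ 35 * S) :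
    A + (A / ε + B * l / ε ^ 2) ≤ 67 / ε ^ 2 * B * S := by
  have hinv : 1 + 1 / ε ≤ 1 / ε ^ 2 := by
    rw [le_div_iff₀ (by positivity), add_mul, one_mul, sq, ← mul_assoc, one_div_mul_cancel hε.ne']
    nlinarith
  calc A + (A / ε + B * l / ε ^ 2) = A * (1 + 1 / ε) + B * l / ε ^ 2 := by ring
    _ ≤ 32 * S * (1 / ε ^ 2) + B * (35 * S) / ε ^ 2 := by gcongr
    _ ≤ 32 * (B * S) * (1 / ε ^ 2) + B * (35 * S) / ε ^ 2 := by
        gcongr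
        exact le_mul_of_one_le_left hS hB
    _ = 67 / ε ^ 2 * B * S := by ring

namespace Setup

variable {n N : ℕ} {P : Setup n N}

theorem cutSum_nonneg {p : ℝ} (hp : 0 ≤ p) : 0 ≤ P.cutSum p :=
  Finset.sum_nonneg fun _ _ => pow_nonneg hp _

theorem errBudget_nonneg {p δ : ℝ} (hp : 0 ≤ p) (hδ : 0 < δ) (hδ2 : δ ≤ 2) :
    0 ≤ P.errBudget p δ := by
  have hlog : 0 ≤ Real.log (2 / δ) := Real.log_nonneg ((one_le_div hδ).2 hδ2)
  have := P.cutSum_nonneg hp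
  rw [errBudget]
  positivity

/-- The order of magnitude of `errBudget`, in the form in which it enters the error bound. -/
noncomputable def errScale (P : Setup n N) (p δ : ℝ) : ℝ :=
  4 ^ P.widStar * P.cutSum p + P.edgeDegStar * P.maxExtEdges * Real.log (1 / δ)

theorem errScale_nonneg {p δ : ℝ} (hp : 0 ≤ p) (hδ : 0 < δ) (hδ1 : δ ≤ 1) :
    0 ≤ P.errScale p δ := by
  have hlog : 0 ≤ Real.log (1 / δ) := Real.log_nonneg ((one_le_div hδ).2 hδ1)
  have := P.cutSum_nonneg hp
  rw [errScale]
  positivity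

theorem errBudget_le_errScale {p δ : ℝ} (hδ : 0 < δ) (hδ2 : δ ≤ 1 / 2) :
    P.errBudget p δ ≤ 16 * P.errScale p δ := by
  have hlog : Real.log (2 / δ) ≤ 2 * Real.log (1 / δ) := by
    rw [← mul_one_div, Real.log_mul two_ne_zero (by positivity)]
    linarith [log_two_le_log_one_div hδ hδ2]
  have hlog0 : 0 ≤ Real.log (1 / δ) :=
    (Real.log_pos one_lt_two).le.trans (log_two_le_log_one_div hδ hδ2)
  calc P.errBudget p δ
      ≤ 4 ^ (P.widStar + 2) * P.cutSum p +
          6 * P.edgeDegStar * P.maxExtEdges * (2 * Real.log (1 / δ)) := by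
        rw [errBudget]
        gcongr
    _ = 16 * (4 ^ P.widStar * P.cutSum p) +
          12 * (P.edgeDegStar * P.maxExtEdges * Real.log (1 / δ)) := by ring
    _ ≤ 16 * P.errScale p δ := by
        rw [errScale, mul_add]
        gcongr
        norm_num

namespace IsAdmissible

open Classical in
theorem measure_hammingDist_le (hP : P.IsAdmissible) (hc : P.probed.Connected)
    (hn : 2 ≤ n) (Y : Fin n → ℤˣ) {p q δ : ℝ} (hp : p ∈ Set.Icc (0 : ℝ) 1) (hq0 : 0 ≤ q)
    (hq : q < 1 / 2) (hδ : 0 < δ) (hδ2 : δ ≤ 2) :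
    1 - δ ≤ (obsLaw P Y p q).real
      {m | ∀ Yhat : Fin n → ℤˣ, P.IsOutput p δ m.1 m.2 Yhat →
        (hammingDist Yhat Y : ℝ) ≤ P.errBudget p δ * (P.wid + 1) +
          (P.errBudget p δ * (P.wid + 1) / (1 / 2 - q) + (P.probed.maxDegree * P.edgeDegStar : ℝ) *
            (Real.log (4 / δ) + ⌊2 * P.treeBudget p δ⌋₊ * Real.log N) / (1 / 2 - q) ^ 2)} := by
  have : Fact (p ∈ Set.Icc (0 : ℝ) 1) := ⟨hp⟩
  have : Fact (q ∈ Set.Icc (0 : ℝ) 1) := ⟨hq0, by linarith⟩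
  have hcor := hP.measure_errBudget_lt_le hc hn hp hδ hδ2 Y
  have hunif := hP.measure_uninformative_le hc hn Y hq0 hq hδ ⌊2 * P.treeBudget p δ⌋₊
  set A := {X | P.errBudget p δ < (Finset.univ.filter fun i => X ∈ P.corrupted Y i).card}
  set l := Real.log (4 / δ) + ⌊2 * P.treeBudget p δ⌋₊ * Real.log N
  set B := {Z : Fin n → ℤˣ | ∃ D ∈ P.smallBoundary ⌊2 * P.treeBudget p δ⌋₊,
    ∑ i ∈ D, ∑ v ∈ P.bag i, agree (Y v) (Z v) ≤ (1 / 2 - q) * ∑ i ∈ D, ((P.bag i).card : ℝ)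
          - (P.probed.maxDegree * P.edgeDegStar : ℝ) * l / (1 / 2 - q)}
  have hbad : (obsLaw P Y p q).real (A ×ˢ Set.univ ∪ Set.univ ×ˢ B) ≤ δ := by
    refine (measureReal_union_le _ _).trans ?_
    rw [obsLaw, measureReal_prod_prod, measureReal_prod_prod, probReal_univ, probReal_univ]
    linarith
  calc 1 - δ ≤ 1 - (obsLaw P Y p q).real (A ×ˢ Set.univ ∪ Set.univ ×ˢ B) := by linarith
    _ = (obsLaw P Y p q).real (A ×ˢ Set.univ ∪ Set.univ ×ˢ B)ᶜ :=
        (probReal_compl_eq_one_sub (Set.toFinite _).measurableSet).symm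
    _ ≤ _ := by
        refine measureReal_mono fun m hm Yhat hY => ?_
        obtain ⟨hA, hB⟩ : m.1 ∉ A ∧ m.2 ∉ B := by simpa using hm
        obtain ⟨D, hD, hagree, hdist⟩ := hY.exists_flipped hP.bag_subset_ext Y (not_lt.1 hA)
        have hlt := (not_le.1 fun h => hB ⟨D, hD, h⟩).trans_le hagree
        rw [sub_lt_iff_lt_add, ← lt_div_iff₀' (sub_pos.2 hq), add_div, div_div, ← sq] at hlt
        exact hdist.trans (by gcongr)

theorem log_one_div_le_errScale (hP : P.IsAdmissible) (hc : P.probed.Connected) (hn : 2 ≤ n)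
    {p δ : ℝ} (hp : 0 ≤ p) (hδ : 0 < δ) (hδ1 : δ ≤ 1) :
    Real.log (1 / δ) ≤ P.errScale p δ := by
  have hlog : 0 ≤ Real.log (1 / δ) := Real.log_nonneg ((one_le_div hδ).2 hδ1)
  have hone : (1 : ℝ) ≤ P.edgeDegStar * P.maxExtEdges := by
    exact_mod_cast Nat.mul_pos (hP.one_le_edgeDegStar hc hn) (hP.one_le_maxExtEdges hc hn)
  rw [errScale]
  linarith [le_mul_of_one_le_left hlog hone,
    mul_nonneg (pow_nonneg zero_le_four P.widStar) (P.cutSum_nonneg hp)]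

theorem log_add_floor_mul_log_le (hP : P.IsAdmissible) (hc : P.probed.Connected) (hn : 2 ≤ n)
    {p δ : ℝ} (hp : 0 ≤ p) (hδ : 0 < δ) (hδ2 : δ ≤ 1 / 2) :
    Real.log (4 / δ) + ⌊2 * P.treeBudget p δ⌋₊ * Real.log N ≤
      35 * (P.errScale p δ * (P.wid + P.treeDeg * Real.log n)) := by
  have hscale := hP.log_one_div_le_errScale hc hn hp hδ (by linarith)
  have hlog2 := log_two_le_log_one_div hδ hδ2
  have hQ : 0 ≤ P.errScale p δ := errScale_nonneg hp hδ (by linarith)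
  have hK := errBudget_nonneg (P := P) hp hδ (by linarith)
  have hT : 0 ≤ P.treeBudget p δ := mul_nonneg (Nat.cast_nonneg _) hK
  have hwid : (1 : ℝ) ≤ P.wid := by exact_mod_cast hP.one_le_wid hc hn
  have hlogN : Real.log N ≤ Real.log n := by
    obtain ⟨i⟩ := hP.isTreeDecomposition.isTree.connected.nonempty
    exact Real.log_le_log (by exact_mod_cast i.pos)
      (by exact_mod_cast hP.card_le (by omega))
  have hfour : Real.log (4 / δ) ≤ 3 * P.errScale p δ := by
    rw [show (4 : ℝ) / δ = 2 ^ 2 * (1 / δ) by ring, Real.log_mul (by norm_num) (by positivity),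
      Real.log_pow]
    push_cast
    linarith
  calc Real.log (4 / δ) + ⌊2 * P.treeBudget p δ⌋₊ * Real.log N
      ≤ 3 * P.errScale p δ + 2 * P.treeBudget p δ * Real.log n := by
        gcongr
        exact Nat.floor_le (by positivity)
    _ = 3 * P.errScale p δ + 2 * P.errBudget p δ * (P.treeDeg * Real.log n) := by
        rw [treeBudget]; ring
    _ ≤ 35 * P.errScale p δ * P.wid + 2 * (16 * P.errScale p δ) * (P.treeDeg * Real.log n) := by
        refine add_le_add ?_ (by gcongr; exact errBudget_le_errScale hδ hδ2)
        exact (mul_le_mul_of_nonneg_right (by norm_num) hQ).trans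
          (le_mul_of_one_le_right (by positivity) hwid)
    _ ≤ 35 * (P.errScale p δ * (P.wid + P.treeDeg * Real.log n)) := by
        have : 0 ≤ P.errScale p δ * (P.treeDeg * Real.log n) := by positivity
        linarith

theorem measure_error_le (hP : P.IsAdmissible) (hc : P.probed.Connected)
    (hn : 2 ≤ n) (Y : Fin n → ℤˣ) {p q δ : ℝ} (hp : p ∈ Set.Icc (0 : ℝ) 1) (hq0 : 0 ≤ q)
    (hq : q < 1 / 2) (hδ : 0 < δ) (hδ2 : δ ≤ 1 / 2) :
    1 - δ ≤ (obsLaw P Y p q).real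
      {m | ∀ Yhat : Fin n → ℤˣ, P.IsOutput p δ m.1 m.2 Yhat →
        (hammingDist Yhat Y : ℝ) ≤
          67 / (1 / 2 - q) ^ 2 * (P.probed.maxDegree * P.edgeDegStar) *
            P.errScale p δ * (P.wid + P.treeDeg * Real.log n)} := by
  have : Fact (p ∈ Set.Icc (0 : ℝ) 1) := ⟨hp⟩
  have : Fact (q ∈ Set.Icc (0 : ℝ) 1) := ⟨hq0, by linarith⟩
  have hQ : 0 ≤ P.errScale p δ := errScale_nonneg hp.1 hδ (by linarith)
  have hlog : 0 ≤ P.treeDeg * Real.log n := by positivity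
  have hwid : (1 : ℝ) ≤ P.wid := by exact_mod_cast hP.one_le_wid hc hn
  have hdeg : (1 : ℝ) ≤ P.probed.maxDegree * P.edgeDegStar := by
    exact_mod_cast Nat.mul_pos (hP.one_le_maxDegree hc hn) (hP.one_le_edgeDegStar hc hn)
  have hcount : P.errBudget p δ * (P.wid + 1) ≤
      32 * (P.errScale p δ * (P.wid + P.treeDeg * Real.log n)) :=
    calc P.errBudget p δ * (P.wid + 1)
        ≤ 16 * P.errScale p δ * (2 * (P.wid + P.treeDeg * Real.log n)) := by
          gcongr
          · exact errBudget_le_errScale hδ hδ2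
          · linarith
      _ = _ := by ring
  refine (hP.measure_hammingDist_le hc hn Y hp hq0 hq hδ (by linarith)).trans
    (measureReal_mono fun m hm Yhat hY => (hm Yhat hY).trans ?_)
  rw [mul_assoc _ (P.errScale p δ)]
  exact add_div_add_div_sq_le (sub_pos.2 hq) (by linarith) hdeg (by positivity) hcount
    (hP.log_add_floor_mul_log_le hc hn hp.1 hδ hδ2)

theorem cutSum_le (hP : P.IsAdmissible) (hn : 0 < n) {p : ℝ} (hp : p ∈ Set.Icc (0 : ℝ) 1) {Δ : ℕ}
    (hΔ : ∀ i, Δ ≤ P.mincutStar i) : P.cutSum p ≤ p ^ ((Δ + 1) / 2) * n :=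
  have hp0 := hp.1
  calc P.cutSum p ≤ ∑ _i : Fin N, p ^ ((Δ + 1) / 2) := Finset.sum_le_sum fun i _ =>
        pow_le_pow_of_le_one hp.1 hp.2 (Nat.div_le_div_right (Nat.succ_le_succ (hΔ i)))
    _ = p ^ ((Δ + 1) / 2) * N := by simp [mul_comm]
    _ ≤ p ^ ((Δ + 1) / 2) * n := by gcongr; exact hP.card_le hn

end IsAdmissible

/-- The constant in the error bound when all parameters are at most `D`. -/
def errorConst (D : ℕ) : ℝ := 67 * D ^ 2 * (4 ^ D + D ^ 2) * (3 * D)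

namespace BoundedBy

variable {D : ℕ}

theorem errScale_le (hD : P.BoundedBy D) {p : ℝ} (hp : 0 ≤ p) :
    P.errScale p (1 / n) ≤ (4 ^ D + D ^ 2) * (P.cutSum p + Real.log n) := by
  have hedge := hD.edgeDegStar_le
  have hext := hD.maxExtEdges_le
  have hcut := P.cutSum_nonneg hp
  rw [errScale, one_div_one_div]
  calc 4 ^ P.widStar * P.cutSum p + P.edgeDegStar * P.maxExtEdges * Real.log n
      ≤ 4 ^ D * P.cutSum p + D * D * Real.log n := by
        gcongr
        · norm_num
        · exact hD.widStar_le
    _ ≤ 4 ^ D * P.cutSum p + D * D * Real.log n +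
          (D ^ 2 * P.cutSum p + 4 ^ D * Real.log n) := le_add_of_nonneg_right (by positivity)
    _ = (4 ^ D + D ^ 2) * (P.cutSum p + Real.log n) := by ring

theorem wid_add_treeDeg_mul_log_le (hD : P.BoundedBy D) (hP : P.IsAdmissible) (hn : 2 ≤ n) :
    P.wid + P.treeDeg * Real.log n ≤ 3 * D * Real.log n := by
  have hlog := half_le_log hn
  have hwid : (P.wid : ℝ) ≤ D := by exact_mod_cast hP.wid_le_widStar.trans hD.widStar_le
  have hdeg := hD.treeDeg_le
  calc P.wid + P.treeDeg * Real.log n ≤ D * (2 * Real.log n) + D * Real.log n := by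
        gcongr
        exact hwid.trans (le_mul_of_one_le_right (Nat.cast_nonneg _) (by linarith))
    _ = 3 * D * Real.log n := by ring

theorem measure_error_le (hD : P.BoundedBy D) (hP : P.IsAdmissible) (hc : P.probed.Connected)
    (hn : 2 ≤ n) (Y : Fin n → ℤˣ) {p q : ℝ} (hp : p ∈ Set.Icc (0 : ℝ) 1) (hq0 : 0 ≤ q)
    (hq : q < 1 / 2) {S C : ℝ} (hS : P.cutSum p ≤ S)
    (hC : errorConst D ≤ C) :
    1 - 1 / (n : ℝ) ≤ (obsLaw P Y p q).real
      {m | ∀ Yhat : Fin n → ℤˣ, P.IsOutput p (1 / n) m.1 m.2 Yhat →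
        (hammingDist Yhat Y : ℝ) ≤
          C / (1 / 2 - q) ^ 2 * Real.log n * (S + Real.log n)} := by
  have : Fact (p ∈ Set.Icc (0 : ℝ) 1) := ⟨hp⟩
  have : Fact (q ∈ Set.Icc (0 : ℝ) 1) := ⟨hq0, by linarith⟩
  have hn' : (2 : ℝ) ≤ n := by exact_mod_cast hn
  have hdeg := hD.maxDegree_le
  have hedge := hD.edgeDegStar_le
  have hcut := (P.cutSum_nonneg hp.1).trans hS
  have hδ : 1 / (n : ℝ) ≤ 1 / 2 := one_div_le_one_div_of_le two_pos hn'
  have hscale : 0 ≤ P.errScale p (1 / n) :=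
    errScale_nonneg hp.1 (by positivity) (by linarith)
  refine (hP.measure_error_le hc hn Y hp hq0 hq (by positivity) hδ).trans
    (measureReal_mono fun m hm Yhat hY => (hm Yhat hY).trans ?_)
  calc 67 / (1 / 2 - q) ^ 2 * (P.probed.maxDegree * P.edgeDegStar) * P.errScale p (1 / n) *
        (P.wid + P.treeDeg * Real.log n)
      ≤ 67 / (1 / 2 - q) ^ 2 * (D * D) * ((4 ^ D + D ^ 2) * (S + Real.log n)) *
          (3 * D * Real.log n) := by
        gcongr
        · exact (hD.errScale_le hp.1).trans (by gcongr)
        · exact hD.wid_add_treeDeg_mul_log_le hP hn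
    _ = errorConst D / (1 / 2 - q) ^ 2 * Real.log n * (S + Real.log n) := by
        rw [errorConst]; ring
    _ ≤ C / (1 / 2 - q) ^ 2 * Real.log n * (S + Real.log n) := by gcongr

end BoundedBy

end Setup

/-! ## Values of programs -/

namespace Timed

variable {α β : Type}

@[simp] theorem bind_val (x : Timed α) (f : α → Timed β) : (x >>= f).val = (f x.val).val := rfl

@[simp] theorem bind_time (x : Timed α) (f : α → Timed β) :
    (x >>= f).time = x.time + (f x.val).time := rfl

@[simp] theorem pure_val (a : α) : (pure a : Timed α).val = a := rfl

@[simp] theorem pure_time (a : α) : (pure a : Timed α).time = 0 := rfl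

@[simp] theorem tick_time (k : ℕ) : (tick k).time = k := rfl

@[simp] theorem fetch_val {ι : Type} (a : ι → α) (i : ι) : (fetch a i).val = a i := rfl

@[simp] theorem fetch_time {ι : Type} (a : ι → α) (i : ι) : (fetch a i).time = 1 := rfl

@[simp] theorem fillFin_val {m : ℕ} (f : Fin m → Timed α) (i : Fin m) :
    (fillFin f).val i = (f i).val := rfl

@[simp] theorem fillUpTo_val (L : ℕ) (f : ℕ → Timed α) (k : ℕ) :
    (fillUpTo L f).val k = (f (min k L)).val := rfl

@[simp] theorem fillSign_val (f : ℤˣ → Timed α) (s : ℤˣ) : (fillSign f).val s = (f s).val := by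
  rcases Int.units_eq_one_or s with rfl | rfl <;> rfl

@[simp] theorem ite_val (c : Prop) [Decidable c] (x y : Timed α) :
    (if c then x else y).val = if c then x.val else y.val := apply_ite _ _ _ _

theorem forEach_val (l : List α) (b : β) (f : β → α → Timed β) :
    (forEach l b f).val = l.foldl (fun b a => (f b a).val) b := by
  induction l generalizing b with
  | nil => rfl
  | cons _ _ ih => exact ih _

end Timed

section Folds

theorem foldl_sort_add {α : Type*} [LinearOrder α] (s : Finset α) (g : α → ℕ) (m : ℕ) :
    s.sort.foldl (fun m a => m + g a) m = m + ∑ a ∈ s, g a := by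
  have hfold (l : List α) : l.foldl (fun m a => m + g a) m = m + (l.map g).sum := by
    induction l generalizing m with
    | nil => rfl
    | cons a l ih => simp [ih, add_assoc]
  rw [hfold, ← List.sum_toFinset g (s.sort_nodup _), s.sort_toFinset]

section

variable {α β γ : Type*} [LinearOrder γ] (key : β → γ) (f : α → β)

theorem foldl_min_mem (l : List α) (b : β) :
    l.foldl (fun b a => if key (f a) < key b then f a else b) b ∈ b :: l.map f := by
  induction l generalizing b with
  | nil => simp
  | cons a l ih =>
    rw [List.foldl_cons]
    have := ih (if key (f a) < key b then f a else b)
    grind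

theorem foldl_min_le (l : List α) (b : β) :
    ∀ c ∈ b :: l.map f,
      key (l.foldl (fun b a => if key (f a) < key b then f a else b) b) ≤ key c := by
  induction l generalizing b with
  | nil => simp
  | cons a l ih =>
    rw [List.foldl_cons]
    have := ih (if key (f a) < key b then f a else b)
    grind

end

theorem foldl_or_find {α : Type*} (p : α → Prop) [DecidablePred p] (l : List α) (o : Option α) :
    l.foldl (fun o a => if o.isNone ∧ p a then some a else o) o = o.or (l.find? p) := by
  induction l generalizing o with
  | nil => simp
  | cons a l ih =>
    rw [List.foldl_cons, ih]
    cases o with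
    | none => by_cases h : p a <;> simp [h]
    | some b => simp

theorem find_sort_eq_min' {α : Type*} [LinearOrder α] {s t : Finset α} (h : (s ∩ t).Nonempty) :
    s.sort.find? (· ∈ t) = some ((s ∩ t).min' h) := by
  obtain ⟨hs, ht⟩ := Finset.mem_inter.1 ((s ∩ t).min'_mem h)
  obtain ⟨l, l', hl⟩ := List.append_of_mem ((Finset.mem_sort (· ≤ ·)).2 hs)
  refine List.find?_eq_some_iff_append.2 ⟨by simpa using ht, l, l', hl, fun a ha => ?_⟩
  have hlt : a < (s ∩ t).min' h := by
    have := s.sortedLT_sort.pairwise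
    rw [hl, List.pairwise_append] at this
    exact this.2.2 a ha _ (List.mem_cons_self ..)
  have has : a ∈ s := (Finset.mem_sort (· ≤ ·)).1 (hl ▸ List.mem_append_left _ ha)
  simpa using fun hat => hlt.not_ge (Finset.min'_le _ _ (Finset.mem_inter.2 ⟨has, hat⟩))

theorem foldl_update {α β : Type*} [DecidableEq α] (l : List α) (f : α → β) (b : β) (a : α) :
    l.foldl (fun f a => Function.update f a b) f a = if a ∈ l then b else f a := by
  induction l generalizing f with
  | nil => simp
  | cons c l ih =>
    rw [List.foldl_cons, ih]
    grind

theorem foldl_ite_of_exists {α : Type*} {p : α → Prop} [DecidablePred p] {l : List α} {b : α}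
    (h : p b ∨ ∃ a ∈ l, p a) : p (l.foldl (fun b a => if p a then a else b) b) := by
  induction l generalizing b with
  | nil => simpa using h
  | cons a l ih =>
    rw [List.foldl_cons]
    grind

end Folds

namespace Setup

variable {n N : ℕ} {P : Setup n N}

/-- The measurement of the edge `e`, with the value `1` at pairs that are not edges. -/
def edgeObsAt (X : EdgeObs P) (e : Sym2 (Fin n)) : ℤˣ :=
  if h : e ∈ P.graph.edgeSet then X ⟨e, h⟩ else 1

theorem readEdge_val (X : EdgeObs P) (u v : Fin n) :
    (P.readEdge X u v).val = edgeObsAt X s(u, v) := rfl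

theorem disagreements_eq_sum (hP : P.probed ≤ P.graph) (X : EdgeObs P) (i : Fin N)
    (y : Fin n → ℤˣ) :
    P.disagreements X i y = ∑ e ∈ P.extEdges i, if edgeProd y e ≠ edgeObsAt X e then 1 else 0 := by
  rw [← Finset.card_filter, disagreements]
  refine Finset.card_nbij Subtype.val (fun e he => ?_) Subtype.val_injective.injOn fun e he => ?_
  · obtain ⟨hmem, hne⟩ := (Finset.mem_filter_univ e).1 he
    exact Finset.mem_filter.2 ⟨hmem, by rwa [edgeObsAt, dif_pos e.2]⟩
  · obtain ⟨hmem, hne⟩ := Finset.mem_filter.1 he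
    have hedge : e ∈ P.graph.edgeSet := SimpleGraph.edgeSet_mono hP
      (SimpleGraph.mem_edgeFinset.1 (Finset.mem_filter.1 hmem).1)
    exact ⟨⟨e, hedge⟩, by simpa [hmem, edgeObsAt, hedge] using hne, rfl⟩

theorem sum_extEdges (i : Fin N) (f : Sym2 (Fin n) → ℕ) :
    ∑ e ∈ P.extEdges i, f e =
      ∑ u ∈ P.ext i, ∑ v ∈ P.ext i, if u < v ∧ P.probed.Adj u v then f s(u, v) else 0 := by
  have hext : P.extEdges i =
      ((P.ext i).sym2.filter fun e => ¬ e.IsDiag).filter (· ∈ P.probed.edgeFinset) := by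
    ext e
    induction e with | _ u v
    have := P.probed.ne_of_adj (a := u) (b := v)
    simp only [mem_extEdges, Finset.mem_filter, Finset.mk_mem_sym2_iff, Sym2.mk_isDiag_iff,
      SimpleGraph.mem_edgeFinset, SimpleGraph.mem_edgeSet]
    tauto
  rw [hext, Finset.sum_filter, Finset.sum_sym2_filter_not_isDiag, ← Finset.sum_product',
    ← Finset.sum_filter, ← Finset.sum_filter]
  refine Finset.sum_congr (Finset.ext fun x => ?_) fun _ _ => rfl
  have := P.probed.ne_of_adj (a := x.1) (b := x.2)
  simp only [Finset.mem_filter, Finset.mem_offDiag, Finset.mem_product,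
    SimpleGraph.mem_edgeFinset, SimpleGraph.mem_edgeSet]
  tauto

theorem energyProg_val (hP : P.probed ≤ P.graph) (X : EdgeObs P) (i : Fin N) (y : Fin n → ℤˣ) :
    (P.energyProg X (P.ext i).sort y).val = P.disagreements X i y := by
  rw [disagreements_eq_sum hP, sum_extEdges, ← zero_add (∑ u ∈ _, _), ← foldl_sort_add]
  simp only [energyProg, forEach_val, bind_val, ite_val, pure_val, readLabel, readEdge_val]
  congr 1
  funext m u
  rw [← foldl_sort_add]
  congr 1
  funext m v
  grind [edgeProd_mk]

theorem labelings_eq_one {l : List (Fin n)} {y : Fin n → ℤˣ} (hy : y ∈ labelings l) {v : Fin n}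
    (hv : v ∉ l) : y v = 1 := by
  induction l generalizing y with
  | nil => rw [List.mem_singleton.1 hy]
  | cons a l ih =>
    simp only [labelings, List.mem_flatMap, List.mem_cons, List.not_mem_nil, or_false] at hy
    rw [List.mem_cons, not_or] at hv
    obtain ⟨z, hz, rfl | rfl⟩ := hy
    · exact ih hz hv.2
    · rw [Function.update_of_ne hv.1, ih hz hv.2]

theorem exists_labeling (l : List (Fin n)) (y : Fin n → ℤˣ) :
    ∃ z ∈ labelings l, ∀ v ∈ l, z v = y v := by
  induction l with
  | nil => exact ⟨fun _ => 1, List.mem_singleton_self _, by simp⟩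
  | cons a l ih =>
    obtain ⟨z, hz, hzy⟩ := ih
    by_cases hza : z a = y a
    · exact ⟨z, List.mem_flatMap.2 ⟨z, hz, by simp⟩, List.forall_mem_cons.2 ⟨hza, hzy⟩⟩
    · have ha : a ∉ l := fun ha => hza (hzy a ha)
      rw [labelings_eq_one hz ha, eq_comm, ← ne_eq, Int.units_ne_iff_eq_neg] at hza
      refine ⟨Function.update z a (-1), List.mem_flatMap.2 ⟨z, hz, by simp⟩,
        List.forall_mem_cons.2 ⟨by simp [hza], fun v hv => ?_⟩⟩
      rw [Function.update_of_ne (ne_of_mem_of_not_mem hv ha), hzy v hv]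

theorem disagreements_congr (X : EdgeObs P) (i : Fin N) {y z : Fin n → ℤˣ}
    (h : ∀ v ∈ P.ext i, y v = z v) : P.disagreements X i y = P.disagreements X i z := by
  rw [disagreements, disagreements]
  congr 1
  refine Finset.filter_congr fun e _ => and_congr_right fun he => ?_
  rw [edgeProd_congr fun v hv => h v ((Finset.mem_filter.1 he).2 v hv)]

theorem estimatorProg_val_le (hP : P.probed ≤ P.graph) (X : EdgeObs P) (i : Fin N)
    (y : Fin n → ℤˣ) :
    P.disagreements X i (P.estimatorProg X (P.ext i).sort).val ≤ P.disagreements X i y := by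
  obtain ⟨z, hz, hzy⟩ := exists_labeling (P.ext i).sort y
  let cell (y : Fin n → ℤˣ) : ℕ × (Fin n → ℤˣ) := (P.disagreements X i y, y)
  set best := (labelings (P.ext i).sort).foldl
    (fun b y => if (cell y).1 < b.1 then cell y else b) (cell fun _ => 1) with hbest
  have hval : (P.estimatorProg X (P.ext i).sort).val = best.2 := by
    simp only [estimatorProg, bind_val, pure_val, forEach_val, energyProg_val hP, hbest, cell]
  have hmem : P.disagreements X i best.2 = best.1 := by
    have := foldl_min_mem Prod.fst cell (labelings (P.ext i).sort) (cell fun _ => 1)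
    rw [← hbest, ← List.map_cons (f := cell), List.mem_map] at this
    obtain ⟨w, -, hw⟩ := this
    rw [← hw]
  rw [hval, hmem, ← disagreements_congr X i fun v hv => hzy v ((Finset.mem_sort _).2 hv)]
  exact foldl_min_le Prod.fst cell _ _ (cell z) (List.mem_cons_of_mem _ (List.mem_map_of_mem hz))

theorem costProg_val (Z : VertexObs n) (est : Fin N → Fin n → ℤˣ) (i : Fin N) (s : ℤˣ) :
    (P.costProg Z est i s).val = P.bagCost Z est i s := by
  rw [bagCost, Finset.card_filter, ← zero_add (∑ v ∈ P.bag i, _), ← foldl_sort_add]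
  simp only [costProg, forEach_val, bind_val, readLabel, pure_val, fetch_val]
  congr 1
  funext m v
  grind

theorem signProg_val (est : Fin N → Fin n → ℤˣ) {i j : Fin N}
    (h : (P.bag i ∩ P.bag j).Nonempty) :
    (P.signProg est i j).val =
      est i ((P.bag i ∩ P.bag j).min' h) * est j ((P.bag i ∩ P.bag j).min' h) := by
  have hlink : (P.linkProg i j).val = some ((P.bag i ∩ P.bag j).min' h) := by
    simp only [linkProg, forEach_val, bind_val, pure_val]
    rw [foldl_or_find (· ∈ P.bag j), Option.none_or, find_sort_eq_min' h]
  simp only [signProg, bind_val, hlink, readLabel, pure_val]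

theorem homeProg_val_mem (hP : ∀ v, ∃ i, v ∈ P.bag i) (root : Fin N) (v : Fin n) :
    v ∈ P.bag ((P.homeProg root).val v) := by
  obtain ⟨i, hi⟩ := hP v
  have hval : (P.homeProg root).val v =
      (List.finRange N).foldl (fun j i => if v ∈ P.bag i then i else j) root := by
    simp only [homeProg, bind_val, forEach_val, pure_val]
    exact (List.foldl_hom (fun h : Fin n → Fin N => h v) fun h i => by
      simp only [foldl_update, Finset.mem_sort]).symm
  rw [hval]
  exact foldl_ite_of_exists (p := (v ∈ P.bag ·)) (Or.inr ⟨i, List.mem_finRange i, hi⟩)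

end Setup

/-! ## Correctness of the dynamic program -/

namespace Timed

instance : LawfulMonad Timed := LawfulMonad.mk' Timed
  (id_map := fun _ => rfl)
  (pure_bind := fun _ _ => congrArg (Timed.mk _) (Nat.zero_add _))
  (bind_assoc := fun _ _ _ => congrArg (Timed.mk _) (Nat.add_assoc _ _ _))

end Timed

namespace Setup

section Cells

variable {N : ℕ} {A B : Finset (Fin N)} {s s' : Fin N → ℤˣ} {l m : Labels N}

/-- The pointer structure `l` holds the labels `s` of the components in `A`, each of them once:
as a binary tree with `A.card` leaves it has `2 * A.card - 1` nodes to visit. -/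
structure Stores (l : Labels N) (A : Finset (Fin N)) (s : Fin N → ℤˣ) : Prop where
  val_eq : ∀ a, (writeLabels l a).val = fun x => if x ∈ A then s x else a x
  time_add_one : ∀ a, (writeLabels l a).time + 1 = 2 * A.card

theorem stores_single (u : Fin N) (s : Fin N → ℤˣ) : Stores (Labels.single u (s u)) {u} s where
  val_eq a := by
    funext x
    simp only [writeLabels, bind_val, pure_val, Finset.mem_singleton]
    split_ifs with hx
    · rw [hx, Function.update_self]
    · rw [Function.update_of_ne hx]
  time_add_one _ := rfl

theorem Stores.congr (h : Stores l A s) (hs : ∀ x ∈ A, s x = s' x) : Stores l A s' where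
  val_eq a := by
    rw [h.val_eq]
    grind
  time_add_one := h.time_add_one

theorem Stores.join (hl : Stores l A s) (hm : Stores m B s) (hAB : Disjoint A B) :
    Stores (Labels.join l m) (A ∪ B) s where
  val_eq a := by
    simp only [writeLabels, bind_val]
    rw [hm.val_eq, hl.val_eq]
    grind
  time_add_one a := by
    simp only [writeLabels, bind_time, tick_time]
    rw [Finset.card_union_of_disjoint hAB]
    linarith [hl.time_add_one a, hm.time_add_one (writeLabels l a).val]

variable {cost : Fin N → ℤˣ → ℕ} {F G : (Fin N → ℤˣ) → Prop} {x y : ℕ × Labels N}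

/-- The cell `x` holds the least cost of a labeling of `A` with the property `F`, together with
such a labeling. -/
structure IsOptimal (cost : Fin N → ℤˣ → ℕ) (A : Finset (Fin N)) (F : (Fin N → ℤˣ) → Prop)
    (x : ℕ × Labels N) : Prop where
  exists_stores : ∃ s, F s ∧ ∑ i ∈ A, cost i (s i) = x.1 ∧ Stores x.2 A s
  le : ∀ s, F s → x.1 ≤ ∑ i ∈ A, cost i (s i)

namespace IsOptimal

theorem congr (h : IsOptimal cost A F x) (hFG : ∀ s, F s ↔ G s) : IsOptimal cost A G x := by
  rwa [← funext fun s => propext (hFG s)]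

theorem single (u : Fin N) (t : ℤˣ) :
    IsOptimal cost {u} (fun s => s u = t) (cost u t, Labels.single u t) where
  exists_stores := ⟨fun _ => t, rfl, Finset.sum_singleton .., stores_single u fun _ => t⟩
  le := by
    rintro s rfl
    exact (Finset.sum_singleton ..).ge

theorem better (hx : IsOptimal cost A F x) (hy : IsOptimal cost A G y) :
    IsOptimal cost A (fun s => F s ∨ G s) (Setup.better x y).val := by
  simp only [Setup.better, bind_val, pure_val]
  split_ifs with h
  · obtain ⟨s, hs, hstore⟩ := hy.exists_stores
    exact ⟨⟨s, .inr hs, hstore⟩, fun s' => Or.rec (fun hF => h.le.trans (hx.le s' hF)) (hy.le s')⟩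
  · obtain ⟨s, hs, hstore⟩ := hx.exists_stores
    exact ⟨⟨s, .inl hs, hstore⟩,
      fun s' => Or.rec (hx.le s') fun hG => (not_lt.1 h).trans (hy.le s' hG)⟩

theorem foldl_better {α : Type*} {f : α → ℕ × Labels N} {G : α → (Fin N → ℤˣ) → Prop}
    (l : List α) (hf : ∀ a ∈ l, IsOptimal cost A (G a) (f a)) (hx : IsOptimal cost A F x) :
    IsOptimal cost A (fun s => F s ∨ ∃ a ∈ l, G a s)
      (l.foldl (fun c a => (Setup.better c (f a)).val) x) := by
  induction l generalizing F x with
  | nil => exact hx.congr fun s => by simp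
  | cons a l ih =>
    obtain ⟨ha, hl⟩ := List.forall_mem_cons.1 hf
    exact (ih hl (hx.better ha)).congr fun s => by simp [or_assoc]

theorem addCells (hx : IsOptimal cost A F x) (hy : IsOptimal cost B G y) (hAB : Disjoint A B)
    (hF : DependsOn F A) (hG : DependsOn G B) :
    IsOptimal cost (A ∪ B) (fun s => F s ∧ G s) (Setup.addCells x y).val where
  exists_stores := by
    obtain ⟨s, hs, hsum, hstore⟩ := hx.exists_stores
    obtain ⟨s', hs', hsum', hstore'⟩ := hy.exists_stores
    let t : Fin N → ℤˣ := A.piecewise s s'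
    have hA : ∀ i ∈ A, s i = t i := fun i hi => (A.piecewise_eq_of_mem s s' hi).symm
    have hB : ∀ i ∈ B, s' i = t i := fun i hi =>
      (A.piecewise_eq_of_notMem s s' (Finset.disjoint_right.1 hAB hi)).symm
    refine ⟨t, ⟨(hF hA).mp hs, (hG hB).mp hs'⟩, ?_,
      (hstore.congr hA).join (hstore'.congr hB) hAB⟩
    have hsumA : ∑ i ∈ A, cost i (t i) = x.1 :=
      hsum ▸ Finset.sum_congr rfl fun i hi => by rw [hA i hi]
    have hsumB : ∑ i ∈ B, cost i (t i) = y.1 :=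
      hsum' ▸ Finset.sum_congr rfl fun i hi => by rw [hB i hi]
    rw [Finset.sum_union hAB, hsumA, hsumB]
    rfl
  le s hs := by
    rw [Finset.sum_union hAB]
    exact add_le_add (hx.le s hs.1) (hy.le s hs.2)

end IsOptimal

end Cells

section Tables

variable {N : ℕ} {T : SimpleGraph (Fin N)} {r : Fin N} {sg : Fin N → Fin N → ℤˣ}
  {cost : Fin N → ℤˣ → ℕ} {L : ℕ} {A B : Finset (Fin N)} {u c : Fin N} {g h : Table N}

/-- `A` is connected in `T`, and `u` is the component in `A` that is closest to the root `r`. -/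
structure IsSubtree (T : SimpleGraph (Fin N)) (r : Fin N) (A : Finset (Fin N)) (u : Fin N) :
    Prop where
  root_mem : u ∈ A
  parent_mem : ∀ x ∈ A, x ≠ u → parent T r x ∈ A

/-- The number of violated edges inside a subtree `A` with the root `u`.  The edge between a
component `x` and its parent `w` has the sign `sg w x` and is counted at `x`. -/
noncomputable def subViolations (T : SimpleGraph (Fin N)) (r : Fin N) (sg : Fin N → Fin N → ℤˣ)
    (A : Finset (Fin N)) (u : Fin N) (s : Fin N → ℤˣ) : ℕ :=
  ((A.erase u).filter fun x => s x ≠ s (parent T r x) * sg (parent T r x) x).card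

theorem isSubtree_singleton (u : Fin N) : IsSubtree T r {u} u where
  root_mem := Finset.mem_singleton_self u
  parent_mem _ hx hxu := absurd (Finset.mem_singleton.1 hx) hxu

theorem subViolations_singleton (u : Fin N) (s : Fin N → ℤˣ) :
    subViolations T r sg {u} u s = 0 := by
  simp [subViolations]

theorem IsSubtree.union (hA : IsSubtree T r A u) (hB : IsSubtree T r B c)
    (hcu : parent T r c = u) : IsSubtree T r (A ∪ B) u where
  root_mem := Finset.mem_union_left _ hA.root_mem
  parent_mem x hx hxu := by
    rcases Finset.mem_union.1 hx with hx | hx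
    · exact Finset.mem_union_left _ (hA.parent_mem x hx hxu)
    · by_cases hxc : x = c
      · rw [hxc, hcu]
        exact Finset.mem_union_left _ hA.root_mem
      · exact Finset.mem_union_right _ (hB.parent_mem x hx hxc)

theorem subViolations_union (hA : u ∈ A) (hB : c ∈ B) (hcu : parent T r c = u)
    (hAB : Disjoint A B) (s : Fin N → ℤˣ) :
    subViolations T r sg (A ∪ B) u s = subViolations T r sg A u s +
      (subViolations T r sg B c s + if s c ≠ s u * sg u c then 1 else 0) := by
  have hsplit : (A ∪ B).erase u = A.erase u ∪ insert c (B.erase c) := by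
    rw [Finset.erase_union_distrib, Finset.erase_eq_of_notMem (Finset.disjoint_left.1 hAB hA),
      Finset.insert_erase hB]
  have hdisj : Disjoint (A.erase u) (insert c (B.erase c)) := by
    rw [Finset.insert_erase hB]
    exact Finset.disjoint_of_subset_left (Finset.erase_subset _ _) hAB
  rw [subViolations, hsplit, Finset.filter_union,
    Finset.card_union_of_disjoint (Finset.disjoint_filter_filter hdisj), Finset.filter_insert, hcu]
  split_ifs
  · rw [Finset.card_insert_of_notMem (by simp)]
    rfl
  · rfl

theorem IsSubtree.dependsOn_subViolations (hA : IsSubtree T r A u) :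
    DependsOn (subViolations T r sg A u) (A : Set (Fin N)) := fun s s' hs => by
  rw [subViolations, subViolations]
  congr 1
  refine Finset.filter_congr fun x hx => ?_
  obtain ⟨hxu, hx⟩ := Finset.mem_erase.1 hx
  rw [hs x hx, hs _ (hA.parent_mem x hx hxu)]

/-- `g` is the table of the subtree `A` with the root `u`, up to the budget `L`. -/
structure IsTable (T : SimpleGraph (Fin N)) (r : Fin N) (sg : Fin N → Fin N → ℤˣ)
    (cost : Fin N → ℤˣ → ℕ) (L : ℕ) (A : Finset (Fin N)) (u : Fin N) (g : Table N) : Prop where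
  isSubtree : IsSubtree T r A u
  isOptimal : ∀ t, ∀ k ≤ L,
    IsOptimal cost A (fun s => s u = t ∧ subViolations T r sg A u s ≤ k) (g t k)

/-- `h` is the table of the subtree `B` with the root `c` in terms of the label and the budget of
its parent `u`: the edge between `c` and `u` is charged to the budget. -/
structure IsMessage (T : SimpleGraph (Fin N)) (r : Fin N) (sg : Fin N → Fin N → ℤˣ)
    (cost : Fin N → ℤˣ → ℕ) (L : ℕ) (B : Finset (Fin N)) (u c : Fin N) (h : Table N) :
    Prop where
  isSubtree : IsSubtree T r B c
  parent_eq : parent T r c = u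
  isOptimal : ∀ t, ∀ k ≤ L, IsOptimal cost B (fun s => subViolations T r sg B c s +
    (if s c ≠ t * sg u c then 1 else 0) ≤ k) (h t k)

theorem baseTable_val (u : Fin N) (s : ℤˣ) (k : ℕ) :
    (baseTable L cost u).val s k = (cost u s, Labels.single u s) := by
  simp only [baseTable, fillSign_val, fillUpTo_val, bind_val, pure_val]

theorem isTable_baseTable (u : Fin N) : IsTable T r sg cost L {u} u (baseTable L cost u).val where
  isSubtree := isSubtree_singleton u
  isOptimal t k _ := by
    rw [baseTable_val]
    exact (IsOptimal.single u t).congr fun s => by simp [subViolations_singleton]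

theorem IsTable.isMessage (hg : IsTable T r sg cost L B c g) (hcu : parent T r c = u) :
    IsMessage T r sg cost L B u c (messageTable L (sg u c) g).val where
  isSubtree := hg.isSubtree
  parent_eq := hcu
  isOptimal t k hk := by
    simp only [messageTable, fillSign_val, fillUpTo_val, bind_val, ite_val, fetch_val, pure_val,
      min_eq_left hk]
    split_ifs with hk0
    · refine (hg.isOptimal (t * sg u c) k hk).congr fun s => ?_
      split_ifs <;> simp_all
    · refine ((hg.isOptimal (t * sg u c) k hk).better
        (hg.isOptimal (-(t * sg u c)) (k - 1) (by omega))).congr fun s => ?_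
      have hneg := units_ne_neg_self (t * sg u c)
      split_ifs with hs
      · have hs' := Int.units_ne_iff_eq_neg.1 hs
        grind
      · grind

theorem IsMessage.dependsOn (hh : IsMessage T r sg cost L B u c h) (t : ℤˣ) (k : ℕ) :
    DependsOn (fun s => subViolations T r sg B c s + (if s c ≠ t then 1 else 0) ≤ k)
      (B : Set (Fin N)) := fun s s' hs => by
  simp only [hs c hh.isSubtree.root_mem, hh.isSubtree.dependsOn_subViolations hs]

theorem IsMessage.isTable_attachFirst (hh : IsMessage T r sg cost L B u c h) (huB : u ∉ B) :
    IsTable T r sg cost L ({u} ∪ B) u (attachFirst L (baseTable L cost u).val h).val where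
  isSubtree := (isSubtree_singleton u).union hh.isSubtree hh.parent_eq
  isOptimal t k hk := by
    have hd : Disjoint {u} B := Finset.disjoint_singleton_left.2 huB
    simp only [attachFirst, fillSign_val, fillUpTo_val, bind_val, fetch_val, min_eq_left hk,
      baseTable_val]
    refine ((IsOptimal.single u t).addCells (hh.isOptimal t k hk) hd
      (fun s s' hs => by simp only [hs u (by simp)]) (hh.dependsOn _ _)).congr fun s => ?_
    rw [subViolations_union (Finset.mem_singleton_self u) hh.isSubtree.root_mem hh.parent_eq hd,
      subViolations_singleton, zero_add]
    exact and_congr_right fun hs => by rw [hs]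

theorem IsTable.attachNext (hg : IsTable T r sg cost L A u g)
    (hh : IsMessage T r sg cost L B u c h) (hAB : Disjoint A B) :
    IsTable T r sg cost L (A ∪ B) u (Setup.attachNext L g h).val where
  isSubtree := hg.isSubtree.union hh.isSubtree hh.parent_eq
  isOptimal t k hk := by
    have hsplit (j : ℕ) (hj : j ≤ k) : IsOptimal cost (A ∪ B)
        (fun s => (s u = t ∧ subViolations T r sg A u s ≤ k - j) ∧
          subViolations T r sg B c s + (if s c ≠ t * sg u c then 1 else 0) ≤ j)
        (Setup.addCells (g t (k - j)) (h t j)).val :=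
      (hg.isOptimal t (k - j) (by omega)).addCells (hh.isOptimal t j (by omega)) hAB
        (fun s s' hs => by
          simp only [hs u hg.isSubtree.root_mem, hg.isSubtree.dependsOn_subViolations hs])
        (hh.dependsOn _ _)
    simp only [Setup.attachNext, fillSign_val, fillUpTo_val, bind_val, fetch_val,
      min_eq_left hk, forEach_val]
    refine (IsOptimal.foldl_better (List.range k)
      (fun j hj => hsplit (j + 1) (List.mem_range.1 hj)) (hsplit 0 k.zero_le)).congr fun s => ?_
    rw [subViolations_union hg.isSubtree.root_mem hh.isSubtree.root_mem hh.parent_eq hAB]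
    set b := subViolations T r sg B c s + if s c ≠ t * sg u c then 1 else 0 with hb
    constructor
    · rintro (⟨⟨rfl, hA⟩, hB⟩ | ⟨j, hj, ⟨rfl, hA⟩, hB⟩)
      · exact ⟨rfl, by omega⟩
      · have := List.mem_range.1 hj
        exact ⟨rfl, by omega⟩
    · rintro ⟨rfl, hle⟩
      rw [← hb] at hle
      rcases b.eq_zero_or_pos with hb0 | hb0
      · exact .inl ⟨⟨rfl, by omega⟩, hb0.le⟩
      · exact .inr ⟨b - 1, List.mem_range.2 (by omega), ⟨rfl, by omega⟩, by omega⟩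

theorem IsTable.foldl_attachNext {B : Fin N → Finset (Fin N)} {h : Fin N → Table N}
    {cs : List (Fin N)} (hg : IsTable T r sg cost L A u g)
    (hh : ∀ c ∈ cs, IsMessage T r sg cost L (B c) u c (h c)) (hA : ∀ c ∈ cs, Disjoint A (B c))
    (hB : cs.Pairwise (Function.onFun Disjoint B)) :
    IsTable T r sg cost L (A ∪ cs.toFinset.biUnion B) u
      (cs.foldl (fun t c => (Setup.attachNext L t (h c)).val) g) := by
  induction cs generalizing A g with
  | nil => simpa using hg
  | cons c cs ih =>
    obtain ⟨hhc, hh⟩ := List.forall_mem_cons.1 hh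
    obtain ⟨hAc, hA⟩ := List.forall_mem_cons.1 hA
    obtain ⟨hBc, hB⟩ := List.pairwise_cons.1 hB
    rw [List.foldl_cons, List.toFinset_cons, Finset.biUnion_insert, ← Finset.union_assoc]
    exact ih (hg.attachNext hhc hAc) hh
      (fun d hd => Finset.disjoint_union_left.2 ⟨hA d hd, hBc d hd⟩) hB

/-- The table of `u` with the messages `h c` of the components `c` in a list attached to it. -/
def attachAll (L : ℕ) (base : Table N) (h : Fin N → Table N) : List (Fin N) → Table N
  | [] => base
  | c :: cs => cs.foldl (fun t c => (attachNext L t (h c)).val) (attachFirst L base (h c)).val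

theorem isTable_attachAll {B : Fin N → Finset (Fin N)} {h : Fin N → Table N}
    {cs : List (Fin N)} (hh : ∀ c ∈ cs, IsMessage T r sg cost L (B c) u c (h c))
    (hu : ∀ c ∈ cs, u ∉ B c) (hB : cs.Pairwise (Function.onFun Disjoint B)) :
    IsTable T r sg cost L ({u} ∪ cs.toFinset.biUnion B) u
      (attachAll L (baseTable L cost u).val h cs) := by
  cases cs with
  | nil => simpa [attachAll] using isTable_baseTable u
  | cons c cs =>
    obtain ⟨hhc, hh⟩ := List.forall_mem_cons.1 hh
    obtain ⟨huc, hu⟩ := List.forall_mem_cons.1 hu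
    obtain ⟨hBc, hB⟩ := List.pairwise_cons.1 hB
    rw [attachAll, List.toFinset_cons, Finset.biUnion_insert, ← Finset.union_assoc]
    exact (hhc.isTable_attachFirst huc).foldl_attachNext hh (fun d hd =>
      Finset.disjoint_union_left.2 ⟨Finset.disjoint_singleton_left.2 (hu d hd), hBc d hd⟩) hB

end Tables

section Solve

variable {n N : ℕ} {P : Setup n N} {L : ℕ} {est : Fin N → Fin n → ℤˣ} {cost : Fin N → ℤˣ → ℕ}
  {r u c d : Fin N}

open Classical in
/-- The subtree of components below `u`, when the tree is rooted at `r`. -/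
noncomputable def below (P : Setup n N) (r u : Fin N) : Finset (Fin N) :=
  Finset.univ.filter (Below P.tree r u)

open Classical in
/-- The component above `u`, if there is one. -/
noncomputable def above (P : Setup n N) (r u : Fin N) : Option (Fin N) :=
  if u = r then none else some (parent P.tree r u)

/-- The neighbours of `u` other than the component `a` above it, in the order in which the dynamic
program visits them. -/
def children (P : Setup n N) (a : Option (Fin N)) (u : Fin N) : List (Fin N) :=
  (P.tree.neighborFinset u).sort.filter fun c => a ≠ some c

theorem mem_below {x : Fin N} : x ∈ P.below r u ↔ Below P.tree r u x := by
  simp [below]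

theorem above_root (r : Fin N) : P.above r r = none := if_pos rfl

theorem above_of_ne (hc : c ≠ r) : P.above r c = some (parent P.tree r c) := if_neg hc

theorem nodup_children (a : Option (Fin N)) (u : Fin N) : (P.children a u).Nodup :=
  (Finset.sort_nodup _ _).filter _

theorem mem_children (hT : P.tree.IsTree) :
    c ∈ P.children (P.above r u) u ↔ c ≠ r ∧ parent P.tree r c = u := by
  simp only [children, List.mem_filter, Finset.mem_sort, SimpleGraph.mem_neighborFinset,
    decide_eq_true_eq]
  constructor
  · rintro ⟨hadj, hne⟩
    obtain ⟨hu, rfl⟩ | ⟨hc, rfl⟩ := (adj_iff_parent hT r).1 hadj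
    · exact absurd (above_of_ne hu) hne
    · exact ⟨hc, rfl⟩
  · rintro ⟨hc, rfl⟩
    refine ⟨(parent_adj hT hc).symm, fun habove => ?_⟩
    by_cases hr : parent P.tree r c = r
    · rw [hr, above_root] at habove
      exact absurd habove (by simp)
    · rw [above_of_ne hr, Option.some_inj] at habove
      have hdist := dist_parent_add_one hT hr
      have hdist' := dist_parent_add_one hT hc
      rw [habove] at hdist
      omega

theorem below_eq (hT : P.tree.IsTree) (r u : Fin N) :
    P.below r u = {u} ∪ (P.children (P.above r u) u).toFinset.biUnion (P.below r) := by
  ext x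
  rw [mem_below, below_iff hT]
  simp only [mem_below, Finset.mem_union, Finset.mem_singleton, Finset.mem_biUnion,
    List.mem_toFinset, mem_children hT, and_assoc]

theorem below_root_eq_univ (hT : P.tree.IsTree) (r : Fin N) : P.below r r = Finset.univ :=
  Finset.eq_univ_of_forall fun x => mem_below.2 (below_root hT r x)

theorem disjoint_below (hT : P.tree.IsTree) (hc : c ≠ r) (hd : d ≠ r)
    (h : parent P.tree r c = parent P.tree r d) (hcd : c ≠ d) :
    Disjoint (P.below r c) (P.below r d) :=
  Finset.disjoint_left.2 fun _ hx hx' =>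
    hcd (eq_of_parent_eq_of_below hT hc hd h (mem_below.1 hx) (mem_below.1 hx'))

theorem pairwise_disjoint_below_children (hT : P.tree.IsTree) (r u : Fin N) :
    (P.children (P.above r u) u).Pairwise (Function.onFun Disjoint (P.below r)) :=
  (nodup_children _ _).imp_of_mem fun hc hd hcd => by
    obtain ⟨hcr, hcu⟩ := (mem_children hT).1 hc
    obtain ⟨hdr, hdu⟩ := (mem_children hT).1 hd
    exact disjoint_below hT hcr hdr (hcu.trans hdu.symm) hcd

theorem dist_lt (hT : P.tree.IsTree) (r u : Fin N) : P.tree.dist r u < N := by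
  obtain ⟨p, hp, hlen⟩ := (hT.connected r u).exists_path_of_dist
  simpa [hlen] using hp.length_lt

/-- The part of `solveProg` that computes the message of the component `c` below `u`. -/
def messageProg (P : Setup n N) (L : ℕ) (est : Fin N → Fin n → ℤˣ) (cost : Fin N → ℤˣ → ℕ)
    (fuel : ℕ) (u c : Fin N) : Timed (Table N) := do
  let g ← P.solveProg L est cost fuel (some u) c
  let sg ← P.signProg est u c
  messageTable L sg g

/-- The part of `solveProg` that combines the base table of `u` with the messages of the
components `c` in a list. -/
def attachProg (P : Setup n N) (L : ℕ) (est : Fin N → Fin n → ℤˣ) (cost : Fin N → ℤˣ → ℕ)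
    (fuel : ℕ) (u : Fin N) (base : Table N) : List (Fin N) → Timed (Table N)
  | [] => pure base
  | c :: cs => do
    let h ← P.messageProg L est cost fuel u c
    let t ← attachFirst L base h
    forEach cs t fun t c => do
      let h ← P.messageProg L est cost fuel u c
      attachNext L t h

theorem solveProg_succ (fuel : ℕ) (a : Option (Fin N)) (u : Fin N) :
    P.solveProg L est cost (fuel + 1) a u = (do
      let base ← baseTable L cost u
      tick (P.tree.neighborFinset u).sort.length
      P.attachProg L est cost fuel u base (P.children a u)) := by
  rw [solveProg, children]
  congr! 4 with base
  generalize List.filter _ _ = cs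
  cases cs with
  | nil => rfl
  | cons c cs =>
    simp only [attachProg, messageProg, bind_assoc]

theorem attachProg_val (fuel : ℕ) (u : Fin N) (base : Table N) (cs : List (Fin N)) :
    (P.attachProg L est cost fuel u base cs).val =
      attachAll L base (fun c => (P.messageProg L est cost fuel u c).val) cs := by
  cases cs <;> simp [attachProg, attachAll, forEach_val]

theorem isTable_solveProg (hT : P.tree.IsTree) (L : ℕ) (est : Fin N → Fin n → ℤˣ)
    (cost : Fin N → ℤˣ → ℕ) (r : Fin N) (fuel : ℕ) (u : Fin N)
    (hfuel : N ≤ fuel + P.tree.dist r u) :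
    IsTable P.tree r (fun i j => (P.signProg est i j).val) cost L (P.below r u) u
      (P.solveProg L est cost fuel (P.above r u) u).val := by
  induction fuel generalizing u with
  | zero => exact absurd (dist_lt hT r u) (by omega)
  | succ fuel ih =>
    rw [solveProg_succ, below_eq hT]
    simp only [bind_val, attachProg_val]
    refine isTable_attachAll (fun c hc => ?_) (fun c hc => ?_)
      (pairwise_disjoint_below_children hT r u) <;>
    obtain ⟨hcr, rfl⟩ := (mem_children hT).1 hc
    · have hdist := dist_parent_add_one hT hcr
      have htable := ih c (by omega)
      rw [above_of_ne hcr] at htable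
      exact htable.isMessage rfl
    · exact fun hmem => not_below_parent hT hcr (mem_below.1 hmem)

theorem isOptimal_root (hT : P.tree.IsTree) (L : ℕ) (est : Fin N → Fin n → ℤˣ)
    (cost : Fin N → ℤˣ → ℕ) (r : Fin N) :
    IsOptimal cost Finset.univ
      (fun s => subViolations P.tree r (fun i j => (P.signProg est i j).val) Finset.univ r s ≤ L)
      (better ((P.solveProg L est cost N none r).val 1 L)
        ((P.solveProg L est cost N none r).val (-1) L)).val := by
  have htable := isTable_solveProg hT L est cost r N r (Nat.le_add_right _ _)
  rw [above_root, below_root_eq_univ hT] at htable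
  refine ((htable.isOptimal 1 L le_rfl).better (htable.isOptimal (-1) L le_rfl)).congr fun s => ?_
  rcases Int.units_eq_one_or (s r) with h | h <;> simp [h]

theorem subViolations_univ (hT : P.tree.IsTree) (r : Fin N) {link : Sym2 (Fin N) → Fin n}
    (hlink : ∀ i j, P.tree.Adj i j →
      (P.signProg est i j).val = est i (link s(i, j)) * est j (link s(i, j)))
    (s : Fin N → ℤˣ) :
    subViolations P.tree r (fun i j => (P.signProg est i j).val) Finset.univ r s =
      P.violations est link s := by
  rw [violations, card_filter_edgeFinset hT r, subViolations]
  congr 1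
  ext x
  simp only [Finset.mem_filter, Finset.mem_erase, Finset.mem_univ, and_true, true_and]
  refine and_congr_right fun hx => not_congr ?_
  set w := parent P.tree r x
  rw [hlink _ _ (parent_adj hT hx).symm, edgeProd_mk, edgeProd_mk, Sym2.eq_swap,
    mul_comm (est w _), ← mul_right_inj (s w), ← mul_assoc, Int.units_mul_self, one_mul,
    mul_comm (s w)]

theorem treeDecoder_val_mem_and_isMinOn (hT : P.tree.IsTree) (L : ℕ)
    {link : Sym2 (Fin N) → Fin n}
    (hlink : ∀ i j, P.tree.Adj i j →
      (P.signProg est i j).val = est i (link s(i, j)) * est j (link s(i, j)))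
    (cost : Fin N → ℤˣ → ℕ) (r : Fin N) :
    (P.treeDecoder L r est cost).val ∈ {s | P.violations est link s ≤ L} ∧
      IsMinOn (fun s : Fin N → ℤˣ => ∑ i, cost i (s i)) {s | P.violations est link s ≤ L}
        (P.treeDecoder L r est cost).val := by
  have hopt := (isOptimal_root hT L est cost r).congr fun s => by
    rw [subViolations_univ hT r hlink s]
  obtain ⟨s, hs, hsum, hstore⟩ := hopt.exists_stores
  have hval : (P.treeDecoder L r est cost).val = s := by
    simp only [treeDecoder, bind_val, fetch_val]
    rw [hstore.val_eq]
    simp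
  rw [hval]
  exact ⟨hs, fun s' hs' => hsum.trans_le (hopt.le s' hs')⟩

end Solve

end Setup

namespace Setup

variable {n N : ℕ} {P : Setup n N}

namespace IsAdmissible

theorem exists_link (hP : P.IsAdmissible) (hc : P.probed.Connected) :
    ∃ link : Sym2 (Fin N) → Fin n, ∀ i j, P.tree.Adj i j → link s(i, j) ∈ P.bag i ∩ P.bag j ∧
      ∀ est, (P.signProg est i j).val = est i (link s(i, j)) * est j (link s(i, j)) := by
  classical
  obtain ⟨v₀⟩ := hc.nonempty
  let common (e : Sym2 (Fin N)) : Finset (Fin n) := Finset.univ.filter fun v => ∀ i ∈ e, v ∈ P.bag i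
  have hcommon (i j : Fin N) : common s(i, j) = P.bag i ∩ P.bag j := by
    ext v
    simp [common]
  refine ⟨fun e => if h : (common e).Nonempty then (common e).min' h else v₀, fun i j hij => ?_⟩
  have hne : (P.bag i ∩ P.bag j).Nonempty := by
    obtain ⟨v, hi, hj⟩ := hP.isTreeDecomposition.exists_mem_bag_inter_of_adj hc hij
    exact ⟨v, Finset.mem_inter.2 ⟨hi, hj⟩⟩
  simp only [hcommon, dif_pos hne]
  exact ⟨Finset.min'_mem _ hne, fun est => signProg_val est hne⟩

theorem isOutput_decoder (hP : P.IsAdmissible) (hc : P.probed.Connected) {p δ : ℝ} (hp : 0 ≤ p)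
    (hδ : 0 < δ) (hδ2 : δ ≤ 2) (root : Fin N) (X : EdgeObs P) (Z : VertexObs n) :
    P.IsOutput p δ X Z (P.treeDecompositionDecoder p δ root X Z).val := by
  obtain ⟨link, hlink⟩ := hP.exists_link hc
  have hbudget : 0 ≤ P.treeBudget p δ :=
    mul_nonneg (Nat.cast_nonneg _) (errBudget_nonneg hp hδ hδ2)
  let est (i : Fin N) : Fin n → ℤˣ := (P.estimatorProg X (P.ext i).sort).val
  obtain ⟨hmem, hmin⟩ := treeDecoder_val_mem_and_isMinOn hP.isTreeDecomposition.isTree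
    ⌊P.treeBudget p δ⌋₊ (fun i j hij => (hlink i j hij).2 est) (P.bagCost Z est) root
  refine ⟨est, link, (P.treeDecoder ⌊P.treeBudget p δ⌋₊ root est (P.bagCost Z est)).val,
    (P.homeProg root).val, estimatorProg_val_le hP.probed_le X, fun i j hij => (hlink i j hij).1,
    (Nat.le_floor_iff hbudget).1 hmem, fun s hs => hmin ((Nat.le_floor_iff hbudget).2 hs),
    homeProg_val_mem hP.isTreeDecomposition.vertex_inclusion root, fun v => ?_⟩
  have hcost : (fillFin fun i => fillSign fun s => P.costProg Z est i s).val = P.bagCost Z est := by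
    funext i s
    rw [fillFin_val, fillSign_val, costProg_val]
  simp only [treeDecompositionDecoder, decoder, bind_val, fillFin_val, fetch_val, pure_val,
    readLabel, ← hcost]
  rfl

end IsAdmissible

end Setup

/-! ## Running times -/

namespace Timed

variable {α β : Type}

theorem forEach_time_le (l : List α) (b : β) (f : β → α → Timed β) (g : α → ℕ)
    (h : ∀ b, ∀ a ∈ l, (f b a).time ≤ g a) :
    (forEach l b f).time ≤ (l.map fun a => g a + 1).sum := by
  induction l generalizing b with
  | nil => rfl
  | cons a l ih =>
    simp only [forEach, bind_time, tick_time, List.map_cons, List.sum_cons]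
    have hhead := h b a List.mem_cons_self
    have htail := ih (f b a).val fun b a ha => h b a (List.mem_cons_of_mem _ ha)
    omega

theorem forEach_time_le_mul (l : List α) (b : β) (f : β → α → Timed β) (k : ℕ)
    (h : ∀ b, ∀ a ∈ l, (f b a).time ≤ k) : (forEach l b f).time ≤ l.length * (k + 1) := by
  simpa using forEach_time_le l b f (fun _ => k) h

theorem fillUpTo_time_le (L : ℕ) (f : ℕ → Timed α) (c : ℕ) (h : ∀ k ≤ L, (f k).time ≤ c) :
    (fillUpTo L f).time ≤ (L + 1) * (c + 1) := by
  simpa [fillUpTo] using Finset.sum_le_card_nsmul (Finset.range (L + 1))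
    (fun k => (f k).time + 1) (c + 1)
    fun k hk => Nat.add_le_add_right (h k (Finset.mem_range_succ_iff.1 hk)) 1

theorem fillFin_time_le {m : ℕ} (f : Fin m → Timed α) (c : ℕ) (h : ∀ i, (f i).time ≤ c) :
    (fillFin f).time ≤ m * (c + 1) := by
  simpa [fillFin] using Finset.sum_le_card_nsmul Finset.univ (fun i => (f i).time + 1) (c + 1)
    fun i _ => Nat.add_le_add_right (h i) 1

theorem fillSign_time_le (f : ℤˣ → Timed α) (c : ℕ) (h : ∀ s, (f s).time ≤ c) :
    (fillSign f).time ≤ 2 + 2 * c := by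
  have hpos := h 1
  have hneg := h (-1)
  simp only [fillSign, bind_time, tick_time, pure_time]
  omega

end Timed

namespace Setup

section Components

variable {n N : ℕ} (P : Setup n N)

theorem length_labelings (l : List (Fin n)) : (labelings l).length = 2 ^ l.length := by
  induction l with
  | nil => rfl
  | cons a l ih => simp [labelings, ih, pow_succ]

/-- A bound for the time of the comparison of one labeling of `m` vertices with the
measurements. -/
def energyTime (m : ℕ) : ℕ := m * (m * (2 * m + 9) + 1)

/-- A bound for the time of the brute-force search on `m` vertices. -/
def searchTime (m : ℕ) : ℕ :=
  2 ^ (m + 1) * (m + 1) + energyTime m + 2 ^ m * (energyTime m + 2)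

/-- A bound for the time of one entry of the cost table of the second stage. -/
def costTime (P : Setup n N) : ℕ := (P.wid + 1) * (P.widStar + 7)

/-- A bound for the time of the computation of one sign `S(W₁, W₂)`. -/
def signTime (P : Setup n N) : ℕ := (P.wid + 1) * (P.wid + 4) + 2 * P.widStar + 5

theorem monotone_searchTime : Monotone searchTime := fun a b h => by
  simp only [searchTime, energyTime]
  gcongr <;> norm_num

theorem energyProg_time_le (X : EdgeObs P) (l : List (Fin n)) (y : Fin n → ℤˣ) :
    (P.energyProg X l y).time ≤ energyTime l.length := by
  refine forEach_time_le_mul _ _ _ _ fun acc u _ => forEach_time_le_mul _ _ _ (2 * l.length + 8)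
    fun acc v _ => ?_
  split_ifs
  · simp only [bind_time, tick_time, readEdge, readLabel, pure_time]
    omega
  · simp only [bind_time, tick_time, pure_time]
    omega

theorem estimatorProg_time_le (X : EdgeObs P) (l : List (Fin n)) :
    (P.estimatorProg X l).time ≤ searchTime l.length := by
  simp only [estimatorProg, bind_time, tick_time, pure_time, searchTime, add_zero]
  rw [← add_assoc]
  refine add_le_add (Nat.add_le_add_left (P.energyProg_time_le X l _) _) ?_
  rw [← length_labelings]
  refine forEach_time_le_mul _ _ _ (energyTime l.length + 1) fun _ y _ => ?_
  exact Nat.add_le_add_right (P.energyProg_time_le X l y) 1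

theorem costProg_time_le (Z : VertexObs n) (est : Fin N → Fin n → ℤˣ) (i : Fin N) (s : ℤˣ) :
    (P.costProg Z est i s).time ≤ P.costTime := by
  refine (forEach_time_le_mul _ _ _ (P.widStar + 6) fun acc v _ => ?_).trans ?_
  · have := P.card_ext_le i
    simp only [bind_time, tick_time, pure_time, readLabel, fetch_time]
    omega
  · rw [Finset.length_sort]
    exact Nat.mul_le_mul_right _ (P.card_bag_le i)

theorem signProg_time_le (est : Fin N → Fin n → ℤˣ) (i j : Fin N) :
    (P.signProg est i j).time ≤ P.signTime := by
  have hlink : (P.linkProg i j).time ≤ (P.wid + 1) * (P.wid + 4) := by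
    refine (forEach_time_le_mul _ _ _ (P.wid + 3) fun _ _ _ => ?_).trans ?_
    · exact Nat.add_le_add_right (P.card_bag_le j) 2
    · rw [Finset.length_sort]
      exact Nat.mul_le_mul_right _ (P.card_bag_le i)
  have hi := P.card_ext_le i
  have hj := P.card_ext_le j
  simp only [signProg, signTime, bind_time]
  cases (P.linkProg i j).val <;>
  · simp only [bind_time, readLabel, tick_time, pure_time]
    omega

theorem homeProg_time_le (root : Fin N) :
    (P.homeProg root).time ≤ n * 1 + N * (2 * P.wid + 3) := by
  simp only [homeProg, bind_time]
  refine add_le_add (fillFin_time_le _ 0 fun _ => le_rfl) ?_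
  refine (forEach_time_le_mul _ _ _ (2 * P.wid + 2) fun h i _ => ?_).trans ?_
  · refine (forEach_time_le_mul _ _ _ 1 fun h v _ => le_rfl).trans ?_
    have := P.card_bag_le i
    rw [Finset.length_sort]
    omega
  · rw [List.length_finRange]

end Components

section DynamicProgram

variable {n N : ℕ} {P : Setup n N} {est : Fin N → Fin n → ℤˣ} {cost : Fin N → ℤˣ → ℕ}

theorem baseTable_time_le (L : ℕ) (cost : Fin N → ℤˣ → ℕ) (u : Fin N) :
    (baseTable L cost u).time ≤ 8 * (L + 1) := by
  refine (fillSign_time_le _ _ fun s => fillUpTo_time_le L _ 2 fun k _ => le_rfl).trans ?_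
  omega

theorem messageTable_time_le (L : ℕ) (sg : ℤˣ) (g : Table N) :
    (messageTable L sg g).time ≤ 14 * (L + 1) := by
  refine (fillSign_time_le _ _ fun s => fillUpTo_time_le L _ 5 fun k _ => ?_).trans (by omega)
  split_ifs <;> simp only [better, bind_time, tick_time, fetch_time, pure_time] <;> norm_num

theorem attachFirst_time_le (L : ℕ) (base h : Table N) :
    (attachFirst L base h).time ≤ 12 * (L + 1) := by
  refine (fillSign_time_le _ _ fun s => fillUpTo_time_le L _ 4 fun k _ => le_rfl).trans ?_
  omega

theorem attachNext_time_lt (L : ℕ) (g h : Table N) :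
    (attachNext L g h).time < 18 * (L + 1) ^ 2 := by
  refine (fillSign_time_le _ _ fun s =>
    fillUpTo_time_le L _ (4 + L * 8) fun k hk => ?_).trans_lt (by nlinarith)
  have hloop (c : ℕ × Labels N) : (forEach (List.range k) c fun c j => do
      tick 2
      let a ← fetch (g s) (k - (j + 1))
      let b ← fetch (h s) (j + 1)
      let c' ← addCells a b
      better c c').time ≤ L * 8 := by
    refine (forEach_time_le_mul _ _ _ 7 fun c j _ => le_rfl).trans ?_
    rw [List.length_range]
    omega
  simp only [bind_time, fetch_time]
  have := hloop (addCells (fetch (g s) k).val (fetch (h s) 0).val).val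
  have hadd (a b : ℕ × Labels N) : (addCells a b).time = 2 := rfl
  rw [hadd]
  omega

theorem attachProg_time_le {L fuel : ℕ} {u : Fin N} {m : Fin N → ℕ} {cs : List (Fin N)}
    (hm : ∀ c ∈ cs, (P.messageProg L est cost fuel u c).time ≤ m c) (base : Table N) :
    (P.attachProg L est cost fuel u base cs).time ≤
      12 * (L + 1) + (cs.map m).sum + (cs.length - 1) * (18 * (L + 1) ^ 2) := by
  cases cs with
  | nil => exact Nat.zero_le _
  | cons c cs =>
    obtain ⟨hmc, hm⟩ := List.forall_mem_cons.1 hm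
    have hfirst := attachFirst_time_le L base (P.messageProg L est cost fuel u c).val
    have hnext (t : Table N) : (forEach cs t fun t c => do
        let h ← P.messageProg L est cost fuel u c
        attachNext L t h).time ≤ (cs.map m).sum + cs.length * (18 * (L + 1) ^ 2) := by
      refine (forEach_time_le _ _ _ (fun c => m c + (18 * (L + 1) ^ 2 - 1)) fun t c hc => ?_).trans
        (le_of_eq ?_)
      · exact add_le_add (hm c hc) (Nat.le_pred_of_lt (attachNext_time_lt L t _))
      · have hpos : 0 < 18 * (L + 1) ^ 2 := by positivity
        simp only [add_assoc, Nat.sub_add_cancel hpos, List.sum_map_add, List.map_const',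
          List.sum_replicate, smul_eq_mul]
    simp only [attachProg, bind_time, List.map_cons, List.sum_cons, List.length_cons,
      Nat.add_sub_cancel]
    have := hnext (attachFirst L base (P.messageProg L est cost fuel u c).val).val
    omega

/-- A bound for the time that `solveProg` spends at the component `x`, including the message from
`x` to its parent but not the messages to `x`. -/
noncomputable def nodeTime (P : Setup n N) (L : ℕ) (r x : Fin N) : ℕ :=
  P.treeDeg + P.signTime + 34 * (L + 1) +
    ((P.children (P.above r x) x).length - 1) * (18 * (L + 1) ^ 2)

theorem sum_below (hT : P.tree.IsTree) (r u : Fin N) (f : Fin N → ℕ) :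
    ∑ x ∈ P.below r u, f x =
      f u + ((P.children (P.above r u) u).map fun c => ∑ x ∈ P.below r c, f x).sum := by
  rw [below_eq hT, Finset.sum_union, Finset.sum_singleton, Finset.sum_biUnion,
    List.sum_toFinset _ (nodup_children _ _)]
  · intro c hc d hd hcd
    obtain ⟨hcr, hcu⟩ := (mem_children hT).1 (List.mem_toFinset.1 hc)
    obtain ⟨hdr, hdu⟩ := (mem_children hT).1 (List.mem_toFinset.1 hd)
    exact disjoint_below hT hcr hdr (hcu.trans hdu.symm) hcd
  · rw [Finset.disjoint_singleton_left, Finset.mem_biUnion]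
    rintro ⟨c, hc, hu⟩
    obtain ⟨hcr, rfl⟩ := (mem_children hT).1 (List.mem_toFinset.1 hc)
    exact not_below_parent hT hcr (mem_below.1 hu)

theorem solveProg_time_le (hT : P.tree.IsTree) (L : ℕ) (est : Fin N → Fin n → ℤˣ)
    (cost : Fin N → ℤˣ → ℕ) (r : Fin N) (fuel : ℕ) (u : Fin N)
    (hfuel : N ≤ fuel + P.tree.dist r u) :
    (P.solveProg L est cost fuel (P.above r u) u).time + P.signTime + 14 * (L + 1) ≤
      ∑ x ∈ P.below r u, P.nodeTime L r x := by
  induction fuel generalizing u with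
  | zero => exact absurd (dist_lt hT r u) (by omega)
  | succ fuel ih =>
    have hmessage : ∀ c ∈ P.children (P.above r u) u,
        (P.messageProg L est cost fuel u c).time ≤ ∑ x ∈ P.below r c, P.nodeTime L r x := by
      intro c hc
      obtain ⟨hcr, rfl⟩ := (mem_children hT).1 hc
      have hdist := dist_parent_add_one hT hcr
      have hsolve := ih c (by omega)
      rw [above_of_ne hcr] at hsolve
      have hsign := P.signProg_time_le est (parent P.tree r c) c
      have htable := messageTable_time_le L (P.signProg est (parent P.tree r c) c).val
        (P.solveProg L est cost fuel (some (parent P.tree r c)) c).val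
      simp only [messageProg, bind_time]
      omega
    have hdeg : (P.tree.neighborFinset u).sort.length ≤ P.treeDeg := by
      rw [Finset.length_sort, SimpleGraph.card_neighborFinset_eq_degree]
      exact P.tree.degree_le_maxDegree u
    have hbase := baseTable_time_le L cost u
    have hattach := attachProg_time_le hmessage (baseTable L cost u).val
    rw [sum_below hT, solveProg_succ, nodeTime]
    simp only [bind_time, tick_time]
    omega

/-- The number of calls of `attachNext` in the dynamic program with the root `r`: a component with
`k > 0` children contributes `k - 1`. -/
noncomputable def branching (P : Setup n N) (r : Fin N) : ℕ :=
  ∑ x, ((P.children (P.above r x) x).length - 1)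

theorem treeDecoder_time_le (hT : P.tree.IsTree) (L : ℕ) (est : Fin N → Fin n → ℤˣ)
    (cost : Fin N → ℤˣ → ℕ) (r : Fin N) :
    (P.treeDecoder L r est cost).time ≤
      N * (P.treeDeg + P.signTime + 34 * (L + 1) + 3) + P.branching r * (18 * (L + 1) ^ 2) := by
  have hsum : ∑ x, P.nodeTime L r x = N * (P.treeDeg + P.signTime + 34 * (L + 1)) +
      P.branching r * (18 * (L + 1) ^ 2) := by
    simp only [nodeTime, branching, Finset.sum_add_distrib, Finset.sum_const, Finset.card_univ,
      Fintype.card_fin, smul_eq_mul, Finset.sum_mul, mul_add]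
  have hsolve := solveProg_time_le hT L est cost r N r (Nat.le_add_right _ _)
  rw [above_root, below_root_eq_univ hT, hsum] at hsolve
  obtain ⟨s, -, -, hstore⟩ := (isOptimal_root hT L est cost r).exists_stores
  have hinit : (fillFin fun _ : Fin N => (pure 1 : Timed ℤˣ)).time = N := by simp [fillFin]
  have hwrite := hstore.time_add_one (fillFin fun _ : Fin N => (pure 1 : Timed ℤˣ)).val
  rw [Finset.card_univ, Fintype.card_fin] at hwrite
  have hbetter (a b : ℕ × Labels N) : (better a b).time = 1 := rfl
  simp only [treeDecoder, bind_time, fetch_time, fetch_val, hinit, hbetter]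
  rw [mul_add N _ 3]
  omega

/-- A bound for the number of steps per component of the tree and unit of the budget, without the
calls of `attachNext`. -/
def componentTime (P : Setup n N) : ℕ :=
  searchTime (P.widStar + 1) + 2 * P.costTime + P.signTime + P.treeDeg + 2 * P.wid + P.widStar + 51

theorem decoder_time_le (hT : P.tree.IsTree) (hN : N ≤ n) (L : ℕ) (r : Fin N) (X : EdgeObs P)
    (Z : VertexObs n) :
    (P.decoder L r X Z).time ≤
      n * P.componentTime * (L + 1) + P.branching r * (18 * (L + 1) ^ 2) := by
  have hest : (fillFin fun i => P.estimatorProg X (P.ext i).sort).time ≤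
      N * (searchTime (P.widStar + 1) + 1) :=
    fillFin_time_le _ _ fun i => (P.estimatorProg_time_le X _).trans <|
      monotone_searchTime <| (Finset.length_sort _).trans_le (P.card_ext_le i)
  have hcost (est : Fin N → Fin n → ℤˣ) :
      (fillFin fun i => fillSign fun s => P.costProg Z est i s).time ≤
        N * (2 + 2 * P.costTime + 1) :=
    fillFin_time_le _ _ fun i => fillSign_time_le _ _ fun s => P.costProg_time_le Z est i s
  have hout (est : Fin N → Fin n → ℤˣ) (s : Fin N → ℤˣ) (home : Fin n → Fin N) :
      (fillFin fun v => do
        let i ← fetch home v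
        let a ← fetch s i
        let y ← readLabel (P.ext i).card (est i) v
        tick 1
        pure (a * y) : Timed (Fin n → ℤˣ)).time ≤ n * (P.widStar + 5 + 1) := by
    refine fillFin_time_le _ _ fun v => ?_
    have := P.card_ext_le (home v)
    simp only [bind_time, fetch_time, fetch_val, readLabel, tick_time, pure_time]
    omega
  simp only [decoder, bind_time]
  grw [hest, hcost, treeDecoder_time_le hT, homeProg_time_le, hout, hN]
  set b := P.branching r * (18 * (L + 1) ^ 2)
  rw [componentTime]
  set a := searchTime (P.widStar + 1) + 2 * P.costTime + P.signTime + P.treeDeg + 2 * P.wid +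
    P.widStar with ha
  calc _ = n * (a + 51 + 34 * L) + b := by
        rw [ha]
        ring
    _ ≤ n * ((a + 51) * (L + 1)) + b := by
        gcongr
        nlinarith [Nat.zero_le (a * L)]
    _ = _ := by rw [← mul_assoc]

theorem length_children_le_degree (a : Option (Fin N)) (x : Fin N) :
    (P.children a x).length ≤ P.tree.degree x :=
  (List.length_filter_le _ _).trans (Finset.length_sort _).le

theorem length_children_add_one (hT : P.tree.IsTree) {r x : Fin N} (hx : x ≠ r) :
    (P.children (P.above r x) x).length + 1 = P.tree.degree x := by
  have hmem : parent P.tree r x ∈ (P.tree.neighborFinset x).sort :=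
    (Finset.mem_sort _).2 ((P.tree.mem_neighborFinset x _).2 (parent_adj hT hx))
  have herase : P.children (P.above r x) x =
      (P.tree.neighborFinset x).sort.erase (parent P.tree r x) := by
    rw [(Finset.sort_nodup _ _).erase_eq_filter, children, above_of_ne hx]
    exact List.filter_congr fun c _ => by simp [eq_comm, bne, beq_eq_decide]
  rw [herase, List.length_erase_add_one hmem, Finset.length_sort,
    SimpleGraph.card_neighborFinset_eq_degree]

theorem branching_le (r : Fin N) : P.branching r ≤ N * P.treeDeg := by
  refine (Finset.sum_le_card_nsmul _ _ P.treeDeg fun x _ => ?_).trans (by simp)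
  exact (Nat.sub_le _ _).trans
    ((length_children_le_degree _ x).trans (P.tree.degree_le_maxDegree x))

theorem degree_le_two_of_path (φ : P.tree ≃g SimpleGraph.pathGraph N) (x : Fin N) :
    P.tree.degree x ≤ 2 := by
  refine (Finset.card_le_card_of_injOn (t := {(φ x : ℕ) - 1, (φ x : ℕ) + 1})
    (fun y => (φ y : ℕ)) (fun y hy => ?_) fun y _ z _ h => φ.injective (Fin.ext h)).trans
    Finset.card_le_two
  have hadj := φ.map_adj_iff.2 ((P.tree.mem_neighborFinset x y).1 hy)
  rw [SimpleGraph.pathGraph_adj] at hadj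
  rw [Finset.mem_coe, Finset.mem_insert, Finset.mem_singleton]
  change (φ y : ℕ) = _ ∨ (φ y : ℕ) = _
  omega

theorem branching_le_one_of_path (hT : P.tree.IsTree) (φ : P.tree ≃g SimpleGraph.pathGraph N)
    (r : Fin N) : P.branching r ≤ 1 := by
  calc P.branching r ≤ ∑ x, if x = r then 1 else 0 := Finset.sum_le_sum fun x _ => by
        have hdeg := degree_le_two_of_path φ x
        split_ifs with hx
        · have := length_children_le_degree (P := P) (P.above r x) x
          omega
        · have := length_children_add_one hT hx
          omega
    _ = 1 := by simp

end DynamicProgram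

end Setup

/-! ## Running times for bounded parameters -/

theorem one_le_ceil_rpow_mul {n : ℕ} (hn : 0 < n) {p : ℝ} (hp : 0 < p) (a : ℝ) :
    (1 : ℝ) ≤ ⌈p ^ a * n⌉₊ := by
  have : 0 < ⌈p ^ a * n⌉₊ := Nat.ceil_pos.2 (by positivity)
  exact_mod_cast this

namespace Setup

/-- A constant for which the number of budgets `L_n + 1` is at most
`budgetConst D * (⌈p ^ (Δ / 2) * n⌉ * log n)` when all parameters are at most `D`. -/
def budgetConst (D : ℕ) : ℝ := 48 * D * (4 ^ D + D ^ 2) + 2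

/-- The bound for `Setup.componentTime` when all parameters are at most `D`. -/
def componentConst (D : ℕ) : ℕ :=
  searchTime (D + 1) + 2 * ((D + 1) * (D + 7)) + ((D + 1) * (D + 4) + 2 * D + 5) + D + 2 * D +
    D + 51

/-- The constant in the bounds for the running time when all parameters are at most `D`. -/
def timeConst (D : ℕ) : ℝ :=
  2 * componentConst D * budgetConst D + 18 * (D + 1) * budgetConst D ^ 2

theorem budgetConst_pos (D : ℕ) : 0 < budgetConst D := by
  rw [budgetConst]
  positivity

theorem errorConst_nonneg (D : ℕ) : 0 ≤ errorConst D := by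
  rw [errorConst]
  positivity

theorem timeConst_nonneg (D : ℕ) : 0 ≤ timeConst D := by
  have := budgetConst_pos D
  rw [timeConst]
  positivity

variable {n N : ℕ} {P : Setup n N}

theorem IsAdmissible.cutSum_le_ceil (hP : P.IsAdmissible) (hn : 0 < n) {p : ℝ} (hp : 0 < p)
    (hp1 : p ≤ 1) {Δ : ℕ} (hΔ : ∀ i, Δ ≤ P.mincutStar i) :
    P.cutSum p ≤ ⌈p ^ ((Δ : ℝ) / 2) * n⌉₊ := by
  refine (hP.cutSum_le hn ⟨hp.le, hp1⟩ hΔ).trans (le_trans ?_ (Nat.le_ceil _))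
  gcongr
  rw [← Real.rpow_natCast]
  refine Real.rpow_le_rpow_of_exponent_ge hp hp1 ?_
  have : (Δ : ℝ) ≤ 2 * ((Δ + 1) / 2 : ℕ) := by
    exact_mod_cast (by omega : Δ ≤ 2 * ((Δ + 1) / 2))
  linarith

namespace BoundedBy

variable {D : ℕ}

theorem treeBudget_le (hD : P.BoundedBy D) (hn : 2 ≤ n) {p : ℝ} (hp : 0 ≤ p) :
    P.treeBudget p (1 / n) ≤ 16 * D * (4 ^ D + D ^ 2) * (P.cutSum p + Real.log n) := by
  have hδ : (1 : ℝ) / n ≤ 1 / 2 := one_div_le_one_div_of_le two_pos (by exact_mod_cast hn)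
  have hbudget := P.errBudget_nonneg hp (by positivity : (0 : ℝ) < 1 / n) (by linarith)
  have hdeg := hD.treeDeg_le
  calc P.treeBudget p (1 / n) = P.treeDeg * P.errBudget p (1 / n) := rfl
    _ ≤ D * (16 * ((4 ^ D + D ^ 2) * (P.cutSum p + Real.log n))) := by
        gcongr
        exact (P.errBudget_le_errScale (by positivity) hδ).trans (by grw [hD.errScale_le hp])
    _ = _ := by ring

theorem floor_treeBudget_add_one_le (hD : P.BoundedBy D) (hP : P.IsAdmissible)
    (hn : 2 ≤ n) {p : ℝ} (hp : 0 < p) (hp1 : p ≤ 1) {Δ : ℕ} (hΔ : ∀ i, Δ ≤ P.mincutStar i) :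
    (⌊P.treeBudget p (1 / n)⌋₊ : ℝ) + 1 ≤
      budgetConst D * (⌈p ^ ((Δ : ℝ) / 2) * n⌉₊ * Real.log n) := by
  have hδ : (1 : ℝ) / n ≤ 1 := by
    rw [div_le_one (by positivity)]
    exact_mod_cast (by omega : 1 ≤ n)
  have hbudget : 0 ≤ P.treeBudget p (1 / n) :=
    mul_nonneg (Nat.cast_nonneg _) (P.errBudget_nonneg hp.le (by positivity) (by linarith))
  have hlog := half_le_log hn
  have hcut := hP.cutSum_le_ceil (by omega) hp hp1 hΔ
  have hx := one_le_ceil_rpow_mul (by omega : 0 < n) hp ((Δ : ℝ) / 2)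
  set x : ℝ := (⌈p ^ ((Δ : ℝ) / 2) * n⌉₊ : ℝ)
  calc (⌊P.treeBudget p (1 / n)⌋₊ : ℝ) + 1
      ≤ 16 * D * (4 ^ D + D ^ 2) * (x + Real.log n) + 1 := by
        grw [Nat.floor_le hbudget, hD.treeBudget_le hn hp.le, hcut]
    _ ≤ 16 * D * (4 ^ D + D ^ 2) * (3 * (x * Real.log n)) + 2 * (x * Real.log n) := by
        gcongr <;> nlinarith
    _ = budgetConst D * (x * Real.log n) := by
        rw [budgetConst]
        ring

theorem componentTime_le (hD : P.BoundedBy D) (hP : P.IsAdmissible) :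
    P.componentTime ≤ componentConst D := by
  have hdeg := hD.treeDeg_le
  have hstar := hD.widStar_le
  have hwid := hP.wid_le_widStar.trans hstar
  have hsearch := monotone_searchTime (Nat.succ_le_succ hstar)
  rw [componentTime, costTime, signTime, componentConst]
  gcongr

/-- With `x = ⌈p ^ (Δ / 2) * n⌉`, the budget `L_n` is of order `x log n`, and merging subtrees costs
`P.branching r * L_n ^ 2`; a general tree needs `b = x * n`, whereas a path allows `b = n`. -/
theorem time_le_of_branching_le (hD : P.BoundedBy D) (hP : P.IsAdmissible) (hn : 2 ≤ n) {p : ℝ}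
    (hp : 0 < p) (hp1 : p ≤ 1) {Δ : ℕ} (hΔ : ∀ i, Δ ≤ P.mincutStar i) (r : Fin N)
    (X : EdgeObs P) (Z : VertexObs n) {b : ℝ}
    (hb : (P.branching r : ℝ) * ⌈p ^ ((Δ : ℝ) / 2) * n⌉₊ ≤ (D + 1) * b)
    (hb1 : (n : ℝ) ≤ b) {C : ℝ} (hC : timeConst D ≤ C) :
    ((P.treeDecompositionDecoder p (1 / n) r X Z).time : ℝ) ≤
      C * Real.log n ^ 2 * ⌈p ^ ((Δ : ℝ) / 2) * n⌉₊ * b := by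
  have hlog := half_le_log hn
  have hcomp := hD.componentTime_le hP
  have hconst := budgetConst_pos D
  have hbudget := hD.floor_treeBudget_add_one_le hP hn hp hp1 hΔ
  set x : ℝ := (⌈p ^ ((Δ : ℝ) / 2) * n⌉₊ : ℝ)
  set L : ℕ := ⌊P.treeBudget p (1 / n)⌋₊
  have hb0 : 0 ≤ b := (Nat.cast_nonneg n).trans hb1
  have hlog2 : Real.log n ≤ 2 * Real.log n ^ 2 := by nlinarith
  calc ((P.treeDecompositionDecoder p (1 / n) r X Z).time : ℝ)
      ≤ n * P.componentTime * (L + 1) + P.branching r * (18 * (L + 1) ^ 2) := by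
        exact_mod_cast decoder_time_le hP.isTreeDecomposition.isTree (hP.card_le (by omega)) L r X Z
    _ ≤ b * componentConst D * (budgetConst D * (x * (2 * Real.log n ^ 2))) +
          P.branching r * (18 * (budgetConst D * (x * Real.log n)) ^ 2) := by
        gcongr
        exact hbudget.trans (by gcongr)
    _ = 2 * componentConst D * budgetConst D * (Real.log n ^ 2 * x * b) +
          18 * budgetConst D ^ 2 * Real.log n ^ 2 * x * (P.branching r * x) := by ring
    _ ≤ 2 * componentConst D * budgetConst D * (Real.log n ^ 2 * x * b) +
          18 * budgetConst D ^ 2 * Real.log n ^ 2 * x * ((D + 1) * b) := by gcongr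
    _ = timeConst D * Real.log n ^ 2 * x * b := by
        rw [timeConst]
        ring
    _ ≤ C * Real.log n ^ 2 * x * b := by gcongr

theorem time_le (hD : P.BoundedBy D) (hP : P.IsAdmissible) (hn : 2 ≤ n) {p : ℝ} (hp : 0 < p)
    (hp1 : p ≤ 1) {Δ : ℕ} (hΔ : ∀ i, Δ ≤ P.mincutStar i) (r : Fin N) (X : EdgeObs P)
    (Z : VertexObs n) {C : ℝ} (hC : timeConst D ≤ C) :
    ((P.treeDecompositionDecoder p (1 / n) r X Z).time : ℝ) ≤
      C * Real.log n ^ 2 * (⌈p ^ ((Δ : ℝ) / 2) * n⌉₊ : ℝ) ^ 2 * n := by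
  have hx := one_le_ceil_rpow_mul (by omega : 0 < n) hp ((Δ : ℝ) / 2)
  have hbranch : (P.branching r : ℝ) ≤ n * D := by
    exact_mod_cast (P.branching_le r).trans
      (Nat.mul_le_mul (hP.card_le (by omega)) hD.treeDeg_le)
  refine (hD.time_le_of_branching_le hP hn hp hp1 hΔ r X Z
    (b := ⌈p ^ ((Δ : ℝ) / 2) * n⌉₊ * n) ?_ (le_mul_of_one_le_left (by positivity) hx) hC).trans_eq
    (by ring)
  grw [hbranch]
  nlinarith [mul_nonneg (Nat.cast_nonneg (α := ℝ) n) (zero_le_one.trans hx)]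

theorem time_le_of_path (hD : P.BoundedBy D) (hP : P.IsAdmissible) (hn : 2 ≤ n) {p : ℝ}
    (hp : 0 < p) (hp1 : p ≤ 1) {Δ : ℕ} (hΔ : ∀ i, Δ ≤ P.mincutStar i)
    (φ : P.tree ≃g SimpleGraph.pathGraph N) (r : Fin N) (X : EdgeObs P) (Z : VertexObs n)
    {C : ℝ} (hC : timeConst D ≤ C) :
    ((P.treeDecompositionDecoder p (1 / n) r X Z).time : ℝ) ≤
      C * Real.log n ^ 2 * (⌈p ^ ((Δ : ℝ) / 2) * n⌉₊ : ℝ) * n := by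
  refine hD.time_le_of_branching_le hP hn hp hp1 hΔ r X Z ?_ le_rfl hC
  have hbranch : (P.branching r : ℝ) ≤ 1 := by
    exact_mod_cast branching_le_one_of_path hP.isTreeDecomposition.isTree φ r
  have hceil : (⌈p ^ ((Δ : ℝ) / 2) * n⌉₊ : ℝ) ≤ n := by
    exact_mod_cast Nat.ceil_le.2 <|
      mul_le_of_le_one_left (by positivity) (Real.rpow_le_one hp.le hp1 (by positivity))
  gcongr
  linarith [Nat.cast_nonneg (α := ℝ) D]

end BoundedBy

end Setup

end TreeDecoding

theorem mainTheorem1_general :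
    (∃ C : ℝ, 0 < C ∧
      ∀ (n N : ℕ) (P : TreeDecoding.Setup n N), P.IsAdmissible → P.probed.Connected → 2 ≤ n →
      ∀ (Y : Fin n → ℤˣ) (p q δ : ℝ), 0 < p → p ≤ 1 → 0 ≤ q → q < 1 / 2 → 0 < δ → δ ≤ 1 / 2 →
        1 - δ ≤ (TreeDecoding.obsLaw P Y p q).real
          {m | ∀ Yhat : Fin n → ℤˣ, P.IsOutput p δ m.1 m.2 Yhat →
            (hammingDist Yhat Y : ℝ) ≤
              C / (1 / 2 - q) ^ 2 * (P.probed.maxDegree * P.edgeDegStar) *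
                (4 ^ P.widStar * P.cutSum p
                  + P.edgeDegStar * P.maxExtEdges * Real.log (1 / δ)) *
                (P.wid + P.treeDeg * Real.log n)} ∧
        ∀ (root : Fin N) (X : TreeDecoding.EdgeObs P) (Z : TreeDecoding.VertexObs n),
          P.IsOutput p δ X Z (P.treeDecompositionDecoder p δ root X Z).val) ∧
    (∀ D : ℕ, ∃ C : ℝ, 0 < C ∧
      ∀ (n N : ℕ) (P : TreeDecoding.Setup n N), P.IsAdmissible → P.BoundedBy D →
        P.probed.Connected → 2 ≤ n →
      ∀ (Y : Fin n → ℤˣ) (p q : ℝ), 0 < p → p ≤ 1 → 0 ≤ q → q < 1 / 2 →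
        1 - 1 / (n : ℝ) ≤ (TreeDecoding.obsLaw P Y p q).real
          {m | ∀ Yhat : Fin n → ℤˣ, P.IsOutput p (1 / n) m.1 m.2 Yhat →
            (hammingDist Yhat Y : ℝ) ≤
              C / (1 / 2 - q) ^ 2 * Real.log n * (P.cutSum p + Real.log n)} ∧
        ∀ Δ : ℕ, (∀ i, Δ ≤ P.mincutStar i) →
          1 - 1 / (n : ℝ) ≤ (TreeDecoding.obsLaw P Y p q).real
            {m | ∀ Yhat : Fin n → ℤˣ, P.IsOutput p (1 / n) m.1 m.2 Yhat →
              (hammingDist Yhat Y : ℝ) ≤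
                C / (1 / 2 - q) ^ 2 * Real.log n * (p ^ ((Δ + 1) / 2) * n + Real.log n)} ∧
          ∀ (root : Fin N) (X : TreeDecoding.EdgeObs P) (Z : TreeDecoding.VertexObs n),
            ((P.treeDecompositionDecoder p (1 / n) root X Z).time : ℝ) ≤
              C * Real.log n ^ 2 * (⌈p ^ ((Δ : ℝ) / 2) * n⌉₊ : ℝ) ^ 2 * n ∧
            (Nonempty (P.tree ≃g SimpleGraph.pathGraph N) →
              ((P.treeDecompositionDecoder p (1 / n) root X Z).time : ℝ) ≤
                C * Real.log n ^ 2 * (⌈p ^ ((Δ : ℝ) / 2) * n⌉₊ : ℝ) * n)) := by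
  refine ⟨⟨67, by norm_num, fun n N P hP hc hn Y p q δ hp hp1 hq0 hq hδ hδ2 =>
    ⟨hP.measure_error_le hc hn Y ⟨hp.le, hp1⟩ hq0 hq hδ hδ2,
      hP.isOutput_decoder hc hp.le hδ (by linarith)⟩⟩, fun D => ?_⟩
  have herror := TreeDecoding.Setup.errorConst_nonneg D
  have htime := TreeDecoding.Setup.timeConst_nonneg D
  refine ⟨TreeDecoding.Setup.errorConst D + TreeDecoding.Setup.timeConst D + 1, by positivity,
    fun n N P hP hD hc hn Y p q hp hp1 hq0 hq => ?_⟩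
  have hpI : p ∈ Set.Icc (0 : ℝ) 1 := ⟨hp.le, hp1⟩
  refine ⟨hD.measure_error_le hP hc hn Y hpI hq0 hq le_rfl (by linarith), fun Δ hΔ =>
    ⟨hD.measure_error_le hP hc hn Y hpI hq0 hq (hP.cutSum_le (by omega) hpI hΔ) (by linarith),
      fun root X Z => ⟨hD.time_le hP hn hp hp1 hΔ root X Z (by linarith), fun ⟨φ⟩ =>
        hD.time_le_of_path hP hn hp hp1 hΔ φ root X Z (by linarith)⟩⟩⟩

theorem mainTheorem1 :
    -- the explicit bound, for every output of the algorithm, and correctness of the program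
    (∃ C : ℝ, 0 < C ∧
      ∀ (n N : ℕ) (P : TreeDecoding.Setup n N), P.IsAdmissible → P.probed.Connected → 2 ≤ n →
      ∀ (Y : Fin n → ℤˣ) (p q δ : ℝ), 0 < p → p < q → q < 1 / 2 → 0 < δ → δ ≤ 1 / 2 →
        1 - δ ≤ (TreeDecoding.obsLaw P Y p q).real
          {m | ∀ Yhat : Fin n → ℤˣ, P.IsOutput p δ m.1 m.2 Yhat →
            (hammingDist Yhat Y : ℝ) ≤
              C / (1 / 2 - q) ^ 2 * (P.probed.maxDegree * P.edgeDegStar) *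
                (4 ^ P.widStar * P.cutSum p
                  + P.edgeDegStar * P.maxExtEdges * Real.log (1 / δ)) *
                (P.wid + P.treeDeg * Real.log n)} ∧
        ∀ (root : Fin N) (X : TreeDecoding.EdgeObs P) (Z : TreeDecoding.VertexObs n),
          P.IsOutput p δ X Z (P.treeDecompositionDecoder p δ root X Z).val) ∧
    -- the rates for bounded parameters and failure probability `1 / n`
    (∀ D : ℕ, ∃ C : ℝ, 0 < C ∧
      ∀ (n N : ℕ) (P : TreeDecoding.Setup n N), P.IsAdmissible → P.BoundedBy D →
        P.probed.Connected → 2 ≤ n →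
      ∀ (Y : Fin n → ℤˣ) (p q : ℝ), 0 < p → p < q → q < 1 / 2 →
        -- the error in terms of the extended min-cuts
        1 - 1 / (n : ℝ) ≤ (TreeDecoding.obsLaw P Y p q).real
          {m | ∀ Yhat : Fin n → ℤˣ, P.IsOutput p (1 / n) m.1 m.2 Yhat →
            (hammingDist Yhat Y : ℝ) ≤
              C / (1 / 2 - q) ^ 2 * Real.log n * (P.cutSum p + Real.log n)} ∧
        ∀ Δ : ℕ, (∀ i, Δ ≤ P.mincutStar i) →
          -- the error in terms of a lower bound for the extended min-cuts
          1 - 1 / (n : ℝ) ≤ (TreeDecoding.obsLaw P Y p q).real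
            {m | ∀ Yhat : Fin n → ℤˣ, P.IsOutput p (1 / n) m.1 m.2 Yhat →
              (hammingDist Yhat Y : ℝ) ≤
                C / (1 / 2 - q) ^ 2 * Real.log n * (p ^ ((Δ + 1) / 2) * n + Real.log n)} ∧
          -- the running time
          ∀ (root : Fin N) (X : TreeDecoding.EdgeObs P) (Z : TreeDecoding.VertexObs n),
            ((P.treeDecompositionDecoder p (1 / n) root X Z).time : ℝ) ≤
              C * Real.log n ^ 2 * (⌈p ^ ((Δ : ℝ) / 2) * n⌉₊ : ℝ) ^ 2 * n ∧
            (Nonempty (P.tree ≃g SimpleGraph.pathGraph N) →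
              ((P.treeDecompositionDecoder p (1 / n) root X Z).time : ℝ) ≤
                C * Real.log n ^ 2 * (⌈p ^ ((Δ : ℝ) / 2) * n⌉₊ : ℝ) * n)) := by
  refine ⟨mainTheorem1_general.1.imp fun C h => ⟨h.1, fun n N P hP hc hn Y p q δ hp hpq hq =>
    h.2 n N P hP hc hn Y p q δ hp (by linarith) (by linarith) hq⟩, fun D =>
    (mainTheorem1_general.2 D).imp fun C h => ⟨h.1, fun n N P hP hD hc hn Y p q hp hpq hq =>
      h.2 n N P hP hD hc hn Y p q hp (by linarith) (by linarith) hq⟩⟩
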